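/- Let $n\ge 2$ and $\lambda>0$. Let $M$ be the set of smooth immersed closed curves $c:S^1\to\mathbb R^n$. For $c\in M$ write $L=\operatorname{len}(c)$ for its length, $D_s=|\partial_u c|^{-1}\partial_u$, $ds=|\partial_u c|\,du$, and $$\|h\|_{H^2,c}^2=\frac1L\int_{S^1}|h|^2\,ds+\lambda L^4\,\frac1L\int_{S^1}|D_s^2h|^2\,ds ,\qquad E(c)=\int_{S^1}|D_s^2c|^2\,ds .$$ Let $d(c_0,c_1)\in[0,\infty]$ be the infimum of $\int_0^1\|\partial_tC(\cdot,t)\|_{H^2,C(\cdot,t)}\,dt$ over all smooth homotopies $C$ of immersed closed curves with $C(\cdot,0)=c_0$ and $C(\cdot,1)=c_1\circ\varphi$ for some diffeomorphism $\varphi$ of $S^1$ (with $d=\infty$ if there is none). A continuous closed curve $c$ is said to be the limit curve of a sequence $(c_k)$ in $M$ if there are diffeomorphisms $\varphi_k$ of $S^1$ such that $c_k\circ\varphi_k\to c$ uniformly; it belongs to the completion of $M$ if it is the limit curve of a $d$-Cauchy sequence in $M$. A continuous closed curve $c$ admits a weak curvature $\kappa$ if, up to a (weakly) monotone continuous reparametrization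 of degree $\pm1$, it is an arclength-parametrized closed curve $\gamma:\mathbb R/\ell\mathbb Z\to\mathbb R^n$ with $\ell>0$ ($\gamma$ is $1$-Lipschitz and $|\gamma'|=1$ a.e.), and $\kappa=D_s^2c=\gamma''$ is an integrable function on $\mathbb R/\ell\mathbb Z$, in the sense of weak derivatives; then $E(c)=\int_0^\ell|\kappa|^2\,ds\in[0,\infty]$. Finally, for continuous closed curves $c_0,c_1$ let $\bar d(c_0,c_1)$ be the infimum of the same length functional over all $C^1$ paths $t\mapsto C(\cdot,t)$, $t\in[0,1]$, in $H^2(S^1,\mathbb R^n)$ that consist of immersed closed curves and satisfy $c_i=C(\cdot,i)\circ\sigma_i$ $(i=0,1)$ for some (weakly) monotone continuous maps $\sigma_i$ of $S^1$ onto itself of degree $\pm1$. **Theorem.** 1. $E$ is locally Lipschitz in $M$ with respect to $d$, with a local Lipschitz constant that depends on the length and the energy of the curve as follows: there are functions $r,K$ of the length, depending only on $\lambda$, with $r(\ell)>0$ for $\ell>0$, such that for all $c,c_1,c_2\in M$ with $d(c,c_1)<r(\operatorname{len} c)$ and $d(c,c_2)<r(\operatorname{len} c)$, $$|E(c_1)-E(c_2)|\le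 K(\operatorname{len}c)\,(1+E(c))\,d(c_1,c_2).$$ 2. Every $d$-Cauchy sequence in $M$ has a limit curve that is Lipschitz, and every non-constant curve $c$ in the completion of $M$ admits a weak curvature, which is a measurable function and satisfies $E(c)<\infty$. 3. Conversely, let $c$ be a non-constant closed curve that admits a weak curvature with $E(c)<\infty$. Then there is a $d$-Cauchy sequence $(c_k)$ in $M$ with limit curve $c$ and $\bar d(c,c_k)\to0$; in particular $c$ belongs to the completion of $M$. -/

import Mathlib

open scoped ENNReal ContDiff

noncomputable section

namespace SobolevCurves

/-- The ambient space `ℝⁿ` with its Euclidean norm. -/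
abbrev Euc (n : ℕ) : Type := EuclideanSpace ℝ (Fin n)

variable {n : ℕ}

/-! Closed curves, that is maps on the circle `S¹ = ℝ/ℤ`, are written as functions on `ℝ` of
period `1`. -/

/-- A closed (continuous) curve in `ℝⁿ`. -/
structure IsClosedCurve (c : ℝ → Euc n) : Prop where
  continuous : Continuous c
  periodic : Function.Periodic c 1

/-- A curve is non-constant. -/
def NonConstant (c : ℝ → Euc n) : Prop := ∃ x y, c x ≠ c y

/-- The elements of `M`: smooth immersed closed curves. -/
structure IsImmersedCurve (c : ℝ → Euc n) : Prop where
  smooth : ContDiff ℝ ∞ c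
  periodic : Function.Periodic c 1
  immersed : ∀ u, deriv c u ≠ 0

/-- Diffeomorphisms of the circle (of either orientation), through their lifts to `ℝ`. -/
structure IsCircleDiffeo (φ : ℝ → ℝ) : Prop where
  smooth : ContDiff ℝ ∞ φ
  deriv_ne_zero : ∀ x, deriv φ x ≠ 0
  degree : (∀ x, φ (x + 1) = φ x + 1) ∨ (∀ x, φ (x + 1) = φ x - 1)

/-- Monotone reparametrizations of a continuous closed curve: lifts of (weakly) monotone continuous
maps of the circle onto itself of degree `1` or `-1`. -/
structure IsReparam (σ : ℝ → ℝ) : Prop where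
  continuous : Continuous σ
  degree : (Monotone σ ∧ ∀ x, σ (x + 1) = σ x + 1) ∨ (Antitone σ ∧ ∀ x, σ (x + 1) = σ x - 1)

/-- Length of a curve. -/
def len (c : ℝ → Euc n) : ℝ := ∫ u in (0 : ℝ)..1, ‖deriv c u‖

/-- Derivative with respect to the arclength of `c`: `D_s h = |∂_u c|⁻¹ ∂_u h`. -/
def Ds (c h : ℝ → Euc n) : ℝ → Euc n := fun u => ‖deriv c u‖⁻¹ • deriv h u

/-- Elastic energy `E(c) = ∫ |D_s² c|² ds`. -/
def elasticEnergy (c : ℝ → Euc n) : ℝ :=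
  ∫ u in (0 : ℝ)..1, ‖Ds c (Ds c c) u‖ ^ 2 * ‖deriv c u‖

/-- `⟨h, k⟩_{H⁰} = L⁻¹ ∫ ⟨h, k⟩ ds`. -/
def innerH0 (c h k : ℝ → Euc n) : ℝ :=
  (len c)⁻¹ * ∫ u in (0 : ℝ)..1, inner ℝ (h u) (k u) * ‖deriv c u‖

/-- `⟨h, k⟩_{H²} = ⟨h, k⟩_{H⁰} + lam L⁴ ⟨D_s² h, D_s² k⟩_{H⁰}`. -/
def innerH2 (lam : ℝ) (c h k : ℝ → Euc n) : ℝ :=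
  innerH0 c h k + lam * len c ^ 4 * innerH0 c (Ds c (Ds c h)) (Ds c (Ds c k))

/-- The norm of the `H²` metric at the curve `c`. -/
def normH2 (lam : ℝ) (c h : ℝ → Euc n) : ℝ := √(innerH2 lam c h h)

/-- The `H²` length of a homotopy; `C t` is the curve at time `t ∈ [0, 1]`. -/
def pathLength (lam : ℝ) (C : ℝ → ℝ → Euc n) : ℝ≥0∞ :=
  ∫⁻ t in Set.Icc (0 : ℝ) 1,
    ENNReal.ofReal (normH2 lam (C t) (fun u => deriv (fun τ => C τ u) t))

/-- Smooth homotopies of immersed closed curves. -/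
structure IsSmoothPath (C : ℝ → ℝ → Euc n) : Prop where
  smooth : ContDiff ℝ ∞ (fun p : ℝ × ℝ => C p.1 p.2)
  immersed : ∀ t ∈ Set.Icc (0 : ℝ) 1, IsImmersedCurve (C t)

/-- The geometric distance on `M` induced by `H²`: the infimum of the lengths of the smooth
homotopies of immersed curves from `c₀` to a reparametrization of `c₁`
(it is `∞` if there is none). -/
def geomDist (lam : ℝ) (c₀ c₁ : ℝ → Euc n) : ℝ≥0∞ :=
  ⨅ (C : ℝ → ℝ → Euc n) (φ : ℝ → ℝ) (_ : IsSmoothPath C) (_ : IsCircleDiffeo φ)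
    (_ : ∀ u, C 0 u = c₀ u) (_ : ∀ u, C 1 u = c₁ (φ u)), pathLength lam C

/-- Cauchy sequences of curves for the geometric distance. -/
def IsCauchyH2 (lam : ℝ) (c : ℕ → ℝ → Euc n) : Prop :=
  ∀ ε : ℝ≥0∞, 0 < ε → ∃ N, ∀ k ≥ N, ∀ m ≥ N, geomDist lam (c k) (c m) < ε

/-- The curves `c k` converge to the curve `c` uniformly, up to reparametrization. -/
def ConvergesToCurve (c : ℕ → ℝ → Euc n) (c' : ℝ → Euc n) : Prop :=
  ∃ φ : ℕ → ℝ → ℝ, (∀ k, IsCircleDiffeo (φ k)) ∧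
    TendstoUniformly (fun k u => c k (φ k u)) c' Filter.atTop

/-- The closed curve `c` belongs to the completion of `M`: it is the limit curve of a Cauchy
sequence of `M`. -/
def InCompletion (lam : ℝ) (c : ℝ → Euc n) : Prop :=
  ∃ u : ℕ → ℝ → Euc n, (∀ k, IsImmersedCurve (u k)) ∧ IsCauchyH2 lam u ∧ ConvergesToCurve u c

/-- `γ` is a parametrization by arclength, of period (= total length) `ℓ > 0`, of the closed
curve `c`. -/
structure IsArcParam (c : ℝ → Euc n) (ℓ : ℝ) (γ : ℝ → Euc n) : Prop where
  pos : 0 < ℓ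
  periodic : Function.Periodic γ ℓ
  lipschitz : LipschitzWith 1 γ
  unit_speed : ∀ᵐ s, ‖deriv γ s‖ = 1
  reparam : ∃ σ, IsReparam σ ∧ ∀ u, c u = γ (ℓ * σ u)

/-- The measurable function `κ` is the weak second derivative on the circle `ℝ/ℓℤ` of the
arclength parametrization `γ`, that is, the weak curvature `D_s² c`. -/
structure IsWeakCurvature (ℓ : ℝ) (γ κ : ℝ → Euc n) : Prop where
  measurable : Measurable κ
  integrable : IntervalIntegrable κ MeasureTheory.volume 0 ℓ
  weak : ∀ η : ℝ → ℝ, ContDiff ℝ ∞ η → Function.Periodic η ℓ →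
    ∫ s in (0 : ℝ)..ℓ, deriv (deriv η) s • γ s = ∫ s in (0 : ℝ)..ℓ, η s • κ s

/-- `E = ∫ |κ|² ds` over one period, for a curvature `κ` given as a function of arclength. -/
def weakEnergy (ℓ : ℝ) (κ : ℝ → Euc n) : ℝ≥0∞ := ∫⁻ s in Set.Ioc 0 ℓ, ‖κ s‖ₑ ^ 2

/-- The curve `c` admits a weak curvature, and `E(c) < ∞`. -/
def HasFiniteEnergy (c : ℝ → Euc n) : Prop :=
  ∃ (ℓ : ℝ) (γ κ : ℝ → Euc n), IsArcParam c ℓ γ ∧ IsWeakCurvature ℓ γ κ ∧ weakEnergy ℓ κ < ⊤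

/-- `C¹` paths `[0, 1] → H²(S¹, ℝⁿ)` of immersed closed curves. A function `h` of class `H²` on
`[0, 1]` is determined by `(h 0, h' 0, h'') ∈ ℝⁿ × ℝⁿ × L²`, and this is an isomorphism of Banach
spaces; so the path is `C¹` when these three components are. -/
structure IsH2Path (C : ℝ → ℝ → Euc n) : Prop where
  periodic : ∀ t ∈ Set.Icc (0 : ℝ) 1, Function.Periodic (C t) 1
  contDiff : ∀ t ∈ Set.Icc (0 : ℝ) 1, ContDiff ℝ 1 (C t)
  immersed : ∀ t ∈ Set.Icc (0 : ℝ) 1, ∀ u, deriv (C t) u ≠ 0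
  c1_value : ContDiffOn ℝ 1 (fun t => C t 0) (Set.Icc 0 1)
  c1_deriv : ContDiffOn ℝ 1 (fun t => deriv (C t) 0) (Set.Icc 0 1)
  c1_second : ∃ W : ℝ → MeasureTheory.Lp (Euc n) 2
      (MeasureTheory.volume.restrict (Set.Ioc (0 : ℝ) 1)),
    ContDiffOn ℝ 1 W (Set.Icc 0 1) ∧
    ∀ t ∈ Set.Icc (0 : ℝ) 1, ∀ u ∈ Set.Icc (0 : ℝ) 1,
      deriv (C t) u = deriv (C t) 0 + ∫ s in (0 : ℝ)..u, W t s

/-- The geometric distance induced by `H²` on curves that need not be smooth: infimum of the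
lengths of the `C¹` paths of `H²` immersed curves that connect the two curves, up to
reparametrization. -/
def extGeomDist (lam : ℝ) (c₀ c₁ : ℝ → Euc n) : ℝ≥0∞ :=
  ⨅ (C : ℝ → ℝ → Euc n) (σ₀ : ℝ → ℝ) (σ₁ : ℝ → ℝ) (_ : IsH2Path C)
    (_ : IsReparam σ₀) (_ : IsReparam σ₁)
    (_ : ∀ u, c₀ u = C 0 (σ₀ u)) (_ : ∀ u, c₁ u = C 1 (σ₁ u)), pathLength lam C

end SobolevCurves

end

open MeasureTheory Filter Topology

namespace SobolevCurves

noncomputable section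

variable {n : ℕ}

/-! Everything rests on two Sobolev inequalities at an immersed curve of length L: a periodic field
h satisfies |D_s h| ≤ λ^{-1/2}‖h‖/L (`IsImmersedCurve.len_mul_norm_deriv_le`) and |h| ≤ (1 +
λ^{-1/2})‖h‖ (`IsImmersedCurve.norm_le_normH2`). The first holds because D_s h has mean zero in ds,
so that it is bounded by ∫|D_s²h| ds and Cauchy–Schwarz applies. Integrated along a homotopy, they
say that the points and the length move at most proportionally to the path length, and so does the
logarithm of the speed as long as the length stays above some m > 0.

Part 1. The first variation of E is ∫ 2⟨D_s²h, κ⟩ − 3⟨D_s h, T⟩|κ|² ds, which is at most a constant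
depending on λ and m, times (1 + E)‖h‖. Hence log(1 + E) is Lipschitz along short paths, so E is
bounded there, and then E itself is Lipschitz.

Part 2. A fast subsequence of a Cauchy sequence can be reparametrized by composing the
diffeomorphisms given by almost optimal paths. It then converges uniformly, with speeds controlled
by a convergent product (`exists_limitCurve`). If the limit curve is not constant, the lengths stay
away from 0 and the energies are bounded. Parametrized with constant speed, the curves have second
derivatives bounded in L²; a weak limit of these is the second derivative of a constant speed limit
(`exists_limit_of_constantSpeed`). The limit curve is this one composed with a limit of monotone
maps, which cannot jump (`continuous_of_monotone_limit`).

Part 3. A curve of finite energy is, up to a monotone map, an H² curve g of constant speed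
(`HasFiniteEnergy.exists_H2Curve`). Approximating g'' in L² by smooth functions of mean zero and
integrating twice gives smooth closed curves that are C¹ close to g. The linear homotopies between
them, and from g to them, therefore stay immersed, and their length is at most a constant times the
L² distance of the second derivatives (`pathLength_affine_near_le`). -/

/-- The constant `λ^{-1/2}`. -/
def isq (lam : ℝ) : ℝ := (√lam)⁻¹

lemma isq_pos {lam : ℝ} (hlam : 0 < lam) : 0 < isq lam := by
  unfold isq; positivity

lemma isq_sq {lam : ℝ} (hlam : 0 < lam) : isq lam ^ 2 * lam = 1 := by
  unfold isq
  rw [inv_pow, Real.sq_sqrt hlam.le, inv_mul_cancel₀ hlam.ne']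

/-! ### Pointwise calculus of the arclength derivative, and the weighted Cauchy–Schwarz inequality
-/

/-- The value of `D_s² h` when `c' = a`, `c'' = b`, `h' = x`, `h'' = y`. -/
def secondDs (a b x y : Euc n) : Euc n :=
  (‖a‖ ^ 2)⁻¹ • y - (inner ℝ a b * (‖a‖ ^ 4)⁻¹) • x

lemma hasDerivAt_inv_norm {f : ℝ → Euc n} {b : Euc n} {u : ℝ} (hf : HasDerivAt f b u)
    (h0 : f u ≠ 0) :
    HasDerivAt (fun v => ‖f v‖⁻¹) (-(inner ℝ (f u) b * (‖f u‖ ^ 3)⁻¹)) u := by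
  have hp : ‖f u‖ ≠ 0 := norm_ne_zero_iff.2 h0
  have h1 : HasDerivAt (fun v => ‖f v‖ ^ 2) (2 * inner ℝ (f u) b) u := hf.norm_sq
  have h2 := (h1.sqrt (by positivity)).inv (by positivity)
  simp only [Real.sqrt_sq (norm_nonneg _)] at h2
  refine HasDerivAt.congr_deriv (f := fun v => ‖f v‖⁻¹) h2 ?_
  field_simp

lemma hasDerivAt_norm' {f : ℝ → Euc n} {b : Euc n} {u : ℝ} (hf : HasDerivAt f b u)
    (h0 : f u ≠ 0) :
    HasDerivAt (fun v => ‖f v‖) (inner ℝ (f u) b * ‖f u‖⁻¹) u := by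
  have hp : ‖f u‖ ≠ 0 := norm_ne_zero_iff.2 h0
  have h1 : HasDerivAt (fun v => ‖f v‖ ^ 2) (2 * inner ℝ (f u) b) u := hf.norm_sq
  have h2 := (h1.sqrt (by positivity))
  simp only [Real.sqrt_sq (norm_nonneg _)] at h2
  convert h2 using 1
  field_simp

lemma hasDerivAt_Ds {c h : ℝ → Euc n} {b y : Euc n} {u : ℝ} (hc : HasDerivAt (deriv c) b u)
    (hh : HasDerivAt (deriv h) y u) (h0 : deriv c u ≠ 0) :
    HasDerivAt (Ds c h) (‖deriv c u‖ • secondDs (deriv c u) b (deriv h u) y) u := by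
  have hp : ‖deriv c u‖ ≠ 0 := norm_ne_zero_iff.2 h0
  have := (hasDerivAt_inv_norm hc h0).smul hh
  refine this.congr_deriv ?_
  simp only [secondDs, smul_sub, smul_smul]
  rw [sub_eq_add_neg, ← neg_smul]
  congr 2
  · field_simp
  · field_simp

/-- The second derivatives are required at the single point u only, so the formula also serves at
almost every point of an H² curve. -/
lemma Ds_Ds {c h : ℝ → Euc n} {b y : Euc n} {u : ℝ} (hc : HasDerivAt (deriv c) b u)
    (hh : HasDerivAt (deriv h) y u) (h0 : deriv c u ≠ 0) :
    Ds c (Ds c h) u = secondDs (deriv c u) b (deriv h u) y := by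
  have hp : ‖deriv c u‖ ≠ 0 := norm_ne_zero_iff.2 h0
  rw [Ds, (hasDerivAt_Ds hc hh h0).deriv, smul_smul, inv_mul_cancel₀ hp, one_smul]

lemma periodic_deriv {E : Type*} [NormedAddCommGroup E] [NormedSpace ℝ E] {f : ℝ → E} {T : ℝ}
    (hf : Function.Periodic f T) : Function.Periodic (deriv f) T := by
  intro x
  rw [← deriv_comp_add_const f T x]
  congr 1
  ext y
  exact hf y

lemma contDiff_deriv {E : Type*} [NormedAddCommGroup E] [NormedSpace ℝ E] {f : ℝ → E}
    (hf : ContDiff ℝ ∞ f) : ContDiff ℝ ∞ (deriv f) :=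
  (contDiff_infty_iff_deriv.1 hf).2

lemma hasDerivAt_deriv {E : Type*} [NormedAddCommGroup E] [NormedSpace ℝ E] {f : ℝ → E}
    (hf : ContDiff ℝ ∞ f) (u : ℝ) : HasDerivAt f (deriv f u) u :=
  (hf.differentiable (by simp)).differentiableAt.hasDerivAt

/-- The weighted Cauchy–Schwarz inequality on an interval. -/
lemma sq_integral_mul_le {f g w : ℝ → ℝ} {a b : ℝ} (hab : a ≤ b) (hw : ∀ u, 0 ≤ w u)
    (h1 : IntervalIntegrable (fun u => f u * g u * w u) volume a b)
    (h2 : IntervalIntegrable (fun u => f u ^ 2 * w u) volume a b)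
    (h3 : IntervalIntegrable (fun u => g u ^ 2 * w u) volume a b) :
    (∫ u in a..b, f u * g u * w u) ^ 2 ≤
      (∫ u in a..b, f u ^ 2 * w u) * ∫ u in a..b, g u ^ 2 * w u := by
  -- This quadratic form in (x, y) is ∫ (x f − y g)² w.
  have key : ∀ x y : ℝ, 0 ≤ x ^ 2 * (∫ u in a..b, f u ^ 2 * w u)
      - 2 * x * y * (∫ u in a..b, f u * g u * w u) + y ^ 2 * ∫ u in a..b, g u ^ 2 * w u := by
    intro x y
    rw [← intervalIntegral.integral_const_mul, ← intervalIntegral.integral_const_mul,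
      ← intervalIntegral.integral_const_mul,
      ← intervalIntegral.integral_sub (h2.const_mul _) (h1.const_mul _),
      ← intervalIntegral.integral_add ((h2.const_mul _).sub (h1.const_mul _)) (h3.const_mul _)]
    apply intervalIntegral.integral_nonneg hab
    intro u _
    have : 0 ≤ (x * f u - y * g u) ^ 2 * w u := mul_nonneg (sq_nonneg _) (hw u)
    linarith [this, show (x * f u - y * g u) ^ 2 * w u =
      x ^ 2 * (f u ^ 2 * w u) - 2 * x * y * (f u * g u * w u) + y ^ 2 * (g u ^ 2 * w u) by ring]
  set F := ∫ u in a..b, f u * g u * w u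
  set G := ∫ u in a..b, f u ^ 2 * w u
  set W := ∫ u in a..b, g u ^ 2 * w u
  have hW : 0 ≤ W :=
    intervalIntegral.integral_nonneg hab fun u _ => mul_nonneg (sq_nonneg _) (hw u)
  rcases hW.eq_or_lt with h0 | h0
  · rw [← h0] at key
    by_cases hF : F = 0
    · simp [hF, ← h0]
    -- For W = 0 and F ≠ 0 the form is affine in y; at this y its value is G − (G + 1) = −1.
    · have h1 := key 1 ((G + 1) / (2 * F))
      have h2 : 2 * 1 * ((G + 1) / (2 * F)) * F = G + 1 := by field_simp
      rw [h2] at h1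
      linarith
  -- At (W, F) the form equals W (G W − F²).
  · have h := key W F
    have : 0 ≤ W * (G * W - F ^ 2) := by nlinarith
    nlinarith [(mul_nonneg_iff_of_pos_left h0).1 this]

lemma sq_integral_le {f w : ℝ → ℝ} {a b : ℝ} (hab : a ≤ b) (hw : ∀ u, 0 ≤ w u)
    (h1 : IntervalIntegrable (fun u => f u * w u) volume a b)
    (h2 : IntervalIntegrable (fun u => f u ^ 2 * w u) volume a b)
    (h3 : IntervalIntegrable w volume a b) :
    (∫ u in a..b, f u * w u) ^ 2 ≤ (∫ u in a..b, f u ^ 2 * w u) * ∫ u in a..b, w u := by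
  simpa using sq_integral_mul_le (g := fun _ => 1) hab hw (by simpa using h1) h2 (by simpa using h3)

/-! ### Sobolev inequalities at a fixed immersed curve -/

section Sobolev

variable {c h : ℝ → Euc n}

lemma IsImmersedCurve.speed_pos (hc : IsImmersedCurve c) (u : ℝ) : 0 < ‖deriv c u‖ :=
  norm_pos_iff.2 (hc.immersed u)

lemma IsImmersedCurve.continuous_speed (hc : IsImmersedCurve c) :
    Continuous fun u => ‖deriv c u‖ := (contDiff_deriv hc.smooth).continuous.norm

lemma IsImmersedCurve.len_pos (hc : IsImmersedCurve c) : 0 < len c :=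
  intervalIntegral.intervalIntegral_pos_of_pos (hc.continuous_speed.intervalIntegrable _ _)
    hc.speed_pos one_pos

lemma IsImmersedCurve.integral_speed (hc : IsImmersedCurve c) (a : ℝ) :
    ∫ u in a..a + 1, ‖deriv c u‖ = len c := by
  have hp : Function.Periodic (fun u => ‖deriv c u‖) 1 := fun u => by
    simp only [periodic_deriv hc.periodic u]
  rw [hp.intervalIntegral_add_eq a 0, zero_add, len]

lemma IsImmersedCurve.Ds_Ds_eq (hc : IsImmersedCurve c) (hh : ContDiff ℝ ∞ h) (u : ℝ) :
    Ds c (Ds c h) u =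
      secondDs (deriv c u) (deriv (deriv c) u) (deriv h u) (deriv (deriv h) u) :=
  Ds_Ds (hasDerivAt_deriv (contDiff_deriv hc.smooth) u) (hasDerivAt_deriv (contDiff_deriv hh) u)
    (hc.immersed u)

lemma IsImmersedCurve.hasDerivAt_Ds (hc : IsImmersedCurve c) (hh : ContDiff ℝ ∞ h) (u : ℝ) :
    HasDerivAt (Ds c h) (‖deriv c u‖ • Ds c (Ds c h) u) u := by
  rw [hc.Ds_Ds_eq hh]
  exact SobolevCurves.hasDerivAt_Ds (hasDerivAt_deriv (contDiff_deriv hc.smooth) u)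
    (hasDerivAt_deriv (contDiff_deriv hh) u) (hc.immersed u)

lemma IsImmersedCurve.contDiff_Ds (hc : IsImmersedCurve c) (hh : ContDiff ℝ ∞ h) :
    ContDiff ℝ ∞ (Ds c h) :=
  (((contDiff_deriv hc.smooth).norm ℝ hc.immersed).inv
    fun u => (hc.speed_pos u).ne').smul (contDiff_deriv hh)

lemma Ds_periodic (hc : Function.Periodic c 1) (hh : Function.Periodic h 1) :
    Function.Periodic (Ds c h) 1 := fun u => by
  simp only [Ds, periodic_deriv hc u, periodic_deriv hh u]

/-- Multiplying by the length clears the averages in the metric. Dropping one of the two nonnegative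
terms on the right bounds the other. -/
lemma IsImmersedCurve.normH2_sq {lam : ℝ} (hlam : 0 < lam) (hc : IsImmersedCurve c) :
    len c * normH2 lam c h ^ 2 = (∫ u in (0 : ℝ)..1, ‖h u‖ ^ 2 * ‖deriv c u‖) +
      lam * len c ^ 4 * ∫ u in (0 : ℝ)..1, ‖Ds c (Ds c h) u‖ ^ 2 * ‖deriv c u‖ := by
  have hL := hc.len_pos
  have e : innerH2 lam c h h = (len c)⁻¹ * (∫ u in (0 : ℝ)..1, ‖h u‖ ^ 2 * ‖deriv c u‖) +
      lam * len c ^ 4 * ((len c)⁻¹ *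
        ∫ u in (0 : ℝ)..1, ‖Ds c (Ds c h) u‖ ^ 2 * ‖deriv c u‖) := by
    simp only [innerH2, innerH0, real_inner_self_eq_norm_sq]
  have h1 : 0 ≤ ∫ u in (0 : ℝ)..1, ‖h u‖ ^ 2 * ‖deriv c u‖ :=
    intervalIntegral.integral_nonneg zero_le_one fun u _ => by positivity
  have h2 : 0 ≤ ∫ u in (0 : ℝ)..1, ‖Ds c (Ds c h) u‖ ^ 2 * ‖deriv c u‖ :=
    intervalIntegral.integral_nonneg zero_le_one fun u _ => by positivity
  rw [normH2, Real.sq_sqrt (by rw [e]; positivity), e]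
  field_simp

lemma normH2_nonneg (lam : ℝ) (c h : ℝ → Euc n) : 0 ≤ normH2 lam c h := Real.sqrt_nonneg _

lemma IsImmersedCurve.integral_sq_le {lam : ℝ} (hlam : 0 < lam) (hc : IsImmersedCurve c) :
    ∫ u in (0 : ℝ)..1, ‖h u‖ ^ 2 * ‖deriv c u‖ ≤ len c * normH2 lam c h ^ 2 := by
  have hL := hc.len_pos
  rw [hc.normH2_sq hlam, le_add_iff_nonneg_right]
  have h2 : 0 ≤ ∫ u in (0 : ℝ)..1, ‖Ds c (Ds c h) u‖ ^ 2 * ‖deriv c u‖ :=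
    intervalIntegral.integral_nonneg zero_le_one fun u _ => by positivity
  positivity

lemma IsImmersedCurve.integral_Ds_sq_le {lam : ℝ} (hlam : 0 < lam) (hc : IsImmersedCurve c) :
    lam * len c ^ 3 * ∫ u in (0 : ℝ)..1, ‖Ds c (Ds c h) u‖ ^ 2 * ‖deriv c u‖
      ≤ normH2 lam c h ^ 2 := by
  have hL := hc.len_pos
  have h1 : 0 ≤ ∫ u in (0 : ℝ)..1, ‖h u‖ ^ 2 * ‖deriv c u‖ :=
    intervalIntegral.integral_nonneg zero_le_one fun u _ => by positivity
  have := hc.normH2_sq hlam (h := h)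
  refine le_of_mul_le_mul_left ?_ hL
  nlinarith

/-- Passes from an oscillation bound to a bound of the value minus the weighted mean. It is used
when the mean is zero (derivatives of closed curves) or controlled separately. The total weight is
left as a factor, so that no division is needed. -/
lemma norm_le_of_osc {f : ℝ → Euc n} {w : ℝ → ℝ} {B : ℝ} {a : ℝ} (hf : Continuous f)
    (hw : Continuous w) (hw0 : ∀ u, 0 ≤ w u) (x : Euc n) (h : ∀ u ∈ Set.Icc a (a + 1), ‖x - f u‖ ≤ B) :
    ‖(∫ u in a..a + 1, w u) • x - ∫ u in a..a + 1, w u • f u‖ ≤ B * ∫ u in a..a + 1, w u := by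
  rw [← intervalIntegral.integral_smul_const, ← intervalIntegral.integral_sub
    (Continuous.intervalIntegrable (by fun_prop) _ _)
    (Continuous.intervalIntegrable (by fun_prop) _ _),
    ← intervalIntegral.integral_const_mul]
  refine (intervalIntegral.norm_integral_le_integral_norm (by linarith)).trans ?_
  refine intervalIntegral.integral_mono_on (by linarith)
    (Continuous.intervalIntegrable (by fun_prop) _ _)
    (Continuous.intervalIntegrable (by fun_prop) _ _) fun u hu => ?_
  rw [← smul_sub, norm_smul, Real.norm_eq_abs, abs_of_nonneg (hw0 u), mul_comm]
  exact mul_le_mul_of_nonneg_right (h u hu) (hw0 u)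

lemma norm_sub_le_integral {f f' : ℝ → Euc n} {g : ℝ → ℝ} (hf : ∀ u, HasDerivAt f (f' u) u)
    (hf' : Continuous f') (hg : Continuous g) (hfg : ∀ u, ‖f' u‖ ≤ g u) {a x y : ℝ}
    (hx : x ∈ Set.Icc a (a + 1)) (hy : y ∈ Set.Icc a (a + 1)) :
    ‖f x - f y‖ ≤ ∫ u in a..a + 1, g u := by
  wlog hxy : y ≤ x generalizing x y
  · rw [norm_sub_rev]; exact this hy hx (le_of_not_ge hxy)
  have hg0 : ∀ u, 0 ≤ g u := fun u => (norm_nonneg _).trans (hfg u)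
  rw [← intervalIntegral.integral_eq_sub_of_hasDerivAt (fun u _ => hf u)
    (hf'.intervalIntegrable _ _)]
  refine (intervalIntegral.norm_integral_le_integral_norm hxy).trans ?_
  refine (intervalIntegral.integral_mono_on hxy (hf'.norm.intervalIntegrable _ _)
    (hg.intervalIntegrable _ _) fun u _ => hfg u).trans ?_
  exact intervalIntegral.integral_mono_interval hy.1 hxy hx.2 (ae_of_all _ hg0)
    (hg.intervalIntegrable _ _)

/-- `|D_s h| ≤ λ^{-1/2} ‖h‖ / L`. -/
lemma IsImmersedCurve.len_mul_norm_deriv_le {lam : ℝ} (hlam : 0 < lam) (hc : IsImmersedCurve c)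
    (hh : ContDiff ℝ ∞ h) (hp : Function.Periodic h 1) (u : ℝ) :
    len c * ‖deriv h u‖ ≤ ‖deriv c u‖ * (isq lam * normH2 lam c h) := by
  have hL := hc.len_pos
  have hD := hc.contDiff_Ds hh
  have hDD := hc.contDiff_Ds hD
  have hcont : Continuous fun v => ‖Ds c (Ds c h) v‖ * ‖deriv c v‖ :=
    hDD.continuous.norm.mul hc.continuous_speed
  set B := ∫ v in (0 : ℝ)..1, ‖Ds c (Ds c h) v‖ * ‖deriv c v‖ with hB
  have hB0 : 0 ≤ B := intervalIntegral.integral_nonneg zero_le_one fun u _ => by positivity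
  have hBp : ∫ v in u..u + 1, ‖Ds c (Ds c h) v‖ * ‖deriv c v‖ = B := by
    have hper : Function.Periodic (fun v => ‖Ds c (Ds c h) v‖ * ‖deriv c v‖) 1 := fun v => by
      simp only [periodic_deriv hc.periodic v,
        Ds_periodic hc.periodic (Ds_periodic hc.periodic hp) v]
    rw [hper.intervalIntegral_add_eq u 0, zero_add]
  -- The period is taken to start at u, so that u itself belongs to the interval of integration.
  have hosc : ∀ v ∈ Set.Icc u (u + 1), ‖Ds c h u - Ds c h v‖ ≤ B := fun v hv => by
    rw [← hBp]
    exact norm_sub_le_integral (fun w => hc.hasDerivAt_Ds hh w)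
      (hc.continuous_speed.smul hDD.continuous) hcont
      (fun w => by rw [norm_smul, norm_norm, mul_comm]) ⟨le_rfl, by linarith⟩ hv
  have h1 := norm_le_of_osc hD.continuous hc.continuous_speed (fun v => norm_nonneg _) _ hosc
  -- The mean of D_s h in ds is the integral of h' over a period.
  have h2 : ∫ v in u..u + 1, ‖deriv c v‖ • Ds c h v = 0 := by
    have : ∀ v, ‖deriv c v‖ • Ds c h v = deriv h v := fun v => by
      rw [Ds, smul_smul, mul_inv_cancel₀ (hc.speed_pos v).ne', one_smul]
    simp only [this]
    rw [intervalIntegral.integral_eq_sub_of_hasDerivAt (fun v _ => hasDerivAt_deriv hh v)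
      ((contDiff_deriv hh).continuous.intervalIntegrable _ _), hp u, sub_self]
  rw [h2, sub_zero, hc.integral_speed, norm_smul, Real.norm_eq_abs, abs_of_pos hL] at h1
  have h3 : ‖Ds c h u‖ ≤ B := le_of_mul_le_mul_left (by linarith) hL
  have h4 : B ^ 2 ≤ (∫ v in (0 : ℝ)..1, ‖Ds c (Ds c h) v‖ ^ 2 * ‖deriv c v‖) * len c :=
    sq_integral_le zero_le_one (fun v => norm_nonneg _) (hcont.intervalIntegrable _ _)
      (((hDD.continuous.norm.pow 2).mul hc.continuous_speed).intervalIntegrable _ _)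
      (hc.continuous_speed.intervalIntegrable _ _)
  have h5 := hc.integral_Ds_sq_le hlam (h := h)
  -- Powers of L: (L B)² ≤ L³ ∫|D_s²h|² ds, and λ L³ ∫|D_s²h|² ds is the second term of the metric,
  -- at most ‖h‖².
  have h6 : len c * B ≤ isq lam * normH2 lam c h := by
    refine abs_le_of_sq_le_sq' ?_ (mul_nonneg (isq_pos hlam).le (normH2_nonneg _ _ _)) |>.2
    calc (len c * B) ^ 2 = len c ^ 2 * B ^ 2 := by ring
      _ ≤ len c ^ 2 * ((∫ v in (0 : ℝ)..1, ‖Ds c (Ds c h) v‖ ^ 2 * ‖deriv c v‖) * len c) := by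
        gcongr
      _ = isq lam ^ 2 * (lam * len c ^ 3 *
          ∫ v in (0 : ℝ)..1, ‖Ds c (Ds c h) v‖ ^ 2 * ‖deriv c v‖) := by
        linear_combination (-(len c ^ 3 * ∫ v in (0 : ℝ)..1,
          ‖Ds c (Ds c h) v‖ ^ 2 * ‖deriv c v‖)) * isq_sq hlam
      _ ≤ isq lam ^ 2 * normH2 lam c h ^ 2 := by gcongr
      _ = _ := by ring
  have h7 : ‖deriv h u‖ = ‖deriv c u‖ * ‖Ds c h u‖ := by
    rw [Ds, norm_smul, norm_inv, norm_norm, mul_inv_cancel_left₀ (hc.speed_pos u).ne']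
  rw [h7]
  calc len c * (‖deriv c u‖ * ‖Ds c h u‖) = ‖deriv c u‖ * (len c * ‖Ds c h u‖) := by ring
    _ ≤ ‖deriv c u‖ * (len c * B) := by gcongr
    _ ≤ _ := by gcongr

/-- `|h| ≤ (1 + λ^{-1/2}) ‖h‖`. -/
lemma IsImmersedCurve.norm_le_normH2 {lam : ℝ} (hlam : 0 < lam) (hc : IsImmersedCurve c)
    (hh : ContDiff ℝ ∞ h) (hp : Function.Periodic h 1) (u : ℝ) :
    ‖h u‖ ≤ (1 + isq lam) * normH2 lam c h := by
  have hL := hc.len_pos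
  have hN := normH2_nonneg lam c h
  have hmu := isq_pos hlam
  have hosc : ∀ v ∈ Set.Icc u (u + 1), ‖h u - h v‖ ≤ isq lam * normH2 lam c h := fun v hv => by
    have : ∫ w in u..u + 1, (isq lam * normH2 lam c h / len c) * ‖deriv c w‖ =
        isq lam * normH2 lam c h := by
      rw [intervalIntegral.integral_const_mul, hc.integral_speed]
      field_simp
    rw [← this]
    refine norm_sub_le_integral (fun w => hasDerivAt_deriv hh w)
      (contDiff_deriv hh).continuous (g := fun w => isq lam * normH2 lam c h / len c * ‖deriv c w‖)
      (continuous_const.mul hc.continuous_speed) (fun w => ?_) ⟨le_rfl, by linarith⟩ hv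
    rw [div_mul_eq_mul_div, le_div_iff₀ hL]
    linarith [hc.len_mul_norm_deriv_le hlam hh hp w]
  have h1 := norm_le_of_osc hh.continuous hc.continuous_speed (fun v => norm_nonneg _) _ hosc
  rw [hc.integral_speed] at h1
  -- The mean of h is controlled by the zeroth order term of the metric through Cauchy–Schwarz.
  have h2 : ‖∫ v in u..u + 1, ‖deriv c v‖ • h v‖ ≤ len c * normH2 lam c h := by
    have e1 : ‖∫ v in u..u + 1, ‖deriv c v‖ • h v‖ ≤ ∫ v in (0 : ℝ)..1, ‖h v‖ * ‖deriv c v‖ := by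
      have hper : Function.Periodic (fun v => ‖h v‖ * ‖deriv c v‖) 1 := fun v => by
        simp only [periodic_deriv hc.periodic v, hp v]
      have := hper.intervalIntegral_add_eq u 0
      rw [zero_add] at this
      rw [← this]
      refine (intervalIntegral.norm_integral_le_integral_norm (by linarith)).trans_eq ?_
      simp only [norm_smul, norm_norm, mul_comm]
    refine e1.trans (abs_le_of_sq_le_sq' ?_ (by positivity)).2
    have e2 := sq_integral_le zero_le_one (fun v => norm_nonneg (deriv c v))
      ((hh.continuous.norm.mul hc.continuous_speed).intervalIntegrable _ _)
      (((hh.continuous.norm.pow 2).mul hc.continuous_speed).intervalIntegrable _ _)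
      (hc.continuous_speed.intervalIntegrable _ _)
    refine e2.trans ?_
    calc _ ≤ (len c * normH2 lam c h ^ 2) * len c :=
          mul_le_mul_of_nonneg_right (hc.integral_sq_le hlam) hL.le
      _ = _ := by ring
  have h3 : ‖len c • h u‖ ≤ isq lam * normH2 lam c h * len c + len c * normH2 lam c h :=
    (norm_le_norm_sub_add _ _).trans (add_le_add h1 h2)
  rw [norm_smul, Real.norm_eq_abs, abs_of_pos hL] at h3
  refine le_of_mul_le_mul_left ?_ hL
  linarith

end Sobolev

/-! ### Partial derivatives of smooth maps of two variables -/

section PartialDerivatives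

variable {E : Type*} [NormedAddCommGroup E] [NormedSpace ℝ E] {F : ℝ → ℝ → E}

lemma hasDerivAt_fst {p : ℝ × ℝ} {F' : ℝ × ℝ →L[ℝ] E}
    (hF : HasFDerivAt (fun p : ℝ × ℝ => F p.1 p.2) F' p) :
    HasDerivAt (fun τ => F τ p.2) (F' (1, 0)) p.1 := by
  have h : HasDerivAt (fun τ : ℝ => (τ, p.2)) ((1 : ℝ), (0 : ℝ)) p.1 :=
    (hasDerivAt_id _).prodMk (hasDerivAt_const _ _)
  exact HasFDerivAt.comp_hasDerivAt (f := fun τ : ℝ => (τ, p.2)) p.1 hF h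

lemma hasDerivAt_snd {p : ℝ × ℝ} {F' : ℝ × ℝ →L[ℝ] E}
    (hF : HasFDerivAt (fun p : ℝ × ℝ => F p.1 p.2) F' p) :
    HasDerivAt (F p.1) (F' (0, 1)) p.2 := by
  have h : HasDerivAt (fun v : ℝ => (p.1, v)) ((0 : ℝ), (1 : ℝ)) p.2 :=
    (hasDerivAt_const _ _).prodMk (hasDerivAt_id _)
  exact HasFDerivAt.comp_hasDerivAt (f := fun v : ℝ => (p.1, v)) p.2 hF h

variable (hF : ContDiff ℝ ∞ (fun p : ℝ × ℝ => F p.1 p.2))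
include hF

lemma partial_fst_eq (p : ℝ × ℝ) : deriv (fun τ => F τ p.2) p.1 =
    fderiv ℝ (fun p : ℝ × ℝ => F p.1 p.2) p (1, 0) :=
  (hasDerivAt_fst ((hF.differentiable (by simp)) p).hasFDerivAt).deriv

lemma partial_snd_eq (p : ℝ × ℝ) : deriv (F p.1) p.2 =
    fderiv ℝ (fun p : ℝ × ℝ => F p.1 p.2) p (0, 1) :=
  (hasDerivAt_snd ((hF.differentiable (by simp)) p).hasFDerivAt).deriv

lemma contDiff_partial_fst :
    ContDiff ℝ ∞ (fun p : ℝ × ℝ => deriv (fun τ => F τ p.2) p.1) := by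
  simp only [partial_fst_eq hF]
  exact (hF.fderiv_right (by simp)).clm_apply contDiff_const

lemma contDiff_partial_snd : ContDiff ℝ ∞ (fun p : ℝ × ℝ => deriv (F p.1) p.2) := by
  simp only [partial_snd_eq hF]
  exact (hF.fderiv_right (by simp)).clm_apply contDiff_const

lemma contDiff_slice_snd (t : ℝ) : ContDiff ℝ ∞ (F t) :=
  hF.comp (contDiff_const.prodMk contDiff_id)

lemma contDiff_slice_fst (u : ℝ) : ContDiff ℝ ∞ (fun τ => F τ u) :=
  hF.comp (contDiff_id.prodMk contDiff_const)

/-- Symmetry of the second Fréchet derivative. It identifies the time derivative of c' with the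
space derivative of the velocity. -/
lemma partial_comm (t u : ℝ) : deriv (fun τ => deriv (F τ) u) t =
    deriv (fun v => deriv (fun τ => F τ v) t) u := by
  have h2 : ContDiff ℝ ∞ (fderiv ℝ (fun p : ℝ × ℝ => F p.1 p.2)) := hF.fderiv_right (by simp)
  have hd := ((h2.differentiable (by simp)) (t, u)).hasFDerivAt
  have e1 := hasDerivAt_fst (F := fun τ v => deriv (F τ) v) (p := (t, u))
    (F' := (ContinuousLinearMap.apply ℝ E ((0 : ℝ), (1 : ℝ))).comp
      (fderiv ℝ (fderiv ℝ (fun p : ℝ × ℝ => F p.1 p.2)) (t, u))) (by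
      simp only [partial_snd_eq hF]
      exact (ContinuousLinearMap.apply ℝ E ((0 : ℝ), (1 : ℝ))).hasFDerivAt.comp _ hd)
  have e2 := hasDerivAt_snd (F := fun t v => deriv (fun τ => F τ v) t) (p := (t, u))
    (F' := (ContinuousLinearMap.apply ℝ E ((1 : ℝ), (0 : ℝ))).comp
      (fderiv ℝ (fderiv ℝ (fun p : ℝ × ℝ => F p.1 p.2)) (t, u))) (by
      simp only [partial_fst_eq hF]
      exact (ContinuousLinearMap.apply ℝ E ((1 : ℝ), (0 : ℝ))).hasFDerivAt.comp _ hd)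
  rw [e1.deriv, e2.deriv]
  have hs : IsSymmSndFDerivAt ℝ (fun p : ℝ × ℝ => F p.1 p.2) (t, u) :=
    (contDiff_infty.1 hF 2).contDiffAt.isSymmSndFDerivAt (by simp)
  exact hs.eq _ _

end PartialDerivatives

/-! ### Homotopies and their velocity -/

/-- The velocity of a homotopy. -/
def velocity (C : ℝ → ℝ → Euc n) (t : ℝ) : ℝ → Euc n := fun u => deriv (fun τ => C τ u) t

section Path

variable {C : ℝ → ℝ → Euc n}

lemma IsSmoothPath.contDiff_velocity (hC : IsSmoothPath C) :
    ContDiff ℝ ∞ (fun p : ℝ × ℝ => velocity C p.1 p.2) := contDiff_partial_fst hC.smooth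

lemma IsSmoothPath.hasDerivAt_time (hC : IsSmoothPath C) (t u : ℝ) :
    HasDerivAt (fun τ => C τ u) (velocity C t u) t :=
  hasDerivAt_deriv (contDiff_slice_fst hC.smooth u) t

lemma IsSmoothPath.hasDerivAt_time_deriv (hC : IsSmoothPath C) (t u : ℝ) :
    HasDerivAt (fun τ => deriv (C τ) u) (deriv (velocity C t) u) t := by
  have := hasDerivAt_deriv (contDiff_slice_fst (F := fun τ v => deriv (C τ) v)
    (contDiff_partial_snd hC.smooth) u) t
  rwa [partial_comm hC.smooth] at this

lemma IsSmoothPath.hasDerivAt_time_deriv_deriv (hC : IsSmoothPath C) (t u : ℝ) :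
    HasDerivAt (fun τ => deriv (deriv (C τ)) u) (deriv (deriv (velocity C t)) u) t := by
  have h1 := contDiff_partial_snd (F := fun τ v => deriv (C τ) v) (contDiff_partial_snd hC.smooth)
  have := hasDerivAt_deriv (contDiff_slice_fst
    (F := fun τ v => deriv (deriv (C τ)) v) h1 u) t
  rw [partial_comm (F := fun τ v => deriv (C τ) v) (contDiff_partial_snd hC.smooth)] at this
  simp only [partial_comm hC.smooth] at this
  exact this

/-- The curves are known to be closed only for times in [0, 1], so the two-sided time derivative
inherits periodicity at interior times only. The bounds of derivatives along paths are stated on the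
open interval for this reason. -/
lemma IsSmoothPath.periodic_velocity (hC : IsSmoothPath C) {t : ℝ} (ht : t ∈ Set.Ioo (0 : ℝ) 1) :
    Function.Periodic (velocity C t) 1 := fun u => by
  refine Filter.EventuallyEq.deriv_eq ?_
  filter_upwards [Icc_mem_nhds ht.1 ht.2] with τ hτ
  exact (hC.immersed τ hτ).periodic u

end Path

/-! ### Calculus along a path: integrated derivative bounds and integrals with a parameter -/

/-- Integration of a derivative bounded by the speed of a path. -/
lemma enorm_sub_le_of_deriv_le {E : Type*} [NormedAddCommGroup E] [NormedSpace ℝ E]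
    [CompleteSpace E] {f f' : ℝ → E} {N : ℝ → ℝ} {A : ℝ} (hA : 0 ≤ A)
    (hf : ContinuousOn f (Set.Icc 0 1)) (hf' : ∀ t ∈ Set.Ioo (0 : ℝ) 1, HasDerivAt f (f' t) t)
    (hf'c : ContinuousOn f' (Set.Icc 0 1)) (hb : ∀ t ∈ Set.Ioo (0 : ℝ) 1, ‖f' t‖ ≤ A * N t)
    {t : ℝ} (ht : t ∈ Set.Icc (0 : ℝ) 1) :
    ‖f t - f 0‖ₑ ≤ ENNReal.ofReal A * ∫⁻ t in Set.Icc (0 : ℝ) 1, ENNReal.ofReal (N t) := by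
  have hsub : Set.Icc 0 t ⊆ Set.Icc (0 : ℝ) 1 := Set.Icc_subset_Icc_right ht.2
  rw [← intervalIntegral.integral_eq_sub_of_hasDerivAt_of_le ht.1 (hf.mono hsub)
    (fun x hx => hf' x ⟨hx.1, hx.2.trans_le ht.2⟩)
    ((hf'c.mono hsub).intervalIntegrable_of_Icc ht.1),
    intervalIntegral.integral_of_le ht.1]
  refine (enorm_integral_le_lintegral_enorm _).trans ?_
  -- Removing the end points, a null set, leaves only times at which the bound holds. A finite
  -- constant leaves the lower integral without any measurability of N.
  rw [← lintegral_const_mul' _ _ ENNReal.ofReal_ne_top, ← restrict_Ioo_eq_restrict_Ioc,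
    ← restrict_Ioo_eq_restrict_Icc]
  refine (lintegral_mono' (Measure.restrict_mono (Set.Ioo_subset_Ioo_right ht.2) le_rfl) 
    le_rfl).trans ?_
  refine setLIntegral_mono' measurableSet_Ioo fun x hx => ?_
  rw [← ENNReal.ofReal_mul hA, ← ofReal_norm]
  exact ENNReal.ofReal_le_ofReal (hb x hx)

lemma continuousOn_integral_of_continuousOn {Φ : ℝ → ℝ → ℝ}
    (hΦ : ContinuousOn (fun p : ℝ × ℝ => Φ p.1 p.2) (Set.Icc 0 1 ×ˢ Set.Icc 0 1)) :
    ContinuousOn (fun t => ∫ u in (0 : ℝ)..1, Φ t u) (Set.Icc 0 1) := by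
  have h01 : (0 : ℝ) ≤ 1 := zero_le_one
  -- The integrand is continuous only on the square. Composing both variables with the projection
  -- onto [0, 1] makes it continuous everywhere and does not change it on the square.
  set P : ℝ → ℝ := fun x => (Set.projIcc (0 : ℝ) 1 h01 x : ℝ)
  have hP : Continuous P := continuous_subtype_val.comp continuous_projIcc
  have hPm : ∀ x, P x ∈ Set.Icc (0 : ℝ) 1 := fun x => (Set.projIcc (0 : ℝ) 1 h01 x).2
  have hPe : ∀ x ∈ Set.Icc (0 : ℝ) 1, P x = x := fun x hx => by
    simp [P, Set.projIcc_of_mem h01 hx]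
  have hc : Continuous (fun p : ℝ × ℝ => Φ (P p.1) (P p.2)) :=
    hΦ.comp_continuous (f := fun p : ℝ × ℝ => (P p.1, P p.2))
      ((hP.comp continuous_fst).prodMk (hP.comp continuous_snd)) fun p => ⟨hPm _, hPm _⟩
  have := intervalIntegral.continuous_parametric_intervalIntegral_of_continuous'
    (μ := volume) (f := fun t u => Φ (P t) (P u)) hc 0 1
  refine this.continuousOn.congr fun t ht => ?_
  refine intervalIntegral.integral_congr fun u hu => ?_
  rw [Set.uIcc_of_le h01] at hu
  simp only [hPe t ht, hPe u hu]

lemma hasDerivAt_integral_of_continuousOn {Φ Φ' : ℝ → ℝ → ℝ}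
    (hΦ : ContinuousOn (fun p : ℝ × ℝ => Φ p.1 p.2) (Set.Icc 0 1 ×ˢ Set.Icc 0 1))
    (hΦ' : ContinuousOn (fun p : ℝ × ℝ => Φ' p.1 p.2) (Set.Icc 0 1 ×ˢ Set.Icc 0 1))
    (hd : ∀ t ∈ Set.Icc (0 : ℝ) 1, ∀ u ∈ Set.Icc (0 : ℝ) 1,
      HasDerivAt (fun τ => Φ τ u) (Φ' t u) t) {t : ℝ} (ht : t ∈ Set.Ioo (0 : ℝ) 1) :
    HasDerivAt (fun t => ∫ u in (0 : ℝ)..1, Φ t u) (∫ u in (0 : ℝ)..1, Φ' t u) t := by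
  obtain ⟨B, hB⟩ := (isCompact_Icc.prod isCompact_Icc).exists_bound_of_continuousOn hΦ'
  have hm : Set.uIoc (0 : ℝ) 1 = Set.Ioc 0 1 := Set.uIoc_of_le zero_le_one
  have hsl : ∀ {Ψ : ℝ → ℝ → ℝ} (_ : ContinuousOn (fun p : ℝ × ℝ => Ψ p.1 p.2)
      (Set.Icc 0 1 ×ˢ Set.Icc 0 1)) (τ : ℝ), τ ∈ Set.Ioo (0 : ℝ) 1 →
      ContinuousOn (Ψ τ) (Set.Icc 0 1) := fun {Ψ} hΨ τ hτ =>
    hΨ.comp (f := fun u => (τ, u)) (by fun_prop) fun u hu => ⟨Set.Ioo_subset_Icc_self hτ, hu⟩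
  refine (intervalIntegral.hasDerivAt_integral_of_dominated_loc_of_deriv_le
    (F := Φ) (F' := Φ') (bound := fun _ => B)
    (s := Set.Ioo (0 : ℝ) 1) (isOpen_Ioo.mem_nhds ht) ?_ ?_ ?_ ?_ (by simp) ?_).2
  · filter_upwards [isOpen_Ioo.mem_nhds ht] with τ hτ
    rw [hm]
    exact ((hsl hΦ τ hτ).mono Set.Ioc_subset_Icc_self).aestronglyMeasurable measurableSet_Ioc
  · exact (hsl hΦ t ht).intervalIntegrable_of_Icc zero_le_one
  · rw [hm]
    exact ((hsl hΦ' t ht).mono Set.Ioc_subset_Icc_self).aestronglyMeasurable measurableSet_Ioc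
  · refine ae_of_all _ fun u hu τ hτ => hB (τ, u) ⟨Set.Ioo_subset_Icc_self hτ, ?_⟩
    rw [hm] at hu
    exact Set.Ioc_subset_Icc_self hu
  · refine ae_of_all _ fun u hu τ hτ => ?_
    rw [hm] at hu
    exact hd τ (Set.Ioo_subset_Icc_self hτ) u (Set.Ioc_subset_Icc_self hu)

/-! ### The energy density and its first variation -/

/-- The integrand of the elastic energy when `c' = a`, `c'' = b`. -/
def energyDensity (a b : Euc n) : ℝ := ‖secondDs a b a b‖ ^ 2 * ‖a‖

/-- Expanding the square leaves a polynomial in |a|⁻¹, ⟨b, b⟩ and ⟨a, b⟩, a form that is easy to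
differentiate. -/
lemma energyDensity_eq {a : Euc n} (ha : a ≠ 0) (b : Euc n) :
    energyDensity a b = ‖a‖⁻¹ ^ 3 * inner ℝ b b - ‖a‖⁻¹ ^ 5 * inner ℝ a b ^ 2 := by
  have hp : ‖a‖ ≠ 0 := norm_ne_zero_iff.2 ha
  rw [energyDensity, secondDs, ← real_inner_self_eq_norm_sq]
  simp only [inner_sub_left, inner_sub_right, real_inner_smul_left, real_inner_smul_right,
    real_inner_comm a b]
  rw [real_inner_self_eq_norm_sq a]
  field_simp
  ring

/-- First variation of |κ|² ds: the two arclength derivatives in κ contribute −4⟨D_s h, T⟩|κ|² and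
ds contributes +1 times the same. The remaining term is tangential and disappears since κ is
orthogonal to T. -/
lemma hasDerivAt_energyDensity {α β : ℝ → Euc n} {x y : Euc n} {t : ℝ} (hα : HasDerivAt α x t)
    (hβ : HasDerivAt β y t) (h0 : α t ≠ 0) :
    HasDerivAt (fun τ => energyDensity (α τ) (β τ))
      (2 * inner ℝ (secondDs (α t) (β t) x y) (secondDs (α t) (β t) (α t) (β t)) * ‖α t‖
        - 3 * (inner ℝ (α t) x * (‖α t‖ ^ 2)⁻¹) * energyDensity (α t) (β t)) t := by
  have hp : ‖α t‖ ≠ 0 := norm_ne_zero_iff.2 h0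
  have hi := hasDerivAt_inv_norm hα h0
  have h1 := ((hi.pow 3).mul (hβ.inner ℝ hβ)).sub ((hi.pow 5).mul ((hα.inner ℝ hβ).pow 2))
  have h2 : (fun τ => energyDensity (α τ) (β τ)) =ᶠ[𝓝 t]
      fun τ => ‖α τ‖⁻¹ ^ 3 * inner ℝ (β τ) (β τ) - ‖α τ‖⁻¹ ^ 5 * inner ℝ (α τ) (β τ) ^ 2 := by
    filter_upwards [hα.continuousAt.eventually_ne h0] with τ hτ
    exact energyDensity_eq hτ _
  refine (HasDerivAt.congr_of_eventuallyEq h1 h2).congr_deriv ?_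
  rw [energyDensity_eq h0]
  simp only [secondDs, inner_sub_left, inner_sub_right, real_inner_smul_left,
    real_inner_smul_right]
  simp only [Pi.pow_apply, real_inner_comm (α t) x, real_inner_comm (α t) y,
    real_inner_comm y (β t), inv_pow, Nat.add_one_sub_one]
  push_cast
  field_simp
  ring

lemma IsImmersedCurve.elasticEnergy_eq {c : ℝ → Euc n} (hc : IsImmersedCurve c) :
    elasticEnergy c = ∫ u in (0 : ℝ)..1, energyDensity (deriv c u) (deriv (deriv c) u) := by
  simp only [elasticEnergy, hc.Ds_Ds_eq hc.smooth, energyDensity]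

lemma elasticEnergy_nonneg (c : ℝ → Euc n) : 0 ≤ elasticEnergy c :=
  intervalIntegral.integral_nonneg zero_le_one fun u _ => by positivity

lemma continuousOn_secondDs {X : Type*} [TopologicalSpace X] {s : Set X} {a b x y : X → Euc n}
    (ha : ContinuousOn a s) (hb : ContinuousOn b s) (hx : ContinuousOn x s)
    (hy : ContinuousOn y s) (h0 : ∀ p ∈ s, a p ≠ 0) :
    ContinuousOn (fun p => secondDs (a p) (b p) (x p) (y p)) s := by
  have h1 : ∀ k : ℕ, ContinuousOn (fun p => (‖a p‖ ^ k)⁻¹) s := fun k =>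
    (ha.norm.pow k).inv₀ fun p hp => pow_ne_zero _ (norm_ne_zero_iff.2 (h0 p hp))
  exact ((h1 2).smul hy).sub (((ha.inner hb).mul (h1 4)).smul hx)

/-- The growth constant of the elastic energy along paths of curves of length at least `m`. -/
def energyConst (lam m : ℝ) : ℝ := isq (lam * m ^ 3) + 3 * isq lam / m

lemma energyConst_pos {lam m : ℝ} (hlam : 0 < lam) (hm : 0 < m) : 0 < energyConst lam m := by
  have := isq_pos hlam
  have := isq_pos (show 0 < lam * m ^ 3 by positivity)
  unfold energyConst
  positivity

/-! ### Growth of position, length, speed and energy along a homotopy -/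

section PathEstimates

variable {C : ℝ → ℝ → Euc n} {lam : ℝ}

lemma IsSmoothPath.continuous_deriv (hC : IsSmoothPath C) :
    Continuous fun p : ℝ × ℝ => deriv (C p.1) p.2 := (contDiff_partial_snd hC.smooth).continuous

lemma IsSmoothPath.continuous_deriv_deriv (hC : IsSmoothPath C) :
    Continuous fun p : ℝ × ℝ => deriv (deriv (C p.1)) p.2 :=
  (contDiff_partial_snd (F := fun τ v => deriv (C τ) v)
    (contDiff_partial_snd hC.smooth)).continuous

lemma IsSmoothPath.continuous_deriv_velocity (hC : IsSmoothPath C) :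
    Continuous fun p : ℝ × ℝ => deriv (velocity C p.1) p.2 :=
  (contDiff_partial_snd hC.contDiff_velocity).continuous

lemma IsSmoothPath.continuous_deriv_deriv_velocity (hC : IsSmoothPath C) :
    Continuous fun p : ℝ × ℝ => deriv (deriv (velocity C p.1)) p.2 :=
  (contDiff_partial_snd (F := fun τ v => deriv (velocity C τ) v)
    (contDiff_partial_snd hC.contDiff_velocity)).continuous

lemma IsSmoothPath.contDiff_velocity_slice (hC : IsSmoothPath C) (t : ℝ) :
    ContDiff ℝ ∞ (velocity C t) := contDiff_slice_snd hC.contDiff_velocity t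

lemma continuous_slice {X : Type*} [TopologicalSpace X] {F : ℝ → ℝ → X}
    (hF : Continuous fun p : ℝ × ℝ => F p.1 p.2) (u : ℝ) : Continuous fun t => F t u :=
  hF.comp (continuous_id.prodMk continuous_const)

/-- A path moves the points by at most `1 + λ^{-1/2}` times its length. -/
lemma IsSmoothPath.enorm_sub_le (hlam : 0 < lam) (hC : IsSmoothPath C) {t : ℝ}
    (ht : t ∈ Set.Icc (0 : ℝ) 1) (u : ℝ) :
    ‖C t u - C 0 u‖ₑ ≤ ENNReal.ofReal (1 + isq lam) * pathLength lam C := by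
  have := isq_pos hlam
  refine enorm_sub_le_of_deriv_le (f := fun t => C t u) (f' := fun t => velocity C t u)
    (N := fun t => normH2 lam (C t) (velocity C t)) (by positivity)
    (continuous_slice hC.smooth.continuous u).continuousOn (fun t _ => hC.hasDerivAt_time t u)
    (continuous_slice hC.contDiff_velocity.continuous u).continuousOn (fun t ht => ?_) ht
  exact (hC.immersed t (Set.Ioo_subset_Icc_self ht)).norm_le_normH2 hlam
    (hC.contDiff_velocity_slice t) (hC.periodic_velocity ht) u

lemma IsSmoothPath.len_mul_norm_deriv_velocity_le (hlam : 0 < lam) (hC : IsSmoothPath C) {t : ℝ}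
    (ht : t ∈ Set.Ioo (0 : ℝ) 1) (u : ℝ) :
    len (C t) * ‖deriv (velocity C t) u‖ ≤
      ‖deriv (C t) u‖ * (isq lam * normH2 lam (C t) (velocity C t)) :=
  (hC.immersed t (Set.Ioo_subset_Icc_self ht)).len_mul_norm_deriv_le hlam
    (hC.contDiff_velocity_slice t) (hC.periodic_velocity ht) u

lemma abs_inner_mul_inv_norm_le (a x : Euc n) : |inner ℝ a x * ‖a‖⁻¹| ≤ ‖x‖ := by
  rw [abs_mul, abs_inv, abs_norm]
  rcases eq_or_ne a 0 with rfl | ha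
  · simp
  · have hp := norm_pos_iff.2 ha
    rw [← div_eq_mul_inv, div_le_iff₀ hp, mul_comm]
    exact abs_real_inner_le_norm _ _

/-- The length of curves is Lipschitz along paths. -/
lemma IsSmoothPath.enorm_len_sub_le (hlam : 0 < lam) (hC : IsSmoothPath C) {t : ℝ}
    (ht : t ∈ Set.Icc (0 : ℝ) 1) :
    ‖len (C t) - len (C 0)‖ₑ ≤ ENNReal.ofReal (isq lam) * pathLength lam C := by
  have h0 : ∀ p ∈ (Set.Icc (0 : ℝ) 1 ×ˢ Set.Icc (0 : ℝ) 1), deriv (C p.1) p.2 ≠ 0 :=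
    fun p hp => (hC.immersed p.1 hp.1).immersed p.2
  have hc1 : ContinuousOn (fun p : ℝ × ℝ => ‖deriv (C p.1) p.2‖)
      (Set.Icc (0 : ℝ) 1 ×ˢ Set.Icc (0 : ℝ) 1) := hC.continuous_deriv.norm.continuousOn
  have hc2 : ContinuousOn (fun p : ℝ × ℝ => inner ℝ (deriv (C p.1) p.2)
      (deriv (velocity C p.1) p.2) * ‖deriv (C p.1) p.2‖⁻¹)
      (Set.Icc (0 : ℝ) 1 ×ˢ Set.Icc (0 : ℝ) 1) :=
    (hC.continuous_deriv.inner hC.continuous_deriv_velocity).continuousOn.mul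
      (hc1.inv₀ fun p hp => norm_ne_zero_iff.2 (h0 p hp))
  refine enorm_sub_le_of_deriv_le (f := fun t => len (C t))
    (f' := fun t => ∫ u in (0 : ℝ)..1,
      inner ℝ (deriv (C t) u) (deriv (velocity C t) u) * ‖deriv (C t) u‖⁻¹)
    (N := fun t => normH2 lam (C t) (velocity C t)) (isq_pos hlam).le
    (continuousOn_integral_of_continuousOn hc1)
    (fun t ht => hasDerivAt_integral_of_continuousOn (Φ := fun t u => ‖deriv (C t) u‖)
      (Φ' := fun t u => inner ℝ (deriv (C t) u) (deriv (velocity C t) u) * ‖deriv (C t) u‖⁻¹)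
      hc1 hc2 (fun t ht u _ => ?_) ht)
    (continuousOn_integral_of_continuousOn (Φ := fun t u => inner ℝ (deriv (C t) u)
      (deriv (velocity C t) u) * ‖deriv (C t) u‖⁻¹) hc2) (fun t ht => ?_) ht
  · exact hasDerivAt_norm' (hC.hasDerivAt_time_deriv t u) ((hC.immersed t ht).immersed u)
  · have hct := hC.immersed t (Set.Ioo_subset_Icc_self ht)
    have hL := hct.len_pos
    have hb : ∀ u, ‖deriv (velocity C t) u‖ ≤
        (isq lam * normH2 lam (C t) (velocity C t) / len (C t)) * ‖deriv (C t) u‖ := fun u => by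
      rw [div_mul_eq_mul_div, le_div_iff₀ hL]
      linarith [hC.len_mul_norm_deriv_velocity_le hlam ht u]
    calc _ ≤ ∫ u in (0 : ℝ)..1,
          (isq lam * normH2 lam (C t) (velocity C t) / len (C t)) * ‖deriv (C t) u‖ := by
          refine intervalIntegral.norm_integral_le_of_norm_le zero_le_one
            (ae_of_all _ fun u _ => ?_)
            ((continuous_const.mul hct.continuous_speed).intervalIntegrable _ _)
          exact (abs_inner_mul_inv_norm_le _ _).trans (hb u)
      _ = _ := by
        rw [intervalIntegral.integral_const_mul, ← len]
        field_simp

/-- The logarithm of the speed of a parametrization is Lipschitz along paths. -/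
lemma IsSmoothPath.enorm_log_speed_sub_le (hlam : 0 < lam) (hC : IsSmoothPath C) {m : ℝ}
    (hm : 0 < m) (hmC : ∀ t ∈ Set.Icc (0 : ℝ) 1, m ≤ len (C t)) {t : ℝ}
    (ht : t ∈ Set.Icc (0 : ℝ) 1) (u : ℝ) :
    ‖Real.log ‖deriv (C t) u‖ - Real.log ‖deriv (C 0) u‖‖ₑ ≤
      ENNReal.ofReal (isq lam / m) * pathLength lam C := by
  have h0 : ∀ t ∈ Set.Icc (0 : ℝ) 1, ‖deriv (C t) u‖ ≠ 0 :=
    fun t ht => ((hC.immersed t ht).speed_pos u).ne'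
  have hc : Continuous fun t => deriv (C t) u :=
    continuous_slice (F := fun t u => deriv (C t) u) hC.continuous_deriv u
  have hcv : Continuous fun t => deriv (velocity C t) u :=
    continuous_slice (F := fun t u => deriv (velocity C t) u) hC.continuous_deriv_velocity u
  refine enorm_sub_le_of_deriv_le (f := fun t => Real.log ‖deriv (C t) u‖)
    (f' := fun t => inner ℝ (deriv (C t) u) (deriv (velocity C t) u) * ‖deriv (C t) u‖⁻¹ /
      ‖deriv (C t) u‖) (N := fun t => normH2 lam (C t) (velocity C t))
    (div_nonneg (isq_pos hlam).le hm.le) (hc.norm.continuousOn.log h0)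
    (fun t ht => ?_) ?_ (fun t ht => ?_) ht
  · exact (hasDerivAt_norm' (hC.hasDerivAt_time_deriv t u)
      (norm_ne_zero_iff.1 (h0 t (Set.Ioo_subset_Icc_self ht)))).log
      (h0 t (Set.Ioo_subset_Icc_self ht))
  · exact ((hc.inner hcv).continuousOn.mul (hc.norm.continuousOn.inv₀ h0)).div
      hc.norm.continuousOn h0
  · have hct := hC.immersed t (Set.Ioo_subset_Icc_self ht)
    have hN := normH2_nonneg lam (C t) (velocity C t)
    have hmu := isq_pos hlam
    rw [norm_div, norm_norm, div_le_iff₀ (hct.speed_pos u), Real.norm_eq_abs]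
    refine (abs_inner_mul_inv_norm_le _ _).trans ?_
    rw [div_mul_eq_mul_div, div_mul_eq_mul_div, le_div_iff₀ hm]
    calc _ ≤ ‖deriv (velocity C t) u‖ * len (C t) := by
          gcongr; exact hmC t (Set.Ioo_subset_Icc_self ht)
      _ ≤ _ := by linarith [hC.len_mul_norm_deriv_velocity_le hlam ht u]

/-- The derivative of the integrand of the elastic energy. -/
def energyDensityDeriv (a b x y : Euc n) : ℝ :=
  2 * inner ℝ (secondDs a b x y) (secondDs a b a b) * ‖a‖
    - 3 * (inner ℝ a x * (‖a‖ ^ 2)⁻¹) * energyDensity a b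

lemma continuousOn_energyDensity {X : Type*} [TopologicalSpace X] {s : Set X} {a b : X → Euc n}
    (ha : ContinuousOn a s) (hb : ContinuousOn b s) (h0 : ∀ p ∈ s, a p ≠ 0) :
    ContinuousOn (fun p => energyDensity (a p) (b p)) s :=
  ((continuousOn_secondDs ha hb ha hb h0).norm.pow 2).mul ha.norm

lemma continuousOn_energyDensityDeriv {X : Type*} [TopologicalSpace X] {s : Set X}
    {a b x y : X → Euc n} (ha : ContinuousOn a s) (hb : ContinuousOn b s)
    (hx : ContinuousOn x s) (hy : ContinuousOn y s) (h0 : ∀ p ∈ s, a p ≠ 0) :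
    ContinuousOn (fun p => energyDensityDeriv (a p) (b p) (x p) (y p)) s :=
  ((continuousOn_const.mul ((continuousOn_secondDs ha hb hx hy h0).inner
    (continuousOn_secondDs ha hb ha hb h0))).mul ha.norm).sub
    ((continuousOn_const.mul ((ha.inner hx).mul ((ha.norm.pow 2).inv₀
      fun p hp => pow_ne_zero _ (norm_ne_zero_iff.2 (h0 p hp))))).mul
      (continuousOn_energyDensity ha hb h0))

/-- The two terms of the first variation give the two summands of `energyConst`: Cauchy–Schwarz with
the second order part of the metric for ⟨D_s²h, κ⟩, the pointwise bound of D_s h for the other. The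
lower bound m of the length makes both constants uniform. -/
lemma norm_integral_energyDensityDeriv_le (hlam : 0 < lam) {m : ℝ} (hm : 0 < m)
    {c h : ℝ → Euc n} (hc : IsImmersedCurve c) (hmc : m ≤ len c) (hh : ContDiff ℝ ∞ h)
    (hp : Function.Periodic h 1) :
    ‖∫ u in (0 : ℝ)..1, energyDensityDeriv (deriv c u) (deriv (deriv c) u) (deriv h u)
      (deriv (deriv h) u)‖ ≤ energyConst lam m * (1 + elasticEnergy c) * normH2 lam c h := by
  have hL := hc.len_pos
  have hmu := isq_pos hlam
  have hM := isq_pos (show 0 < lam * m ^ 3 by positivity)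
  have hN := normH2_nonneg lam c h
  have hE := elasticEnergy_nonneg c
  have hD := (hc.contDiff_Ds (hc.contDiff_Ds hh)).continuous
  have hK := (hc.contDiff_Ds (hc.contDiff_Ds hc.smooth)).continuous
  have hs := hc.continuous_speed
  set D := Ds c (Ds c h) with hDdef
  set κ := Ds c (Ds c c) with hKdef
  set N := normH2 lam c h with hNdef
  have hi1 : Continuous fun u => ‖D u‖ * ‖κ u‖ * ‖deriv c u‖ := (hD.norm.mul hK.norm).mul hs
  have hi2 : Continuous fun u => ‖κ u‖ ^ 2 * ‖deriv c u‖ := (hK.norm.pow 2).mul hs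
  have hi3 : Continuous fun u => ‖D u‖ ^ 2 * ‖deriv c u‖ := (hD.norm.pow 2).mul hs
  have hpt : ∀ u, ‖energyDensityDeriv (deriv c u) (deriv (deriv c) u) (deriv h u)
      (deriv (deriv h) u)‖ ≤ 2 * (‖D u‖ * ‖κ u‖ * ‖deriv c u‖) +
        3 * isq lam / m * N * (‖κ u‖ ^ 2 * ‖deriv c u‖) := by
    intro u
    have hsp := hc.speed_pos u
    have e1 : secondDs (deriv c u) (deriv (deriv c) u) (deriv h u) (deriv (deriv h) u) = D u :=
      (hc.Ds_Ds_eq hh u).symm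
    have e2 : secondDs (deriv c u) (deriv (deriv c) u) (deriv c u) (deriv (deriv c) u) = κ u :=
      (hc.Ds_Ds_eq hc.smooth u).symm
    rw [energyDensityDeriv, energyDensity, e1, e2]
    refine (norm_sub_le _ _).trans (add_le_add ?_ ?_)
    · rw [norm_mul, norm_mul, norm_norm, Real.norm_eq_abs, abs_two, mul_assoc]
      gcongr
      exact abs_real_inner_le_norm _ _
    · rw [norm_mul, norm_mul, norm_mul, norm_inv, norm_pow, norm_norm, Real.norm_eq_abs,
        Real.norm_eq_abs, Real.norm_eq_abs, abs_of_pos (show (0 : ℝ) < 3 by norm_num),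
        abs_of_nonneg (show 0 ≤ ‖κ u‖ ^ 2 * ‖deriv c u‖ by positivity)]
      have h1 : |inner ℝ (deriv c u) (deriv h u)| * (‖deriv c u‖ ^ 2)⁻¹ ≤ isq lam / m * N := by
        rw [← div_eq_mul_inv, div_le_iff₀ (by positivity), div_mul_eq_mul_div,
          div_mul_eq_mul_div, le_div_iff₀ hm]
        calc _ ≤ (‖deriv c u‖ * ‖deriv h u‖) * len c :=
              mul_le_mul (abs_real_inner_le_norm _ _) hmc hm.le (by positivity)
          _ = ‖deriv c u‖ * (len c * ‖deriv h u‖) := by ring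
          _ ≤ ‖deriv c u‖ * (‖deriv c u‖ * (isq lam * N)) :=
              mul_le_mul_of_nonneg_left (hc.len_mul_norm_deriv_le hlam hh hp u) (norm_nonneg _)
          _ = _ := by ring
      calc _ ≤ 3 * (isq lam / m * N) * (‖κ u‖ ^ 2 * ‖deriv c u‖) := by gcongr
        _ = _ := by ring
  have hcs : ∫ u in (0 : ℝ)..1, ‖D u‖ * ‖κ u‖ * ‖deriv c u‖ ≤
      isq (lam * m ^ 3) * N * (1 + elasticEnergy c) / 2 := by
    refine (abs_le_of_sq_le_sq' ?_ (by positivity)).2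
    have h1 := sq_integral_mul_le zero_le_one (fun u => norm_nonneg (deriv c u))
      (hi1.intervalIntegrable 0 1) (hi3.intervalIntegrable _ _) (hi2.intervalIntegrable _ _)
    have h2 := hc.integral_Ds_sq_le hlam (h := h)
    rw [← hDdef, ← hNdef] at h2
    have h3 : (∫ u in (0 : ℝ)..1, ‖D u‖ ^ 2 * ‖deriv c u‖) ≤ (isq (lam * m ^ 3) * N) ^ 2 := by
      set I := ∫ u in (0 : ℝ)..1, ‖D u‖ ^ 2 * ‖deriv c u‖
      have hI : 0 ≤ I := intervalIntegral.integral_nonneg zero_le_one fun u _ => by positivity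
      calc I = isq (lam * m ^ 3) ^ 2 * (lam * m ^ 3 * I) := by
            linear_combination (-I) * isq_sq (show 0 < lam * m ^ 3 by positivity)
        _ ≤ isq (lam * m ^ 3) ^ 2 * (lam * len c ^ 3 * I) := by gcongr
        _ ≤ isq (lam * m ^ 3) ^ 2 * N ^ 2 := by gcongr
        _ = _ := by ring
    have h4 : ∫ u in (0 : ℝ)..1, ‖κ u‖ ^ 2 * ‖deriv c u‖ = elasticEnergy c := rfl
    calc _ ≤ _ := h1
      _ ≤ (isq (lam * m ^ 3) * N) ^ 2 * elasticEnergy c := by rw [h4]; gcongr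
      -- Cauchy–Schwarz produces √E; replacing it by (1 + E)/2 gives a growth rate linear in 1 + E,
      -- as the logarithmic Gronwall argument requires.
      _ ≤ (isq (lam * m ^ 3) * N) ^ 2 * ((1 + elasticEnergy c) / 2) ^ 2 := by
          gcongr; nlinarith [sq_nonneg (1 - elasticEnergy c)]
      _ = _ := by ring
  calc _ ≤ ∫ u in (0 : ℝ)..1, (2 * (‖D u‖ * ‖κ u‖ * ‖deriv c u‖) +
        3 * isq lam / m * N * (‖κ u‖ ^ 2 * ‖deriv c u‖)) :=
        intervalIntegral.norm_integral_le_of_norm_le zero_le_one (ae_of_all _ fun u _ => hpt u)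
          ((hi1.const_mul 2 |>.add (hi2.const_mul _)).intervalIntegrable _ _)
    _ = 2 * (∫ u in (0 : ℝ)..1, ‖D u‖ * ‖κ u‖ * ‖deriv c u‖) +
        3 * isq lam / m * N * elasticEnergy c := by
        rw [intervalIntegral.integral_add ((hi1.const_mul 2).intervalIntegrable _ _)
          ((hi2.const_mul _).intervalIntegrable _ _), intervalIntegral.integral_const_mul,
          intervalIntegral.integral_const_mul]
        rfl
    _ ≤ 2 * (isq (lam * m ^ 3) * N * (1 + elasticEnergy c) / 2) +
        3 * isq lam / m * N * (1 + elasticEnergy c) := by gcongr; linarith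
    _ = _ := by rw [energyConst]; ring

lemma IsSmoothPath.continuousOn_energy (hC : IsSmoothPath C) :
    ContinuousOn (fun t => elasticEnergy (C t)) (Set.Icc 0 1) := by
  refine ContinuousOn.congr (continuousOn_integral_of_continuousOn
    (Φ := fun t u => energyDensity (deriv (C t) u) (deriv (deriv (C t)) u)) ?_)
    fun t ht => (hC.immersed t ht).elasticEnergy_eq
  exact continuousOn_energyDensity hC.continuous_deriv.continuousOn
    hC.continuous_deriv_deriv.continuousOn fun p hp => (hC.immersed p.1 hp.1).immersed p.2

/-- The time derivative of the elastic energy. -/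
def energyRate (C : ℝ → ℝ → Euc n) (t : ℝ) : ℝ :=
  ∫ u in (0 : ℝ)..1, energyDensityDeriv (deriv (C t) u) (deriv (deriv (C t)) u)
    (deriv (velocity C t) u) (deriv (deriv (velocity C t)) u)

lemma IsSmoothPath.continuousOn_energyDensityDeriv (hC : IsSmoothPath C) :
    ContinuousOn (fun p : ℝ × ℝ => energyDensityDeriv (deriv (C p.1) p.2)
      (deriv (deriv (C p.1)) p.2) (deriv (velocity C p.1) p.2)
      (deriv (deriv (velocity C p.1)) p.2)) (Set.Icc 0 1 ×ˢ Set.Icc 0 1) :=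
  SobolevCurves.continuousOn_energyDensityDeriv hC.continuous_deriv.continuousOn
    hC.continuous_deriv_deriv.continuousOn hC.continuous_deriv_velocity.continuousOn
    hC.continuous_deriv_deriv_velocity.continuousOn
    fun p hp => (hC.immersed p.1 hp.1).immersed p.2

lemma IsSmoothPath.continuousOn_energyRate (hC : IsSmoothPath C) :
    ContinuousOn (energyRate C) (Set.Icc 0 1) :=
  continuousOn_integral_of_continuousOn (Φ := fun t u => energyDensityDeriv (deriv (C t) u)
    (deriv (deriv (C t)) u) (deriv (velocity C t) u) (deriv (deriv (velocity C t)) u))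
    hC.continuousOn_energyDensityDeriv

lemma IsSmoothPath.hasDerivAt_energy (hC : IsSmoothPath C) {t : ℝ}
    (ht : t ∈ Set.Ioo (0 : ℝ) 1) :
    HasDerivAt (fun t => elasticEnergy (C t)) (energyRate C t) t := by
  have h := hasDerivAt_integral_of_continuousOn
    (Φ := fun t u => energyDensity (deriv (C t) u) (deriv (deriv (C t)) u))
    (Φ' := fun t u => energyDensityDeriv (deriv (C t) u)
    (deriv (deriv (C t)) u) (deriv (velocity C t) u) (deriv (deriv (velocity C t)) u))
    (continuousOn_energyDensity hC.continuous_deriv.continuousOn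
    hC.continuous_deriv_deriv.continuousOn fun p hp => (hC.immersed p.1 hp.1).immersed p.2)
    hC.continuousOn_energyDensityDeriv (fun t ht u _ => hasDerivAt_energyDensity
      (hC.hasDerivAt_time_deriv t u) (hC.hasDerivAt_time_deriv_deriv t u)
      ((hC.immersed t ht).immersed u)) ht
  refine h.congr_of_eventuallyEq ?_
  filter_upwards [Icc_mem_nhds ht.1 ht.2] with τ hτ
  exact (hC.immersed τ hτ).elasticEnergy_eq

lemma IsSmoothPath.norm_energyRate_le (hlam : 0 < lam) (hC : IsSmoothPath C) {m : ℝ}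
    (hm : 0 < m) (hmC : ∀ t ∈ Set.Icc (0 : ℝ) 1, m ≤ len (C t)) {t : ℝ}
    (ht : t ∈ Set.Ioo (0 : ℝ) 1) :
    ‖energyRate C t‖ ≤ energyConst lam m * (1 + elasticEnergy (C t)) *
      normH2 lam (C t) (velocity C t) :=
  norm_integral_energyDensityDeriv_le hlam hm (hC.immersed t (Set.Ioo_subset_Icc_self ht))
    (hmC t (Set.Ioo_subset_Icc_self ht)) (hC.contDiff_velocity_slice t) (hC.periodic_velocity ht)

/-- Gronwall's inequality in logarithmic form: the energy rate is at most a constant times (1 + E)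
times the speed of the path. -/
lemma IsSmoothPath.enorm_log_energy_sub_le (hlam : 0 < lam) (hC : IsSmoothPath C) {m : ℝ}
    (hm : 0 < m) (hmC : ∀ t ∈ Set.Icc (0 : ℝ) 1, m ≤ len (C t)) {t : ℝ}
    (ht : t ∈ Set.Icc (0 : ℝ) 1) :
    ‖Real.log (1 + elasticEnergy (C t)) - Real.log (1 + elasticEnergy (C 0))‖ₑ ≤
      ENNReal.ofReal (energyConst lam m) * pathLength lam C := by
  have hpos : ∀ t, 0 < 1 + elasticEnergy (C t) := fun t => by
    linarith [elasticEnergy_nonneg (C t)]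
  refine enorm_sub_le_of_deriv_le (f := fun t => Real.log (1 + elasticEnergy (C t)))
    (f' := fun t => energyRate C t / (1 + elasticEnergy (C t)))
    (N := fun t => normH2 lam (C t) (velocity C t)) (energyConst_pos hlam hm).le
    ((continuousOn_const.add hC.continuousOn_energy).log fun t _ => (hpos t).ne')
    (fun t ht => ((hC.hasDerivAt_energy ht).const_add 1).log (hpos t).ne')
    (hC.continuousOn_energyRate.div (continuousOn_const.add hC.continuousOn_energy)
      fun t _ => (hpos t).ne') (fun t ht => ?_) ht
  rw [norm_div, Real.norm_eq_abs (1 + _), abs_of_pos (hpos t), div_le_iff₀ (hpos t)]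
  linarith [hC.norm_energyRate_le hlam hm hmC ht]

/-- Second use of the rate bound, once the logarithmic estimate has supplied the uniform bound A of
1 + E along the path. -/
lemma IsSmoothPath.enorm_energy_sub_le (hlam : 0 < lam) (hC : IsSmoothPath C) {m A : ℝ}
    (hm : 0 < m) (hmC : ∀ t ∈ Set.Icc (0 : ℝ) 1, m ≤ len (C t))
    (hA : ∀ t ∈ Set.Icc (0 : ℝ) 1, 1 + elasticEnergy (C t) ≤ A) {t : ℝ}
    (ht : t ∈ Set.Icc (0 : ℝ) 1) :
    ‖elasticEnergy (C t) - elasticEnergy (C 0)‖ₑ ≤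
      ENNReal.ofReal (energyConst lam m * A) * pathLength lam C := by
  have hK := energyConst_pos hlam hm
  have hA0 : 0 ≤ A := by linarith [hA 0 (by simp), elasticEnergy_nonneg (C 0)]
  refine enorm_sub_le_of_deriv_le (f := fun t => elasticEnergy (C t)) (f' := energyRate C)
    (N := fun t => normH2 lam (C t) (velocity C t)) (by positivity) hC.continuousOn_energy
    (fun t ht => hC.hasDerivAt_energy ht) hC.continuousOn_energyRate (fun t ht => ?_) ht
  refine (hC.norm_energyRate_le hlam hm hmC ht).trans ?_
  have := normH2_nonneg lam (C t) (velocity C t)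
  gcongr
  exact hA t (Set.Ioo_subset_Icc_self ht)

end PathEstimates

/-! ### Invariance under diffeomorphisms of the circle -/

section Reparametrization

lemma IsCircleDiffeo.id : IsCircleDiffeo (fun u => u) :=
  ⟨contDiff_id, fun x => by simp, Or.inl fun x => rfl⟩

lemma IsCircleDiffeo.hasDerivAt {φ : ℝ → ℝ} (hφ : IsCircleDiffeo φ) (u : ℝ) :
    HasDerivAt φ (deriv φ u) u := hasDerivAt_deriv hφ.smooth u

lemma IsCircleDiffeo.comp {φ ψ : ℝ → ℝ} (hφ : IsCircleDiffeo φ) (hψ : IsCircleDiffeo ψ) :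
    IsCircleDiffeo (fun u => φ (ψ u)) := by
  refine ⟨hφ.smooth.comp hψ.smooth, fun x => ?_, ?_⟩
  · have := ((hφ.hasDerivAt (ψ x)).scomp x (hψ.hasDerivAt x)).deriv
    rw [Function.comp_def] at this
    rw [this]
    exact smul_ne_zero (hψ.deriv_ne_zero x) (hφ.deriv_ne_zero _)
  · have hm : (∀ x, φ (x + 1) = φ x + 1) → ∀ x, φ (x - 1) = φ x - 1 := fun h x => by
      have := h (x - 1)
      rw [sub_add_cancel] at this
      linarith
    have hm' : (∀ x, φ (x + 1) = φ x - 1) → ∀ x, φ (x - 1) = φ x + 1 := fun h x => by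
      have := h (x - 1)
      rw [sub_add_cancel] at this
      linarith
    rcases hφ.degree with h1 | h1 <;> rcases hψ.degree with h2 | h2
    · exact Or.inl fun x => by rw [h2, h1]
    · exact Or.inr fun x => by rw [h2, hm h1]
    · exact Or.inr fun x => by rw [h2, h1]
    · exact Or.inl fun x => by rw [h2, hm' h1]

/-- A diffeomorphism of the circle is increasing of degree `1` or decreasing of degree `-1`. -/
lemma IsCircleDiffeo.cases {φ : ℝ → ℝ} (hφ : IsCircleDiffeo φ) :
    ((∀ x, 0 < deriv φ x) ∧ ∀ x, φ (x + 1) = φ x + 1) ∨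
      ((∀ x, deriv φ x < 0) ∧ ∀ x, φ (x + 1) = φ x - 1) := by
  have hc : Continuous (deriv φ) := (contDiff_deriv hφ.smooth).continuous
  have hsign : (∀ x, 0 < deriv φ x) ∨ ∀ x, deriv φ x < 0 := by
    by_contra! h
    obtain ⟨⟨x, hx⟩, y, hy⟩ := h
    obtain ⟨z, hz⟩ := mem_range_of_exists_le_of_exists_ge hc ⟨x, hx⟩ ⟨y, hy⟩
    exact hφ.deriv_ne_zero z hz
  rcases hsign with h | h
  · refine Or.inl ⟨h, hφ.degree.resolve_right fun hd => ?_⟩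
    have h1 := strictMono_of_deriv_pos h (show (0 : ℝ) < 0 + 1 by norm_num)
    rw [hd] at h1
    linarith
  · refine Or.inr ⟨h, hφ.degree.resolve_left fun hd => ?_⟩
    have h1 := strictAnti_of_deriv_neg h (show (0 : ℝ) < 0 + 1 by norm_num)
    rw [hd] at h1
    linarith

/-- For a decreasing φ the sign from the absolute value cancels the one from the reversed interval;
periodicity then shifts the interval back to [0, 1]. -/
lemma IsCircleDiffeo.integral_comp {φ : ℝ → ℝ} (hφ : IsCircleDiffeo φ) {F : ℝ → ℝ}
    (hF : Continuous F) (hp : Function.Periodic F 1) :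
    ∫ u in (0 : ℝ)..1, F (φ u) * |deriv φ u| = ∫ u in (0 : ℝ)..1, F u := by
  have hc : Continuous (deriv φ) := (contDiff_deriv hφ.smooth).continuous
  have key : ∫ u in (0 : ℝ)..1, F (φ u) * deriv φ u = ∫ u in φ 0..φ 1, F u :=
    intervalIntegral.integral_comp_mul_deriv (fun x _ => hφ.hasDerivAt x) hc.continuousOn hF
  rcases hφ.cases with ⟨h1, h2⟩ | ⟨h1, h2⟩
  · simp only [fun u => abs_of_pos (h1 u)]
    have h3 := h2 0
    rw [zero_add] at h3
    rw [key, h3, hp.intervalIntegral_add_eq (φ 0) 0, zero_add]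
  · simp only [fun u => abs_of_neg (h1 u), mul_neg, intervalIntegral.integral_neg]
    have h3 := h2 0
    rw [zero_add] at h3
    rw [key, h3, ← intervalIntegral.integral_symm]
    have := hp.intervalIntegral_add_eq (φ 0 - 1) 0
    rwa [zero_add, sub_add_cancel] at this

variable {c h : ℝ → Euc n} {φ : ℝ → ℝ}

lemma deriv_comp_diffeo (hφ : IsCircleDiffeo φ) (hh : ContDiff ℝ ∞ h) (u : ℝ) :
    deriv (fun u => h (φ u)) u = deriv φ u • deriv h (φ u) :=
  ((hasDerivAt_deriv hh (φ u)).scomp u (hφ.hasDerivAt u)).deriv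

lemma IsImmersedCurve.comp (hc : IsImmersedCurve c) (hφ : IsCircleDiffeo φ) :
    IsImmersedCurve (fun u => c (φ u)) := by
  refine ⟨hc.smooth.comp hφ.smooth, fun x => ?_, fun u => ?_⟩
  · rcases hφ.degree with h | h
    · simp only [h x, hc.periodic (φ x)]
    · simp only [h x, hc.periodic.sub_eq (φ x)]
  · rw [deriv_comp_diffeo hφ hc.smooth]
    exact smul_ne_zero (hφ.deriv_ne_zero u) (hc.immersed _)

lemma Ds_comp_diffeo (hc : IsImmersedCurve c) (hφ : IsCircleDiffeo φ) (hh : ContDiff ℝ ∞ h)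
    (u : ℝ) : Ds (fun u => c (φ u)) (fun u => h (φ u)) u =
      (|deriv φ u|⁻¹ * deriv φ u) • Ds c h (φ u) := by
  rw [Ds, Ds, deriv_comp_diffeo hφ hc.smooth, deriv_comp_diffeo hφ hh, norm_smul, mul_inv,
    smul_smul, smul_smul, Real.norm_eq_abs]
  congr 1
  ring

/-- The sign by which D_s changes under φ is constant, so it passes through a second D_s and does
not affect the norm of D_s²c. -/
lemma IsCircleDiffeo.exists_sign (hφ : IsCircleDiffeo φ) :
    ∃ ε : ℝ, |ε| = 1 ∧ ∀ u, |deriv φ u|⁻¹ * deriv φ u = ε := by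
  rcases hφ.cases with ⟨h1, -⟩ | ⟨h1, -⟩
  · exact ⟨1, by simp, fun u => by rw [abs_of_pos (h1 u), inv_mul_cancel₀ (h1 u).ne']⟩
  · exact ⟨-1, by simp, fun u => by
      rw [abs_of_neg (h1 u), inv_neg, neg_mul, inv_mul_cancel₀ (h1 u).ne]⟩

lemma norm_Ds_Ds_comp (hc : IsImmersedCurve c) (hφ : IsCircleDiffeo φ) (u : ℝ) :
    ‖Ds (fun u => c (φ u)) (Ds (fun u => c (φ u)) (fun u => c (φ u))) u‖ =
      ‖Ds c (Ds c c) (φ u)‖ := by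
  obtain ⟨ε, hε, h⟩ := hφ.exists_sign
  have e1 : Ds (fun u => c (φ u)) (fun u => c (φ u)) = fun u => ε • Ds c c (φ u) := by
    ext1 u
    rw [Ds_comp_diffeo hc hφ hc.smooth, h]
  rw [e1, Ds_comp_diffeo (h := fun u => ε • Ds c c u) hc hφ
    ((hc.contDiff_Ds hc.smooth).const_smul ε), h]
  have e2 : Ds c (fun u => ε • Ds c c u) (φ u) = ε • Ds c (Ds c c) (φ u) := by
    rw [Ds, Ds, deriv_fun_const_smul _ (hc.hasDerivAt_Ds hc.smooth (φ u)).differentiableAt,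
      smul_comm]
  rw [e2, norm_smul, norm_smul, Real.norm_eq_abs, hε, one_mul, one_mul]

lemma len_comp (hc : IsImmersedCurve c) (hφ : IsCircleDiffeo φ) :
    len (fun u => c (φ u)) = len c := by
  rw [len, len, ← hφ.integral_comp hc.continuous_speed fun u => by
    simp only [periodic_deriv hc.periodic u]]
  simp only [deriv_comp_diffeo hφ hc.smooth, norm_smul, Real.norm_eq_abs, mul_comm]

lemma elasticEnergy_comp (hc : IsImmersedCurve c) (hφ : IsCircleDiffeo φ) :
    elasticEnergy (fun u => c (φ u)) = elasticEnergy c := by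
  have hK := (hc.contDiff_Ds (hc.contDiff_Ds hc.smooth)).continuous
  rw [elasticEnergy, elasticEnergy, ← hφ.integral_comp
    (F := fun u => ‖Ds c (Ds c c) u‖ ^ 2 * ‖deriv c u‖) ((hK.norm.pow 2).mul hc.continuous_speed)
    fun u => by
      simp only [periodic_deriv hc.periodic u,
        Ds_periodic hc.periodic (Ds_periodic hc.periodic hc.periodic) u]]
  simp only [norm_Ds_Ds_comp hc hφ, deriv_comp_diffeo hφ hc.smooth, norm_smul, Real.norm_eq_abs,
    mul_comm, mul_left_comm]

end Reparametrization

/-! ### From paths to the distance: the local Lipschitz bound of the energy -/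

section Distance

variable {lam : ℝ}

lemma exists_path_of_geomDist_lt {c₀ c₁ : ℝ → Euc n} {δ : ℝ≥0∞} (h : geomDist lam c₀ c₁ < δ) :
    ∃ (C : ℝ → ℝ → Euc n) (φ : ℝ → ℝ), IsSmoothPath C ∧ IsCircleDiffeo φ ∧ C 0 = c₀ ∧
      C 1 = (fun u => c₁ (φ u)) ∧ pathLength lam C < δ := by
  simp only [geomDist, iInf_lt_iff] at h
  obtain ⟨C, φ, h1, h2, h3, h4, h5⟩ := h
  exact ⟨C, φ, h1, h2, funext h3, funext h4, h5⟩

lemma norm_le_of_enorm_le {E : Type*} [NormedAddCommGroup E] {x : E} {A δ : ℝ} {P : ℝ≥0∞}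
    (hA : 0 ≤ A) (hδ : 0 ≤ δ) (h : ‖x‖ₑ ≤ ENNReal.ofReal A * P) (hP : P ≤ ENNReal.ofReal δ) :
    ‖x‖ ≤ A * δ := by
  rw [← ENNReal.ofReal_le_ofReal_iff (by positivity), ENNReal.ofReal_mul hA, ofReal_norm]
  exact h.trans (by gcongr)

variable {C : ℝ → ℝ → Euc n}

lemma IsSmoothPath.abs_len_sub_le (hlam : 0 < lam) (hC : IsSmoothPath C) {δ : ℝ} (hδ : 0 ≤ δ)
    (hP : pathLength lam C ≤ ENNReal.ofReal δ) {t : ℝ} (ht : t ∈ Set.Icc (0 : ℝ) 1) :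
    |len (C t) - len (C 0)| ≤ isq lam * δ :=
  norm_le_of_enorm_le (isq_pos hlam).le hδ (hC.enorm_len_sub_le hlam ht) hP

/-- A path of length δ shortens the curve by at most `isq lam * δ`; the hypothesis on the initial
length reserves this amount above m. -/
lemma IsSmoothPath.le_len (hlam : 0 < lam) (hC : IsSmoothPath C) {δ m : ℝ} (hδ : 0 ≤ δ)
    (hP : pathLength lam C ≤ ENNReal.ofReal δ) (hm : m + isq lam * δ ≤ len (C 0)) :
    ∀ t ∈ Set.Icc (0 : ℝ) 1, m ≤ len (C t) := fun t ht => by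
  have := (abs_le.1 (hC.abs_len_sub_le hlam hδ hP ht)).1
  linarith

lemma IsSmoothPath.one_add_energy_le (hlam : 0 < lam) (hC : IsSmoothPath C) {δ m : ℝ}
    (hδ : 0 ≤ δ) (hm : 0 < m) (hP : pathLength lam C ≤ ENNReal.ofReal δ)
    (hmC : m + isq lam * δ ≤ len (C 0)) :
    ∀ t ∈ Set.Icc (0 : ℝ) 1, 1 + elasticEnergy (C t) ≤
      Real.exp (energyConst lam m * δ) * (1 + elasticEnergy (C 0)) := fun t ht => by
  have hpos : ∀ t, 0 < 1 + elasticEnergy (C t) := fun t => by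
    linarith [elasticEnergy_nonneg (C t)]
  have h := norm_le_of_enorm_le (energyConst_pos hlam hm).le hδ
    (hC.enorm_log_energy_sub_le hlam hm (hC.le_len hlam hδ hP hmC) ht) hP
  have h1 := (abs_le.1 h).2
  rw [← Real.log_le_log_iff (hpos t) (mul_pos (Real.exp_pos _) (hpos 0)),
    Real.log_mul (Real.exp_pos _).ne' (hpos 0).ne', Real.log_exp]
  linarith

/-- The factor on the right is the actual path length; δ enters only through the constant. This is
what survives the infimum over paths as a Lipschitz estimate. -/
lemma IsSmoothPath.enorm_energy_sub_le_of_pathLength_le (hlam : 0 < lam) (hC : IsSmoothPath C)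
    {δ m : ℝ} (hδ : 0 ≤ δ) (hm : 0 < m) (hP : pathLength lam C ≤ ENNReal.ofReal δ)
    (hmC : m + isq lam * δ ≤ len (C 0)) :
    ‖elasticEnergy (C 1) - elasticEnergy (C 0)‖ₑ ≤
      ENNReal.ofReal (energyConst lam m * (Real.exp (energyConst lam m * δ) *
        (1 + elasticEnergy (C 0)))) * pathLength lam C :=
  hC.enorm_energy_sub_le hlam hm (hC.le_len hlam hδ hP hmC)
    (hC.one_add_energy_le hlam hδ hm hP hmC) (by simp)

lemma abs_len_sub_le_of_geomDist_lt (hlam : 0 < lam) {c c₁ : ℝ → Euc n}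
    (hc₁ : IsImmersedCurve c₁) {δ : ℝ} (hδ : 0 ≤ δ)
    (h : geomDist lam c c₁ < ENNReal.ofReal δ) : |len c₁ - len c| ≤ isq lam * δ := by
  obtain ⟨C, φ, hC, hφ, rfl, h1, hP⟩ := exists_path_of_geomDist_lt h
  have := hC.abs_len_sub_le hlam hδ hP.le (t := 1) (by simp)
  rwa [h1, len_comp hc₁ hφ] at this

lemma one_add_energy_le_of_geomDist_lt (hlam : 0 < lam) {c c₁ : ℝ → Euc n}
    (hc₁ : IsImmersedCurve c₁) {δ m : ℝ} (hδ : 0 ≤ δ) (hm : 0 < m)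
    (hmc : m + isq lam * δ ≤ len c) (h : geomDist lam c c₁ < ENNReal.ofReal δ) :
    1 + elasticEnergy c₁ ≤ Real.exp (energyConst lam m * δ) * (1 + elasticEnergy c) := by
  obtain ⟨C, φ, hC, hφ, rfl, h1, hP⟩ := exists_path_of_geomDist_lt h
  have := hC.one_add_energy_le hlam hδ hm hP.le hmc 1 (by simp)
  rwa [h1, elasticEnergy_comp hc₁ hφ] at this

lemma abs_energy_sub_le_of_geomDist_lt (hlam : 0 < lam) {c c₁ : ℝ → Euc n}
    (hc₁ : IsImmersedCurve c₁) {δ m : ℝ} (hδ : 0 ≤ δ) (hm : 0 < m)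
    (hmc : m + isq lam * δ ≤ len c) (h : geomDist lam c c₁ < ENNReal.ofReal δ) :
    |elasticEnergy c₁ - elasticEnergy c| ≤ energyConst lam m *
      (Real.exp (energyConst lam m * δ) * (1 + elasticEnergy c)) * δ := by
  obtain ⟨C, φ, hC, hφ, rfl, h1, hP⟩ := exists_path_of_geomDist_lt h
  have := hC.enorm_energy_sub_le_of_pathLength_le hlam hδ hm hP.le hmc
  rw [h1, elasticEnergy_comp hc₁ hφ] at this
  have hE := elasticEnergy_nonneg (C 0)
  have hK := energyConst_pos hlam hm
  exact norm_le_of_enorm_le (by positivity) hδ this hP.le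

/-- The elastic energy is locally Lipschitz. -/
theorem elasticEnergy_locally_lipschitz (hlam : 0 < lam) :
    ∃ r K : ℝ → ℝ, (∀ ℓ, 0 < ℓ → 0 < r ℓ) ∧ ∀ n : ℕ, ∀ c c₁ c₂ : ℝ → Euc n,
      IsImmersedCurve c → IsImmersedCurve c₁ → IsImmersedCurve c₂ →
      geomDist lam c c₁ < ENNReal.ofReal (r (len c)) →
      geomDist lam c c₂ < ENNReal.ofReal (r (len c)) →
      ENNReal.ofReal |elasticEnergy c₁ - elasticEnergy c₂| ≤
        ENNReal.ofReal (K (len c) * (1 + elasticEnergy c)) * geomDist lam c₁ c₂ := by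
  have hmu := isq_pos hlam
  -- With this radius each move of size r changes the length by at most ℓ/8: once from c to c₁, once
  -- more along a short path starting at c₁. So all lengths stay above m = ℓ/2. The two moves also
  -- account for the 2 in the exponent.
  refine ⟨fun ℓ => ℓ / (8 * isq lam), fun ℓ => 2 * energyConst lam (ℓ / 2) *
    Real.exp (2 * (energyConst lam (ℓ / 2) * (ℓ / (8 * isq lam)))), fun ℓ hℓ => by positivity,
    fun n c c₁ c₂ hc hc₁ hc₂ h₁ h₂ => ?_⟩
  have hL := hc.len_pos
  have hE := elasticEnergy_nonneg c
  have hE1 := elasticEnergy_nonneg c₁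
  dsimp only at *
  set m := len c / 2 with hm_def
  set r := len c / (8 * isq lam) with hr_def
  have hm : 0 < m := by positivity
  have hr : 0 < r := by positivity
  have hmr : isq lam * r = len c / 8 := by rw [hr_def]; field_simp
  set κ := energyConst lam m with hκ_def
  have hκ : 0 < κ := energyConst_pos hlam hm
  have hmc : m + isq lam * r ≤ len c := by rw [hmr]; linarith
  have hexp : Real.exp (2 * (κ * r)) = Real.exp (κ * r) * Real.exp (κ * r) := by
    rw [← Real.exp_add]; ring_nf
  have he1 : 1 ≤ Real.exp (κ * r) := Real.one_le_exp (by positivity)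
  have hKpos : 0 < 2 * κ * Real.exp (2 * (κ * r)) * (1 + elasticEnergy c) := by positivity
  have hlen1 := abs_len_sub_le_of_geomDist_lt hlam hc₁ hr.le h₁
  have hmc1 : m + isq lam * r ≤ len c₁ := by
    rw [hmr] at hlen1 ⊢
    have := (abs_le.1 hlen1).1
    linarith
  have hEc1 := one_add_energy_le_of_geomDist_lt hlam hc₁ hr.le hm hmc h₁
  have hd1 := abs_energy_sub_le_of_geomDist_lt hlam hc₁ hr.le hm hmc h₁
  have hd2 := abs_energy_sub_le_of_geomDist_lt hlam hc₂ hr.le hm hmc h₂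
  rw [← hκ_def] at hEc1 hd1 hd2
  -- Dividing by the positive finite constant isolates the infimum, so that it suffices to treat
  -- each path separately.
  rw [mul_comm, ← ENNReal.div_le_iff (by simpa using hKpos) ENNReal.ofReal_ne_top]
  refine le_iInf fun C => le_iInf fun φ => le_iInf fun hC => le_iInf fun hφ => le_iInf fun h0 =>
    le_iInf fun h1 => ?_
  rw [ENNReal.div_le_iff (by simpa using hKpos) ENNReal.ofReal_ne_top, mul_comm]
  have h0' : C 0 = c₁ := funext h0
  have h1' : C 1 = fun u => c₂ (φ u) := funext h1
  -- A short path stays where 1 + E is controlled, and the energy rate is integrated along it. For a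
  -- long path, the triangle inequality through c bounds the energy difference by a multiple of r,
  -- hence of the path length.
  rcases le_total (pathLength lam C) (ENNReal.ofReal r) with hP | hP
  · have := hC.enorm_energy_sub_le_of_pathLength_le hlam hr.le hm hP (by rwa [h0'])
    rw [h0', h1', elasticEnergy_comp hc₂ hφ, ← ofReal_norm, Real.norm_eq_abs, abs_sub_comm] at this
    refine this.trans (mul_le_mul_left (ENNReal.ofReal_le_ofReal ?_) _)
    calc κ * (Real.exp (κ * r) * (1 + elasticEnergy c₁))
        ≤ κ * (Real.exp (κ * r) * (Real.exp (κ * r) * (1 + elasticEnergy c))) := by gcongr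
      _ = κ * Real.exp (2 * (κ * r)) * (1 + elasticEnergy c) := by rw [hexp]; ring
      _ ≤ _ := by
        gcongr
        linarith
  · refine le_trans ?_ (mul_le_mul_right hP _)
    rw [← ENNReal.ofReal_mul hKpos.le]
    apply ENNReal.ofReal_le_ofReal
    have h3 : |elasticEnergy c₁ - elasticEnergy c₂| ≤
        2 * (κ * (Real.exp (κ * r) * (1 + elasticEnergy c)) * r) := by
      rw [abs_le] at *
      constructor <;> linarith [hd1.1, hd1.2, hd2.1, hd2.2]
    refine h3.trans ?_
    calc 2 * (κ * (Real.exp (κ * r) * (1 + elasticEnergy c)) * r)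
        = 2 * κ * Real.exp (κ * r) * (1 + elasticEnergy c) * r := by ring
      _ ≤ 2 * κ * Real.exp (2 * (κ * r)) * (1 + elasticEnergy c) * r := by
        rw [hexp]
        gcongr
        exact le_mul_of_one_le_left (Real.exp_pos _).le he1

end Distance

/-! ### Limit curves of Cauchy sequences -/

section LimitCurves

variable {lam : ℝ}

/-- Turns a small distance into closeness of actual parametrizations. A single φ gives both the
uniform bound and the speed bound, the latter for every admissible m, so the choice of φ can precede
that of m. -/
lemma exists_diffeo_of_geomDist_lt (hlam : 0 < lam) {c c₁ : ℝ → Euc n} {δ : ℝ} (hδ : 0 ≤ δ)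
    (h : geomDist lam c c₁ < ENNReal.ofReal δ) :
    ∃ φ : ℝ → ℝ, IsCircleDiffeo φ ∧ (∀ u, ‖c₁ (φ u) - c u‖ ≤ (1 + isq lam) * δ) ∧
      ∀ m, 0 < m → m + isq lam * δ ≤ len c →
        ∀ u, ‖deriv (fun u => c₁ (φ u)) u‖ ≤ Real.exp (isq lam / m * δ) * ‖deriv c u‖ := by
  obtain ⟨C, φ, hC, hφ, rfl, h1, hP⟩ := exists_path_of_geomDist_lt h
  have hmu := isq_pos hlam
  refine ⟨φ, hφ, fun u => ?_, fun m hm hmc u => ?_⟩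
  · have := norm_le_of_enorm_le (by positivity) hδ
      (hC.enorm_sub_le hlam (t := 1) (by simp) u) hP.le
    rwa [h1] at this
  · have := norm_le_of_enorm_le (by positivity) hδ (hC.enorm_log_speed_sub_le hlam hm
      (hC.le_len hlam hδ hP.le hmc) (t := 1) (by simp) u) hP.le
    have h2 := (hC.immersed 1 (by simp)).speed_pos u
    have h3 := (hC.immersed 0 (by simp)).speed_pos u
    rw [← h1, ← Real.log_le_log_iff h2 (by positivity), Real.log_mul (Real.exp_pos _).ne' h3.ne',
      Real.log_exp]
    linarith [(abs_le.1 this).2]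

lemma IsImmersedCurve.norm_sub_le_len {c : ℝ → Euc n} (hc : IsImmersedCurve c) (x y : ℝ) :
    ‖c x - c y‖ ≤ len c := by
  have e : c y = c (y - ⌊y - x⌋) := by
    have := hc.periodic.sub_int_mul_eq (x := y) ⌊y - x⌋
    rw [mul_one] at this
    exact this.symm
  rw [e, ← hc.integral_speed x]
  refine norm_sub_le_integral (fun u => hasDerivAt_deriv hc.smooth u)
    (contDiff_deriv hc.smooth).continuous hc.continuous_speed (fun u => le_rfl)
    ⟨le_rfl, by linarith⟩ ⟨?_, ?_⟩
  · linarith [Int.floor_le (y - x)]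
  · linarith [Int.lt_floor_add_one (y - x)]

lemma IsCauchyH2.exists_len_tendsto (hlam : 0 < lam) {u : ℕ → ℝ → Euc n}
    (hu : ∀ k, IsImmersedCurve (u k)) (hC : IsCauchyH2 lam u) :
    ∃ ℓ : ℝ, 0 ≤ ℓ ∧ Tendsto (fun k => len (u k)) atTop (𝓝 ℓ) := by
  have hmu := isq_pos hlam
  have hcs : CauchySeq fun k => len (u k) := by
    rw [Metric.cauchySeq_iff]
    intro ε hε
    obtain ⟨N, hN⟩ := hC (ENNReal.ofReal (ε / (2 * isq lam))) (by
      rw [ENNReal.ofReal_pos]; positivity)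
    refine ⟨N, fun k hk m hm => ?_⟩
    have := abs_len_sub_le_of_geomDist_lt hlam (hu k) (by positivity) (hN m hm k hk)
    rw [Real.dist_eq]
    refine this.trans_lt ?_
    have e : isq lam * (ε / (2 * isq lam)) = ε / 2 := by field_simp
    rw [e]; linarith
  obtain ⟨ℓ, hℓ⟩ := cauchySeq_tendsto_of_complete hcs
  exact ⟨ℓ, ge_of_tendsto' hℓ fun k => (hu k).len_pos.le, hℓ⟩

lemma exists_strictMono_of_isCauchyH2 {u : ℕ → ℝ → Euc n} (hC : IsCauchyH2 lam u) :
    ∃ N : ℕ → ℕ, StrictMono N ∧ ∀ j, ∀ k ≥ N j, ∀ m ≥ N j,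
      geomDist lam (u k) (u m) < ENNReal.ofReal ((1 / 2) ^ j) := by
  choose N hN using fun j : ℕ => hC (ENNReal.ofReal ((1 / 2) ^ j)) (by
    rw [ENNReal.ofReal_pos]; positivity)
  -- The sum dominates N j, and the summand j makes the sequence strictly increasing.
  refine ⟨fun j => j + ∑ i ∈ Finset.range (j + 1), N i, strictMono_nat_of_lt_succ fun j => ?_,
    fun j k (hk : j + _ ≤ k) m (hm : j + _ ≤ m) => hN j k ?_ m ?_⟩
  · rw [Finset.sum_range_succ _ (j + 1)]
    omega
  all_goals
    have : N j ≤ ∑ i ∈ Finset.range (j + 1), N i :=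
      Finset.single_le_sum (f := N) (fun _ _ => Nat.zero_le _) (by simp)
    omega

lemma lipschitzWith_of_norm_deriv_le {f : ℝ → Euc n} (hf : ContDiff ℝ ∞ f) {A : ℝ}
    (h : ∀ u, ‖deriv f u‖ ≤ A) (x y : ℝ) : ‖f x - f y‖ ≤ A * |x - y| := by
  have := convex_univ.norm_image_sub_le_of_norm_deriv_le (f := f) (C := A)
    (fun x _ => (hf.differentiable (by simp)).differentiableAt) (fun x _ => h x)
    (Set.mem_univ y) (Set.mem_univ x)
  simpa using this

/-- Every Cauchy sequence has a limit curve, and the limit curve is Lipschitz. -/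
theorem exists_limitCurve (hlam : 0 < lam) {u : ℕ → ℝ → Euc n}
    (hu : ∀ k, IsImmersedCurve (u k)) (hC : IsCauchyH2 lam u) :
    ∃ c : ℝ → Euc n, IsClosedCurve c ∧ (∃ A, LipschitzWith A c) ∧ ConvergesToCurve u c := by
  have hmu := isq_pos hlam
  obtain ⟨N, hNm, hN⟩ := exists_strictMono_of_isCauchyH2 hC
  have hδ : ∀ j : ℕ, (0 : ℝ) ≤ (1 / 2) ^ j := fun j => by positivity
  choose! θ hθd hθs hθ using fun j k (hk : N j ≤ k) =>
    exists_diffeo_of_geomDist_lt hlam (hδ j) (hN j (N j) le_rfl k hk)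
  have hN1 : ∀ j, N j ≤ N (j + 1) := fun j => hNm.monotone (Nat.le_succ j)
  -- ψ j composes the first j transition diffeomorphisms, so consecutive curves u (N j) ∘ ψ j differ
  -- pointwise by at most B 2^{-j}.
  set ψ : ℕ → ℝ → ℝ := fun j => Nat.rec (fun u => u) (fun j ψ u => θ j (N (j + 1)) (ψ u)) j
    with hψ_def
  have hψ1 : ∀ j, ψ (j + 1) = fun u => θ j (N (j + 1)) (ψ j u) := fun j => rfl
  have hψ : ∀ j, IsCircleDiffeo (ψ j) := fun j => by
    induction j with
    | zero => exact IsCircleDiffeo.id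
    | succ j ih => rw [hψ1]; exact (hθd j _ (hN1 j)).comp ih
  set c' : ℕ → ℝ → Euc n := fun j x => u (N j) (ψ j x) with hc'_def
  have hc' : ∀ j, IsImmersedCurve (c' j) := fun j => (hu (N j)).comp (hψ j)
  set B := 1 + isq lam with hB_def
  have hstep : ∀ x j, dist (c' j x) (c' (j + 1) x) ≤ B * (1 / 2) ^ j := fun x j => by
    rw [dist_comm, dist_eq_norm]
    exact hθs j _ (hN1 j) (ψ j x)
  choose c hc using fun x => cauchySeq_tendsto_of_complete
    (cauchySeq_of_le_geometric (1 / 2 : ℝ) B (by norm_num) (hstep x))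
  have hcd : ∀ j x, dist (c' j x) (c x) ≤ 2 * B * (1 / 2) ^ j := fun j x => by
    refine (dist_le_of_le_geometric_of_tendsto (1 / 2 : ℝ) B (by norm_num) (hstep x)
      (hc x) j).trans_eq ?_
    ring
  have hpow : ∀ K : ℝ, Tendsto (fun j : ℕ => K * (1 / 2 : ℝ) ^ j) atTop (𝓝 0) := fun K => by
    simpa using (tendsto_pow_atTop_nhds_zero_of_lt_one (r := (1 / 2 : ℝ)) (by norm_num)
      (by norm_num)).const_mul K
  have hper : Function.Periodic c 1 := fun x => by
    refine tendsto_nhds_unique (hc (x + 1)) ?_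
    simp only [fun j => (hc' j).periodic x]
    exact hc x
  have hlip : ∃ A, LipschitzWith A c := by
    obtain ⟨ℓ, hℓ0, hℓ⟩ := hC.exists_len_tendsto hlam hu
    have hℓ' : Tendsto (fun j => len (c' j)) atTop (𝓝 ℓ) := by
      simp only [hc'_def, fun j => len_comp (hu (N j)) (hψ j)]
      exact hℓ.comp hNm.tendsto_atTop
    rcases hℓ0.eq_or_lt with rfl | hℓpos
    -- If the lengths tend to 0 the limit is constant, since two points of a curve are at distance
    -- at most its length.
    · refine ⟨0, LipschitzWith.of_dist_le_mul fun x y => ?_⟩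
      have h1 : Tendsto (fun j => ‖c' j x - c' j y‖) atTop (𝓝 ‖c x - c y‖) :=
        ((hc x).sub (hc y)).norm
      have := le_of_tendsto_of_tendsto' h1 hℓ' fun j => (hc' j).norm_sub_le_len x y
      rw [dist_eq_norm]
      simpa using this
    · have hm : 0 < ℓ / 4 := by positivity
      -- From J on, the length exceeds ℓ/2 and a step of size 2^{-k} costs less than ℓ/4 of it, so
      -- the speed bound applies with m = ℓ/4.
      obtain ⟨J, hJ⟩ := eventually_atTop.1
        ((hℓ'.eventually (lt_mem_nhds (show ℓ / 2 < ℓ by linarith))).and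
          ((hpow (isq lam)).eventually (gt_mem_nhds hm)))
      obtain ⟨M, hM⟩ : ∃ M, ∀ x, ‖deriv (c' J) x‖ ≤ M := by
        have hcont : Continuous (deriv (c' J)) := (contDiff_deriv (hc' J).smooth).continuous
        obtain ⟨M, hM⟩ := isCompact_Icc.exists_bound_of_continuousOn
          (s := Set.Icc (0 : ℝ) 1) hcont.continuousOn
        refine ⟨M, fun x => ?_⟩
        obtain ⟨y, hy, he⟩ := (periodic_deriv (hc' J).periodic).exists_mem_Ico₀ one_pos x
        rw [he]
        exact hM y ⟨hy.1, hy.2.le⟩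
      have hM0 : 0 ≤ M := (norm_nonneg _).trans (hM 0)
      set α := isq lam / (ℓ / 4) with hα
      have hα0 : 0 < α := by positivity
      -- Step k multiplies the speed by at most exp(α 2^{-k}), and 2 − 2·2^{-k} is the sum of 2^{-i}
      -- over i < k. The product of all factors is at most exp(2α).
      have hbd : ∀ i x, ‖deriv (c' (J + i)) x‖ ≤
          Real.exp (α * (2 - 2 * (1 / 2) ^ (J + i))) * M := by
        intro i
        induction i with
        | zero =>
          intro x
          refine (hM x).trans (le_mul_of_one_le_left hM0 (Real.one_le_exp ?_))
          have : (1 / 2 : ℝ) ^ (J + 0) ≤ 1 := pow_le_one₀ (by norm_num) (by norm_num)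
          exact mul_nonneg hα0.le (by linarith)
        | succ i ih =>
          intro x
          set k := J + i with hk
          have hlen := hJ k (by omega)
          have h1 := hθ k _ (hN1 k) (ℓ / 4) hm (by
            have : len (c' k) = len (u (N k)) := len_comp (hu _) (hψ k)
            rw [← this]; linarith [hlen.1, hlen.2]) (ψ k x)
          have h2 : deriv (c' (k + 1)) x = deriv (ψ k) x •
              deriv (fun y => u (N (k + 1)) (θ k (N (k + 1)) y)) (ψ k x) :=
            deriv_comp_diffeo (h := fun y => u (N (k + 1)) (θ k (N (k + 1)) y)) (hψ k)
              ((hu _).smooth.comp (hθd k _ (hN1 k)).smooth) x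
          have h3 : deriv (c' k) x = deriv (ψ k) x • deriv (u (N k)) (ψ k x) :=
            deriv_comp_diffeo (hψ k) (hu _).smooth x
          have h4 := ih x
          rw [← add_assoc, ← hk]
          calc ‖deriv (c' (k + 1)) x‖ ≤ ‖deriv (ψ k) x‖ *
                (Real.exp (α * (1 / 2) ^ k) * ‖deriv (u (N k)) (ψ k x)‖) := by
                rw [h2, norm_smul]; gcongr
            _ = Real.exp (α * (1 / 2) ^ k) * ‖deriv (c' k) x‖ := by rw [h3, norm_smul]; ring
            _ ≤ Real.exp (α * (1 / 2) ^ k) * (Real.exp (α * (2 - 2 * (1 / 2) ^ k)) * M) := by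
                gcongr
            _ = _ := by
                rw [← mul_assoc, ← Real.exp_add]
                congr 2
                rw [pow_succ]; ring
      set A := Real.exp (α * 2) * M
      have hA0 : 0 ≤ A := by positivity
      refine ⟨⟨A, hA0⟩, LipschitzWith.of_dist_le_mul fun x y => ?_⟩
      have h1 : Tendsto (fun i => dist (c' (i + J) x) (c' (i + J) y)) atTop
          (𝓝 (dist (c x) (c y))) :=
        (((hc x).comp (tendsto_add_atTop_nat J))).dist ((hc y).comp (tendsto_add_atTop_nat J))
      refine le_of_tendsto' h1 fun i => ?_
      rw [dist_eq_norm, Real.dist_eq, add_comm i J]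
      refine lipschitzWith_of_norm_deriv_le (hc' _).smooth (fun v => (hbd i v).trans ?_) x y
      change _ ≤ Real.exp (α * 2) * M
      gcongr
      have : (0 : ℝ) ≤ (1 / 2) ^ (J + i) := by positivity
      linarith
  refine ⟨c, ⟨hlip.choose_spec.continuous, hper⟩, hlip, ?_⟩
  -- Extension from the subsequence to the whole sequence: u k is compared with the latest N j ≤ k.
  -- The search is bounded by k, so J ≤ k is needed below as well as N J ≤ k. The errors 2B 2^{-j}
  -- and B 2^{-j} add up to 3B 2^{-j}.
  set jj : ℕ → ℕ := fun k => Nat.findGreatest (fun j => N j ≤ k) k with hjj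
  refine ⟨fun k => if N 0 ≤ k then fun x => θ (jj k) k (ψ (jj k) x) else fun x => x,
    fun k => ?_, ?_⟩
  · dsimp only
    split_ifs with hk
    · exact (hθd _ _ (Nat.findGreatest_spec (P := fun j => N j ≤ k) (Nat.zero_le k) hk)).comp
        (hψ _)
    · exact IsCircleDiffeo.id
  · rw [Metric.tendstoUniformly_iff]
    intro ε hε
    obtain ⟨J, hJ⟩ := eventually_atTop.1 ((hpow (3 * B)).eventually (gt_mem_nhds hε))
    filter_upwards [eventually_ge_atTop (max (N 0) (max (N J) J))] with k hk x
    have hk0 : N 0 ≤ k := (le_max_left _ _).trans hk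
    have hkJ : N J ≤ k := ((le_max_left _ _).trans (le_max_right _ _)).trans hk
    have hkJ' : J ≤ k := ((le_max_right _ _).trans (le_max_right _ _)).trans hk
    have hj1 : N (jj k) ≤ k :=
      Nat.findGreatest_spec (P := fun j => N j ≤ k) (Nat.zero_le k) hk0
    have hj2 : J ≤ jj k := Nat.le_findGreatest hkJ' hkJ
    simp only [hk0, if_true]
    have h1 := hθs (jj k) k hj1 (ψ (jj k) x)
    have h2 := hcd (jj k) x
    have h3 := hJ _ hj2
    rw [← dist_eq_norm] at h1
    calc dist (c x) (u k (θ (jj k) k (ψ (jj k) x)))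
        ≤ dist (c x) (c' (jj k) x) + dist (c' (jj k) x) (u k (θ (jj k) k (ψ (jj k) x))) :=
          dist_triangle _ _ _
      _ ≤ 2 * B * (1 / 2) ^ jj k + B * (1 / 2) ^ jj k := by
          rw [dist_comm (c x), dist_comm _ (u k _)]
          exact add_le_add h2 h1
      _ < ε := by linarith

end LimitCurves

/-! ### Constant speed parametrizations -/

section ArcLength

variable {c : ℝ → Euc n}

/-- An immersed curve has an orientation preserving reparametrization of constant speed. -/
lemma IsImmersedCurve.exists_constantSpeed (hc : IsImmersedCurve c) :
    ∃ τ σ : ℝ → ℝ, IsCircleDiffeo τ ∧ Continuous σ ∧ Monotone σ ∧ (∀ u, σ (u + 1) = σ u + 1) ∧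
      (∀ u, |σ u - u| ≤ 1) ∧ (∀ u, τ (σ u) = u) ∧ ∀ x, ‖deriv (fun y => c (τ y)) x‖ = len c := by
  have hL := hc.len_pos
  set σ : ℝ → ℝ := fun u => (len c)⁻¹ * ∫ v in (0 : ℝ)..u, ‖deriv c v‖ with hσ
  have hs := hc.continuous_speed
  have hd : ∀ u, HasDerivAt σ ((len c)⁻¹ * ‖deriv c u‖) u := fun u =>
    (intervalIntegral.integral_hasDerivAt_right (hs.intervalIntegrable _ _)
      (hs.stronglyMeasurableAtFilter _ _) hs.continuousAt).const_mul _
  have hpos : ∀ u, 0 < (len c)⁻¹ * ‖deriv c u‖ := fun u =>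
    mul_pos (inv_pos.2 hL) (hc.speed_pos u)
  have hmono : StrictMono σ := strictMono_of_hasDerivAt_pos hd hpos
  have hcont : Continuous σ := continuous_iff_continuousAt.2 fun u => (hd u).continuousAt
  have hdeg : ∀ u, σ (u + 1) = σ u + 1 := fun u => by
    simp only [hσ]
    rw [← intervalIntegral.integral_add_adjacent_intervals (hs.intervalIntegrable 0 u)
      (hs.intervalIntegrable u (u + 1)), hc.integral_speed, mul_add, inv_mul_cancel₀ hL.ne']
  have h0 : σ 0 = 0 := by simp [hσ]
  -- The normalized arclength from 0 fixes the integers. This gives surjectivity, and the bound |σ u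
  -- − u| ≤ 1 that later makes limits of such σ possible.
  have hint : ∀ k : ℤ, σ k = k := fun k => by
    have hp : Function.Periodic (fun u => σ u - u) 1 := fun u => by simp only [hdeg u]; ring
    have := hp.int_mul_eq k
    simp only [mul_one, h0, sub_zero] at this
    linarith
  have hsurj : Function.Surjective σ := fun y => by
    have h1 : y ∈ Set.Icc (σ ⌊y⌋) (σ ((⌊y⌋ + 1 : ℤ))) := by
      rw [hint, hint]
      exact ⟨Int.floor_le y, by push_cast; exact (Int.lt_floor_add_one y).le⟩
    obtain ⟨x, -, hx⟩ := intermediate_value_Icc (by push_cast; linarith) hcont.continuousOn h1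
    exact ⟨x, hx⟩
  have hsm : ContDiff ℝ ∞ σ := by
    rw [contDiff_infty_iff_deriv]
    refine ⟨fun u => (hd u).differentiableAt, ?_⟩
    rw [show deriv σ = fun u => (len c)⁻¹ * ‖deriv c u‖ from funext fun u => (hd u).deriv]
    exact contDiff_const.mul ((contDiff_deriv hc.smooth).norm ℝ hc.immersed)
  set e : ℝ ≃ₜ ℝ := (hmono.orderIsoOfSurjective σ hsurj).toHomeomorph with he
  have hee : ∀ u, e u = σ u := fun u => rfl
  have hτs : ContDiff ℝ ∞ e.symm :=
    e.contDiff_symm_deriv (f' := fun u => (len c)⁻¹ * ‖deriv c u‖) (fun u => (hpos u).ne') hd hsm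
  have hτσ : ∀ u, e.symm (σ u) = u := fun u => e.symm_apply_apply u
  have hστ : ∀ u, σ (e.symm u) = u := fun u => e.apply_symm_apply u
  have hτd : ∀ x, (len c)⁻¹ * ‖deriv c (e.symm x)‖ * deriv e.symm x = 1 := fun x => by
    have h1 : HasDerivAt (fun y => σ (e.symm y)) (deriv e.symm x •
        ((len c)⁻¹ * ‖deriv c (e.symm x)‖)) x := (hd _).scomp x (hasDerivAt_deriv hτs x)
    have h2 : HasDerivAt (fun y => σ (e.symm y)) 1 x := by
      simp only [hστ]; exact hasDerivAt_id x
    have := h1.unique h2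
    rw [smul_eq_mul] at this
    linarith
  have hτ : IsCircleDiffeo e.symm := by
    refine ⟨hτs, fun x hx => ?_, Or.inl fun x => ?_⟩
    · have := hτd x
      rw [hx, mul_zero] at this
      exact zero_ne_one this
    · apply hmono.injective
      rw [hστ, hdeg, hστ]
  have hbd : ∀ u, |σ u - u| ≤ 1 := fun u => by
    have h1 := hmono.monotone (Int.floor_le u)
    have h2 := hmono.monotone (show u ≤ ((⌊u⌋ + 1 : ℤ) : ℝ) by
      push_cast; exact (Int.lt_floor_add_one u).le)
    rw [hint] at h1 h2
    push_cast at h2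
    rw [abs_le]
    constructor <;> linarith [Int.floor_le u, Int.lt_floor_add_one u]
  refine ⟨e.symm, σ, hτ, hcont, hmono.monotone, hdeg, hbd, hτσ, fun x => ?_⟩
  rw [deriv_comp_diffeo hτ hc.smooth, norm_smul]
  have h1 := hτd x
  have h2 := hc.speed_pos (e.symm x)
  have h3 : 0 < deriv e.symm x := by
    by_contra! h
    have := mul_nonpos_of_nonneg_of_nonpos (hpos (e.symm x)).le h
    linarith
  rw [Real.norm_eq_abs, abs_of_pos h3]
  field_simp at h1
  linarith

/-- The elastic energy of a curve of constant speed. -/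
lemma IsImmersedCurve.integral_sq_of_constantSpeed (hc : IsImmersedCurve c) {L : ℝ} (hL : 0 < L)
    (h : ∀ u, ‖deriv c u‖ = L) :
    ∫ u in (0 : ℝ)..1, ‖deriv (deriv c) u‖ ^ 2 = L ^ 3 * elasticEnergy c := by
  have e1 : ∀ f, Ds c f = fun u => L⁻¹ • deriv f u := fun f => by ext1 u; rw [Ds, h]
  have e2 : ∀ u, Ds c (Ds c c) u = (L⁻¹ * L⁻¹) • deriv (deriv c) u := fun u => by
    rw [e1, e1]
    dsimp only
    rw [deriv_fun_const_smul _ ((contDiff_deriv hc.smooth).differentiable (by simp) u),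
      smul_smul]
  rw [elasticEnergy, ← intervalIntegral.integral_const_mul]
  refine intervalIntegral.integral_congr fun u _ => ?_
  simp only [e2, h, norm_smul, norm_mul, norm_inv, Real.norm_eq_abs, abs_of_pos hL]
  field_simp

end ArcLength

/-! ### Limits along an ultrafilter -/

section UltraLimits

variable (U : Ultrafilter ℕ)

/-- An ultrafilter takes the place of subsequences: limits can be chosen at all points of an
interval at once, with no diagonal argument. -/
lemma exists_tendsto_ultrafilter {E : Type*} [NormedAddCommGroup E] [ProperSpace E]
    {x : ℕ → E} {M : ℝ} (hx : ∀ k, ‖x k‖ ≤ M) : ∃ y, Tendsto x U (𝓝 y) := by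
  obtain ⟨y, -, hy⟩ := (isCompact_closedBall (0 : E) M).ultrafilter_le_nhds' (U.map x)
    (Filter.mem_map.2 (Filter.Eventually.of_forall fun k => by simpa using hx k))
  exact ⟨y, hy⟩

/-- Banach–Alaoglu in the dual, carried back by the Riesz isomorphism. -/
lemma exists_weakLimit {H : Type*} [NormedAddCommGroup H] [InnerProductSpace ℝ H]
    [CompleteSpace H] {x : ℕ → H} {M : ℝ} (hx : ∀ k, ‖x k‖ ≤ M) :
    ∃ y : H, ∀ z, Tendsto (fun k => inner ℝ (x k) z) U (𝓝 (inner ℝ y z)) := by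
  set D : ℕ → WeakDual ℝ H := fun k =>
    StrongDual.toWeakDual (InnerProductSpace.toDual ℝ H (x k)) with hD
  obtain ⟨y, -, hy⟩ := (WeakDual.isCompact_closedBall (𝕜 := ℝ) (E := H) 0 M).ultrafilter_le_nhds'
    (U.map D) (Filter.mem_map.2 (Filter.Eventually.of_forall fun k => by
      simpa [hD] using hx k))
  refine ⟨(InnerProductSpace.toDual ℝ H).symm (WeakDual.toStrongDual y), fun z => ?_⟩
  rw [InnerProductSpace.toDual_symm_apply]
  exact ((WeakDual.eval_continuous z).tendsto y).comp hy

variable {U}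

/-- Pointwise limits of equi-Lipschitz functions are uniform on `[0, 1]`. -/
lemma eventually_dist_lt_of_lipschitz {E : Type*} [NormedAddCommGroup E] {g : ℕ → ℝ → E}
    {g' : ℝ → E} {A : ℝ} (hA : 0 < A) (hg : ∀ k x y, ‖g k x - g k y‖ ≤ A * |x - y|)
    (hlim : ∀ x, Tendsto (fun k => g k x) U (𝓝 (g' x))) {ε : ℝ} (hε : 0 < ε) :
    ∀ᶠ k in (U : Filter ℕ), ∀ x ∈ Set.Icc (0 : ℝ) 1, ‖g k x - g' x‖ ≤ ε := by
  have hg' : ∀ x y, ‖g' x - g' y‖ ≤ A * |x - y| := fun x y =>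
    le_of_tendsto ((hlim x).sub (hlim y)).norm (Eventually.of_forall fun k => hg k x y)
  obtain ⟨t, ht, hcov⟩ := (isCompact_Icc (a := (0 : ℝ)) (b := 1)).finite_cover_balls
    (show 0 < ε / (3 * A) by positivity)
  have hev : ∀ᶠ k in (U : Filter ℕ), ∀ z ∈ t, ‖g k z - g' z‖ < ε / 3 :=
    (Filter.eventually_all_finite hcov.1).2 fun z _ => by
      have := (tendsto_iff_norm_sub_tendsto_zero.1 (hlim z))
      exact this.eventually (gt_mem_nhds (by positivity))
  filter_upwards [hev] with k hk x hx
  obtain ⟨z, hz, hxz⟩ := Set.mem_iUnion₂.1 (hcov.2 hx)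
  rw [Metric.mem_ball, Real.dist_eq] at hxz
  have h1 : A * |x - z| ≤ ε / 3 := by
    have : A * (ε / (3 * A)) = ε / 3 := by field_simp
    rw [← this]; gcongr
  calc ‖g k x - g' x‖ = ‖(g k x - g k z) + (g k z - g' z) + -(g' x - g' z)‖ := by
        congr 1; abel
    _ ≤ ‖g k x - g k z‖ + ‖g k z - g' z‖ + ‖g' x - g' z‖ := by
        refine (norm_add_le _ _).trans ?_
        rw [norm_neg]
        gcongr
        exact norm_add_le _ _
    _ ≤ ε := by linarith [hg k x z, hg' x z, hk z hz]

end UltraLimits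

lemma norm_integral_sub_le_of_norm_le {E : Type*} [NormedAddCommGroup E] [NormedSpace ℝ E]
    {f g : ℝ → E} {w : ℝ → ℝ} {ε : ℝ} (hf : Continuous f) (hg : Continuous g) (hw : Continuous w)
    (h : ∀ x ∈ Set.Icc (0 : ℝ) 1, ‖f x - g x‖ ≤ ε) :
    ‖(∫ x in (0 : ℝ)..1, w x • f x) - ∫ x in (0 : ℝ)..1, w x • g x‖ ≤
      ε * ∫ x in (0 : ℝ)..1, |w x| := by
  rw [← intervalIntegral.integral_sub (Continuous.intervalIntegrable (by fun_prop) _ _)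
    (Continuous.intervalIntegrable (by fun_prop) _ _), ← intervalIntegral.integral_const_mul]
  refine intervalIntegral.norm_integral_le_of_norm_le zero_le_one
    (ae_of_all _ fun x hx => ?_) (Continuous.intervalIntegrable (by fun_prop) _ _)
  rw [← smul_sub, norm_smul, Real.norm_eq_abs, mul_comm]
  exact mul_le_mul_of_nonneg_right (h x (Set.Ioc_subset_Icc_self hx)) (abs_nonneg _)

/-- Integration by parts on the circle, twice. -/
lemma integral_deriv_deriv_smul {g g' g'' : ℝ → Euc n} {η : ℝ → ℝ}
    (hg : ∀ x, HasDerivAt g (g' x) x) (hg' : ∀ x, HasDerivAt g' (g'' x) x)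
    (hg'' : Continuous g'') (hp : Function.Periodic g 1) (hp' : Function.Periodic g' 1)
    (hη : ContDiff ℝ ∞ η) (hηp : Function.Periodic η 1) :
    ∫ x in (0 : ℝ)..1, deriv (deriv η) x • g x = ∫ x in (0 : ℝ)..1, η x • g'' x := by
  have hη1 := contDiff_deriv hη
  have hη2 := contDiff_deriv hη1
  have hgc : Continuous g := continuous_iff_continuousAt.2 fun x => (hg x).continuousAt
  -- The difference of the two integrands has the periodic primitive η'g − ηg'.
  have hd : ∀ x, HasDerivAt (fun x => deriv η x • g x - η x • g' x)
      (deriv (deriv η) x • g x - η x • g'' x) x := fun x => by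
    have h1 := (hasDerivAt_deriv hη1 x).smul (hg x)
    have h2 := (hasDerivAt_deriv hη x).smul (hg' x)
    refine (h1.sub h2).congr_deriv ?_
    abel
  have hc1 : Continuous fun x => deriv (deriv η) x • g x := hη2.continuous.smul hgc
  have hc2 : Continuous fun x => η x • g'' x := hη.continuous.smul hg''
  rw [← sub_eq_zero, ← intervalIntegral.integral_sub (hc1.intervalIntegrable _ _)
    (hc2.intervalIntegrable _ _), intervalIntegral.integral_eq_sub_of_hasDerivAt
    (fun x _ => hd x) ((hc1.sub hc2).intervalIntegrable _ _)]
  have e : ∀ {X : Type} {f : ℝ → X}, Function.Periodic f 1 → f 1 = f 0 := fun {X f} hf => by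
    have := hf 0; rwa [zero_add] at this
  rw [e (periodic_deriv hηp), e hp, e hηp, e hp', sub_self]

/-! ### Compactness of constant speed curves of bounded energy -/

section Compactness

/-- Cauchy–Schwarz applied to ∫|g''| between y and x. Since |x − y| ≤ 1, this interval lies in one
period, over which ∫|g''|² is at most B. -/
lemma norm_deriv_sub_le_sqrt {g : ℝ → Euc n} (hg : ContDiff ℝ ∞ g) (hp : Function.Periodic g 1)
    {B : ℝ} (hB : ∫ u in (0 : ℝ)..1, ‖deriv (deriv g) u‖ ^ 2 ≤ B) {x y : ℝ} (hxy : |x - y| ≤ 1) :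
    ‖deriv g x - deriv g y‖ ≤ √B * √|x - y| := by
  wlog h : y ≤ x generalizing x y
  · rw [norm_sub_rev, abs_sub_comm]
    exact this (by rwa [abs_sub_comm]) (le_of_not_ge h)
  rw [abs_of_nonneg (sub_nonneg.2 h)] at hxy ⊢
  have hg1 := contDiff_deriv hg
  have hc : Continuous fun u => ‖deriv (deriv g) u‖ := (contDiff_deriv hg1).continuous.norm
  have hc2 : Continuous fun u => ‖deriv (deriv g) u‖ ^ 2 := hc.pow 2
  have hB0 : 0 ≤ B := (intervalIntegral.integral_nonneg zero_le_one
    fun u _ => by positivity).trans hB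
  have h1 : ‖deriv g x - deriv g y‖ ≤ ∫ u in y..x, ‖deriv (deriv g) u‖ := by
    rw [← intervalIntegral.integral_eq_sub_of_hasDerivAt (fun u _ => hasDerivAt_deriv hg1 u)
      ((contDiff_deriv hg1).continuous.intervalIntegrable _ _)]
    exact intervalIntegral.norm_integral_le_integral_norm h
  have h2 := sq_integral_le (f := fun u => ‖deriv (deriv g) u‖) (w := fun _ => 1) h
    (fun _ => zero_le_one) (by simpa using hc.intervalIntegrable _ _)
    (by simpa using hc2.intervalIntegrable _ _) (by simp)
  simp only [mul_one, intervalIntegral.integral_const, smul_eq_mul] at h2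
  have h3 : ∫ u in y..x, ‖deriv (deriv g) u‖ ^ 2 ≤ B := by
    refine le_trans ?_ hB
    have hper : Function.Periodic (fun u => ‖deriv (deriv g) u‖ ^ 2) 1 := fun u => by
      simp only [periodic_deriv (periodic_deriv hp) u]
    have := hper.intervalIntegral_add_eq y 0
    rw [zero_add] at this
    rw [← this]
    exact intervalIntegral.integral_mono_interval le_rfl h (by linarith)
      (ae_of_all _ fun u => by positivity) ((hc.pow 2).intervalIntegrable _ _)
  rw [← Real.sqrt_mul hB0]
  refine h1.trans (Real.le_sqrt_of_sq_le (h2.trans ?_))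
  gcongr

/-- A first order Taylor remainder that depends on g only through B. It passes to pointwise limits
and makes the limit curve differentiable without uniform convergence of the derivatives. -/
lemma norm_sub_sub_smul_le {g : ℝ → Euc n} (hg : ContDiff ℝ ∞ g) (hp : Function.Periodic g 1)
    {B : ℝ} (hB : ∫ u in (0 : ℝ)..1, ‖deriv (deriv g) u‖ ^ 2 ≤ B) {x y : ℝ} (hxy : |y - x| ≤ 1) :
    ‖g y - g x - (y - x) • deriv g x‖ ≤ √B * √|y - x| * |y - x| := by
  have hd : ∀ z, HasDerivAt (fun z => g z - z • deriv g x) (deriv g z - deriv g x) z := fun z => by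
    exact HasDerivAt.congr_deriv (f := fun z => g z - z • deriv g x)
      ((hasDerivAt_deriv hg z).sub ((hasDerivAt_id z).smul_const (deriv g x))) (by simp)
  have := (convex_uIcc x y).norm_image_sub_le_of_norm_hasDerivWithin_le
    (fun z _ => (hd z).hasDerivWithinAt) (C := √B * √|y - x|) (fun z hz => ?_)
    Set.left_mem_uIcc Set.right_mem_uIcc
  · rw [Real.norm_eq_abs] at this
    have e : g y - g x - (y - x) • deriv g x =
        g y - y • deriv g x - (g x - x • deriv g x) := by rw [sub_smul]; abel
    rw [e]
    exact this
  · have hz' : |z - x| ≤ |y - x| := Set.abs_sub_left_of_mem_uIcc hz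
    refine (norm_deriv_sub_le_sqrt hg hp hB (hz'.trans hxy)).trans ?_
    gcongr

/-- The measure on the circle, as a measure on a period. -/
abbrev circleMeasure : Measure ℝ := volume.restrict (Set.Ioc (0 : ℝ) 1)

lemma memLp_circle_of_continuous {f : ℝ → Euc n} (hf : Continuous f) :
    MemLp f 2 circleMeasure := by
  obtain ⟨M, hM⟩ := (isCompact_Icc (a := (0 : ℝ)) (b := 1)).exists_bound_of_continuousOn
    hf.continuousOn
  refine MemLp.of_bound hf.aestronglyMeasurable M ?_
  exact (ae_restrict_iff' measurableSet_Ioc).2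
    (ae_of_all _ fun x hx => hM x (Set.Ioc_subset_Icc_self hx))

lemma inner_toLp_eq {f g : ℝ → Euc n} (hf : MemLp f 2 circleMeasure)
    (hg : MemLp g 2 circleMeasure) :
    inner ℝ (hf.toLp f) (hg.toLp g) = ∫ x in (0 : ℝ)..1, inner ℝ (f x) (g x) := by
  rw [L2.inner_def, intervalIntegral.integral_of_le zero_le_one]
  refine integral_congr_ae ?_
  filter_upwards [hf.coeFn_toLp, hg.coeFn_toLp] with x h1 h2
  rw [h1, h2]

/-- Limits of curves of constant speed and bounded energy. -/
lemma exists_limit_of_constantSpeed (U : Ultrafilter ℕ) {g : ℕ → ℝ → Euc n}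
    (hg : ∀ k, ContDiff ℝ ∞ (g k)) (hp : ∀ k, Function.Periodic (g k) 1) {L : ℕ → ℝ} {ℓ M B A : ℝ}
    (hL : ∀ k u, ‖deriv (g k) u‖ = L k) (hLA : ∀ k, L k ≤ A) (hLℓ : Tendsto L U (𝓝 ℓ))
    (hM : ∀ k u, ‖g k u‖ ≤ M)
    (hB : ∀ k, ∫ u in (0 : ℝ)..1, ‖deriv (deriv (g k)) u‖ ^ 2 ≤ B) :
    ∃ (g' v κ : ℝ → Euc n), (∀ u, Tendsto (fun k => g k u) U (𝓝 (g' u))) ∧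
      (∀ u, HasDerivAt g' (v u) u) ∧ (∀ u, ‖v u‖ = ℓ) ∧ Measurable κ ∧
      MemLp κ 2 circleMeasure ∧
      ∀ η : ℝ → ℝ, ContDiff ℝ ∞ η → Function.Periodic η 1 →
        ∫ x in (0 : ℝ)..1, deriv (deriv η) x • g' x = ∫ x in (0 : ℝ)..1, η x • κ x := by
  choose g' hg' using fun u => exists_tendsto_ultrafilter U (fun k => hM k u)
  choose v hv using fun u => exists_tendsto_ultrafilter U (x := fun k => deriv (g k) u)
    (fun k => (hL k u).trans_le (hLA k))
  have hcd : ∀ k, Continuous (deriv (deriv (g k))) := fun k =>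
    (contDiff_deriv (contDiff_deriv (hg k))).continuous
  have hml : ∀ k, MemLp (deriv (deriv (g k))) 2 circleMeasure := fun k =>
    memLp_circle_of_continuous (hcd k)
  obtain ⟨W, hW⟩ := exists_weakLimit U (x := fun k => (hml k).toLp _) (M := √B) fun k => by
    refine Real.le_sqrt_of_sq_le ?_
    rw [← real_inner_self_eq_norm_sq, inner_toLp_eq (hml k) (hml k)]
    simp only [real_inner_self_eq_norm_sq]
    exact hB k
  have hderiv : ∀ u, HasDerivAt g' (v u) u := fun u => by
    rw [hasDerivAt_iff_isLittleO]
    have hb : ∀ y, |y - u| ≤ 1 → ‖g' y - g' u - (y - u) • v u‖ ≤ √B * √|y - u| * |y - u| :=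
      fun y hy => le_of_tendsto (((hg' y).sub (hg' u)).sub ((hv u).const_smul (y - u))).norm
        (Eventually.of_forall fun k => norm_sub_sub_smul_le (hg k) (hp k) (hB k) hy)
    rw [Asymptotics.isLittleO_iff]
    intro ε hε
    have hlim : Tendsto (fun y => √B * √|y - u|) (𝓝 u) (𝓝 0) := by
      have hc : Continuous fun y => √B * √|y - u| := by fun_prop
      simpa using hc.tendsto u
    filter_upwards [hlim.eventually (gt_mem_nhds hε), Metric.ball_mem_nhds u one_pos] with y h1 h2
    rw [Metric.mem_ball, Real.dist_eq] at h2
    refine (hb y h2.le).trans ?_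
    rw [Real.norm_eq_abs]
    gcongr
  have hg'c : Continuous g' := continuous_iff_continuousAt.2 fun u => (hderiv u).continuousAt
  refine ⟨g', v, W, hg', hderiv, fun u => ?_, (Lp.stronglyMeasurable W).measurable, Lp.memLp W,
    fun η hη hηp => ?_⟩
  · refine tendsto_nhds_unique ((hv u).norm) ?_
    simp only [hL]
    exact hLℓ
  -- Pairing with a fixed vector e turns the vector identity into inner products with the test field
  -- η e, to which the weak convergence applies.
  · refine ext_inner_right ℝ fun e => ?_
    have hη2 := (contDiff_deriv (contDiff_deriv hη)).continuous
    have hmη : MemLp (fun x => η x • e) 2 circleMeasure :=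
      memLp_circle_of_continuous (hη.continuous.smul continuous_const)
    have hint : ∀ f : ℝ → Euc n, MemLp f 2 circleMeasure →
        IntervalIntegrable (fun x => η x • f x) volume 0 1 := fun f hf => by
      have h1 : IntervalIntegrable f volume 0 1 :=
        (intervalIntegrable_iff_integrableOn_Ioc_of_le zero_le_one).2 (hf.integrable one_le_two)
      exact h1.continuousOn_smul hη.continuous.continuousOn
    have hinner : ∀ f : ℝ → Euc n, MemLp f 2 circleMeasure →
        inner ℝ (∫ x in (0 : ℝ)..1, η x • f x) e = ∫ x in (0 : ℝ)..1, inner ℝ (f x) (η x • e) := by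
      intro f hf
      rw [real_inner_comm, intervalIntegral.integral_of_le zero_le_one,
        intervalIntegral.integral_of_le zero_le_one, ← integral_inner (hint f hf).1 e]
      refine integral_congr_ae (ae_of_all _ fun x => ?_)
      simp only [real_inner_smul_right, real_inner_comm]
    have h1 := hW (hmη.toLp _)
    simp only [inner_toLp_eq] at h1
    have h2 : inner ℝ W (hmη.toLp _) = inner ℝ (∫ x in (0 : ℝ)..1, η x • W x) e := by
      rw [hinner _ (Lp.memLp W), ← inner_toLp_eq (Lp.memLp W) hmη, Lp.toLp_coeFn]
    rw [h2] at h1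
    refine tendsto_nhds_unique ?_ h1
    have h3 : ∀ k, ∫ x in (0 : ℝ)..1, inner ℝ (deriv (deriv (g k)) x) (η x • e) =
        inner ℝ (∫ x in (0 : ℝ)..1, deriv (deriv η) x • g k x) e := fun k => by
      rw [← hinner _ (hml k), integral_deriv_deriv_smul (fun x => hasDerivAt_deriv (hg k) x)
        (fun x => hasDerivAt_deriv (contDiff_deriv (hg k)) x) (hcd k) (hp k)
        (periodic_deriv (hp k)) hη hηp]
    simp only [h3]
    refine Tendsto.inner ?_ tendsto_const_nhds
    rw [Metric.tendsto_nhds]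
    intro ε hε
    set I := ∫ x in (0 : ℝ)..1, |deriv (deriv η) x| with hI
    have hI0 : 0 ≤ I := intervalIntegral.integral_nonneg zero_le_one fun x _ => abs_nonneg _
    have hA0 : 0 ≤ A := ((norm_nonneg _).trans_eq (hL 0 0)).trans (hLA 0)
    -- A may be 0, while the Lipschitz constant has to be positive here.
    filter_upwards [eventually_dist_lt_of_lipschitz (A := A + 1) (by positivity)
      (fun k x y => lipschitzWith_of_norm_deriv_le (hg k)
        (fun u => (hL k u).trans_le ((hLA k).trans (by linarith))) x y) hg'
      (show 0 < ε / (I + 1) by positivity)] with k hk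
    rw [dist_eq_norm]
    refine (norm_integral_sub_le_of_norm_le (hg k).continuous hg'c hη2 hk).trans_lt ?_
    rw [← hI, div_mul_eq_mul_div, div_lt_iff₀ (by positivity)]
    nlinarith

end Compactness

/-! ### Curves of the completion have finite energy -/

section FiniteEnergy

/-- If σ' jumped at x, the curves g k would run through the jump interval during arbitrarily short
parameter intervals around x. Then g' would be constant, equal to c' x, on that interval, against
its nonzero derivative. -/
lemma continuous_of_monotone_limit {U : Ultrafilter ℕ} {σ : ℕ → ℝ → ℝ} {σ' : ℝ → ℝ}
    {c : ℕ → ℝ → Euc n} {c' : ℝ → Euc n} {g : ℕ → ℝ → Euc n} {g' v : ℝ → Euc n}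
    (hσc : ∀ k, Continuous (σ k)) (hσ' : Monotone σ')
    (hσ : ∀ x, Tendsto (fun k => σ k x) U (𝓝 (σ' x))) (hcg : ∀ k x, c k x = g k (σ k x))
    (hg : ∀ x, Tendsto (fun k => g k x) U (𝓝 (g' x))) (hc' : Continuous c')
    (hc : ∀ ε > 0, ∀ᶠ k in (U : Filter ℕ), ∀ x, ‖c k x - c' x‖ ≤ ε)
    (hd : ∀ x, HasDerivAt g' (v x) x) (hv : ∀ x, v x ≠ 0) : Continuous σ' := by
  refine continuous_iff_continuousAt.2 fun x => ?_
  rw [hσ'.continuousAt_iff_leftLim_eq_rightLim]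
  by_contra hne
  have hlt : Function.leftLim σ' x < Function.rightLim σ' x :=
    lt_of_le_of_ne (hσ'.leftLim_le_rightLim le_rfl) hne
  have hconst : ∀ y ∈ Set.Ioo (Function.leftLim σ' x) (Function.rightLim σ' x),
      g' y = c' x := by
    intro y hy
    refine eq_of_forall_dist_le fun ε hε => ?_
    obtain ⟨δ, hδ, hδc⟩ := Metric.continuous_iff.1 hc' x (ε / 2) (by positivity)
    have hz : σ' (x - δ / 2) < y := (hσ'.le_leftLim (by linarith)).trans_lt hy.1
    have hw : y < σ' (x + δ / 2) := hy.2.trans_le (hσ'.rightLim_le (by linarith))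
    rw [dist_eq_norm]
    refine le_of_tendsto ((hg y).sub tendsto_const_nhds).norm ?_
    filter_upwards [(hσ _).eventually (gt_mem_nhds hz), (hσ _).eventually (lt_mem_nhds hw),
      hc (ε / 2) (by positivity)] with k h1 h2 h3
    obtain ⟨t, ht, hty⟩ := intermediate_value_Icc (show x - δ / 2 ≤ x + δ / 2 by linarith)
      (hσc k).continuousOn ⟨h1.le, h2.le⟩
    have h4 := hδc t (by
      rw [Real.dist_eq, abs_lt]; constructor <;> linarith [ht.1, ht.2])
    rw [← hty, ← hcg]
    calc ‖c k t - c' x‖ ≤ ‖c k t - c' t‖ + ‖c' t - c' x‖ := norm_sub_le_norm_sub_add_norm_sub _ _ _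
      _ ≤ ε / 2 + ε / 2 := add_le_add (h3 t) (by rw [← dist_eq_norm]; exact h4.le)
      _ = ε := by ring
  obtain ⟨y, hy⟩ := exists_between hlt
  have h1 : HasDerivAt g' 0 y := by
    refine (hasDerivAt_const y (c' x)).congr_of_eventuallyEq ?_
    filter_upwards [Ioo_mem_nhds hy.1 hy.2] with z hz
    exact hconst z hz
  exact hv y ((hd y).unique h1)

lemma setLIntegral_Ioc_scale {ℓ : ℝ} (hℓ : 0 < ℓ) (F : ℝ → ℝ≥0∞) :
    ∫⁻ s in Set.Ioc 0 ℓ, F s = ENNReal.ofReal ℓ * ∫⁻ x in Set.Ioc (0 : ℝ) 1, F (ℓ * x) := by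
  have himg : (fun x => ℓ * x) '' Set.Ioc (0 : ℝ) 1 = Set.Ioc 0 ℓ := by
    rw [Set.image_mul_left_Ioc hℓ, mul_zero, mul_one]
  rw [← himg, lintegral_image_eq_lintegral_abs_deriv_mul measurableSet_Ioc
    (f' := fun _ => ℓ) (fun x _ => by simpa using ((hasDerivAt_id x).const_mul ℓ).hasDerivWithinAt)
    (mul_right_injective₀ hℓ.ne').injOn, abs_of_pos hℓ,
    lintegral_const_mul' _ _ ENNReal.ofReal_ne_top]

lemma memLp_two_iff {κ : ℝ → Euc n} (hκ : Measurable κ) {μ : Measure ℝ} :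
    MemLp κ 2 μ ↔ ∫⁻ s, ‖κ s‖ₑ ^ 2 ∂μ < ⊤ := by
  rw [MemLp, and_iff_right hκ.aestronglyMeasurable,
    eLpNorm_lt_top_iff_lintegral_rpow_enorm_lt_top (by simp) (by simp)]
  simp

lemma weakEnergy_lt_top_iff {ℓ : ℝ} (hℓ : 0 < ℓ) {κ : ℝ → Euc n} (hκ : Measurable κ) :
    weakEnergy ℓ κ < ⊤ ↔ MemLp (fun x => κ (ℓ * x)) 2 circleMeasure := by
  have hm : Measurable fun x => κ (ℓ * x) := hκ.comp (measurable_const_mul ℓ)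
  rw [memLp_two_iff hm, weakEnergy, setLIntegral_Ioc_scale hℓ,
    ENNReal.mul_lt_top_iff]
  have : ENNReal.ofReal ℓ ≠ 0 := by simpa using hℓ
  simp only [ENNReal.ofReal_lt_top, true_and, this, false_or, or_iff_left_iff_imp]
  intro h
  rw [h]; exact ENNReal.zero_lt_top

lemma deriv_deriv_comp_mul {η : ℝ → ℝ} (hη : ContDiff ℝ ∞ η) (ℓ x : ℝ) :
    deriv (deriv fun y => η (ℓ * y)) x = ℓ ^ 2 * deriv (deriv η) (ℓ * x) := by
  have h : ∀ {f : ℝ → ℝ}, ContDiff ℝ ∞ f → ∀ y, HasDerivAt (fun y => f (ℓ * y))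
      (ℓ * deriv f (ℓ * y)) y := fun {f} hf y => by
    exact HasDerivAt.congr_deriv (f := fun y => f (ℓ * y))
      ((hasDerivAt_deriv hf (ℓ * y)).scomp y ((hasDerivAt_id y).const_mul ℓ)) (by simp)
  rw [show deriv (fun y => η (ℓ * y)) = fun y => ℓ * deriv η (ℓ * y) from
    funext fun y => (h hη y).deriv, ((h (contDiff_deriv hη) x).const_mul ℓ).deriv]
  ring

/-- The weak formulation of the second derivative, scaled to the circle of length `1`. -/
lemma weak_iff_scale {ℓ : ℝ} (hℓ : 0 < ℓ) (γ κ : ℝ → Euc n) :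
    (∀ η : ℝ → ℝ, ContDiff ℝ ∞ η → Function.Periodic η ℓ →
      ∫ s in (0 : ℝ)..ℓ, deriv (deriv η) s • γ s = ∫ s in (0 : ℝ)..ℓ, η s • κ s) ↔
    ∀ η : ℝ → ℝ, ContDiff ℝ ∞ η → Function.Periodic η 1 →
      ∫ x in (0 : ℝ)..1, deriv (deriv η) x • γ (ℓ * x) =
        ∫ x in (0 : ℝ)..1, η x • (ℓ ^ 2 • κ (ℓ * x)) := by
  have hsc : ∀ F : ℝ → Euc n, ∫ s in (0 : ℝ)..ℓ, F s = ℓ • ∫ x in (0 : ℝ)..1, F (ℓ * x) :=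
    fun F => by
      rw [intervalIntegral.smul_integral_comp_mul_left, mul_zero, mul_one]
  have key : ∀ η : ℝ → ℝ, ContDiff ℝ ∞ η →
      ((∫ s in (0 : ℝ)..ℓ, deriv (deriv η) s • γ s = ∫ s in (0 : ℝ)..ℓ, η s • κ s) ↔
      ∫ x in (0 : ℝ)..1, deriv (deriv fun y => η (ℓ * y)) x • γ (ℓ * x) =
        ∫ x in (0 : ℝ)..1, η (ℓ * x) • (ℓ ^ 2 • κ (ℓ * x))) := fun η hη => by
    rw [hsc, hsc]
    simp only [deriv_deriv_comp_mul hη, mul_smul]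
    simp only [smul_comm _ (ℓ ^ 2), intervalIntegral.integral_smul]
    rw [smul_right_inj hℓ.ne', smul_right_inj (pow_ne_zero 2 hℓ.ne')]
  constructor
  · intro h η hη hp
    have hη' : ContDiff ℝ ∞ fun s => η (s / ℓ) := hη.comp (contDiff_id.div_const ℓ)
    have := (key _ hη').1 (h _ hη' fun s => by
      simp only [add_div, div_self hℓ.ne', hp (s / ℓ)])
    simpa only [mul_div_cancel_left₀ _ hℓ.ne'] using this
  · intro h η hη hp
    refine (key η hη).2 (h _ (hη.comp (contDiff_const.mul contDiff_id)) fun x => ?_)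
    simp only [mul_add, mul_one, hp (ℓ * x)]

/-- A curve is of finite energy if it is, up to a monotone reparametrization, of constant speed
with square integrable second derivative. -/
lemma hasFiniteEnergy_of_constantSpeed {c g v κ : ℝ → Euc n} {σ : ℝ → ℝ} {ℓ : ℝ} (hℓ : 0 < ℓ)
    (hσ : IsReparam σ) (hc : ∀ x, c x = g (σ x)) (hg : Function.Periodic g 1)
    (hd : ∀ x, HasDerivAt g (v x) x) (hv : ∀ x, ‖v x‖ = ℓ) (hκm : Measurable κ)
    (hκ : MemLp κ 2 circleMeasure)
    (hw : ∀ η : ℝ → ℝ, ContDiff ℝ ∞ η → Function.Periodic η 1 →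
      ∫ x in (0 : ℝ)..1, deriv (deriv η) x • g x = ∫ x in (0 : ℝ)..1, η x • κ x) :
    HasFiniteEnergy c := by
  set γ : ℝ → Euc n := fun s => g (s / ℓ) with hγ
  set κ' : ℝ → Euc n := fun s => (ℓ ^ 2)⁻¹ • κ (s / ℓ) with hκ'
  have hγℓ : ∀ x, γ (ℓ * x) = g x := fun x => by simp only [hγ, mul_div_cancel_left₀ _ hℓ.ne']
  have hκℓ : ∀ x, κ' (ℓ * x) = (ℓ ^ 2)⁻¹ • κ x := fun x => by
    simp only [hκ', mul_div_cancel_left₀ _ hℓ.ne']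
  have hγd : ∀ s, HasDerivAt γ (ℓ⁻¹ • v (s / ℓ)) s := fun s => by
    exact HasDerivAt.congr_deriv (f := γ)
      ((hd (s / ℓ)).scomp s ((hasDerivAt_id s).div_const ℓ)) (by simp)
  have hγn : ∀ s, ‖deriv γ s‖ = 1 := fun s => by
    rw [(hγd s).deriv, norm_smul, hv, norm_inv, Real.norm_eq_abs, abs_of_pos hℓ,
      inv_mul_cancel₀ hℓ.ne']
  have hκ'm : Measurable κ' :=
    Measurable.const_smul (g := fun s => κ (s / ℓ)) (hκm.comp (measurable_id.div_const ℓ))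
      ((ℓ ^ 2)⁻¹)
  have hE : weakEnergy ℓ κ' < ⊤ := by
    rw [weakEnergy_lt_top_iff hℓ hκ'm]
    simp only [hκℓ]
    exact MemLp.const_smul hκ ((ℓ ^ 2)⁻¹)
  refine ⟨ℓ, γ, κ', ⟨hℓ, fun s => ?_, ?_, ae_of_all _ hγn, σ, hσ, fun x => ?_⟩,
    ⟨hκ'm, ?_, ?_⟩, hE⟩
  · simp only [hγ, add_div, div_self hℓ.ne', hg (s / ℓ)]
  · exact lipschitzWith_of_nnnorm_deriv_le (fun s => (hγd s).differentiableAt) fun s => by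
      rw [← NNReal.coe_le_coe, coe_nnnorm, hγn s, NNReal.coe_one]
  · rw [hc, hγℓ]
  · rw [intervalIntegrable_iff_integrableOn_Ioc_of_le hℓ.le]
    exact ((memLp_two_iff hκ'm (μ := volume.restrict (Set.Ioc 0 ℓ))).2 hE).integrable one_le_two
  · rw [weak_iff_scale hℓ]
    simp only [hγℓ, hκℓ, smul_smul, mul_inv_cancel₀ (pow_ne_zero 2 hℓ.ne'), one_smul]
    simpa only [mul_assoc, mul_inv_cancel₀ (pow_ne_zero 2 hℓ.ne'), mul_one] using hw

/-- The non-constant curves of the completion have finite energy. -/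
theorem hasFiniteEnergy_of_inCompletion {lam : ℝ} (hlam : 0 < lam) {c : ℝ → Euc n}
    (hc : IsClosedCurve c) (hne : NonConstant c) (h : InCompletion lam c) :
    HasFiniteEnergy c := by
  obtain ⟨w, hw, hC, φ, hφ, hlim⟩ := h
  have hmu := isq_pos hlam
  obtain ⟨ℓ, hℓ0, hℓ⟩ := hC.exists_len_tendsto hlam hw
  rw [Metric.tendstoUniformly_iff] at hlim
  have hptw : ∀ x, Tendsto (fun k => w k (φ k x)) atTop (𝓝 (c x)) := fun x => by
    rw [Metric.tendsto_nhds]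
    intro ε hε
    filter_upwards [hlim ε hε] with k hk
    rw [dist_comm]; exact hk x
  -- Two distinct points of the limit curve bound the lengths from below.
  have hℓpos : 0 < ℓ := by
    obtain ⟨x, y, hxy⟩ := hne
    have := le_of_tendsto_of_tendsto' ((hptw x).sub (hptw y)).norm hℓ
      fun k => (hw k).norm_sub_le_len _ _
    exact (norm_pos_iff.2 (sub_ne_zero.2 hxy)).trans_le this
  have hδ : 0 < ℓ / (8 * isq lam) := by positivity
  have hmδ : isq lam * (ℓ / (8 * isq lam)) = ℓ / 8 := by field_simp
  obtain ⟨N₁, hN₁⟩ := hC (ENNReal.ofReal (ℓ / (8 * isq lam))) (by rwa [ENNReal.ofReal_pos])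
  obtain ⟨N₂, hN₂⟩ := eventually_atTop.1 ((hℓ.eventually (Ioo_mem_nhds
    (show ℓ / 2 < ℓ by linarith) (show ℓ < 2 * ℓ by linarith))).and (hlim 1 one_pos))
  set N := max N₁ N₂
  set ck : ℕ → ℝ → Euc n := fun k x => w (k + N) (φ (k + N) x) with hck
  have hcki : ∀ k, IsImmersedCurve (ck k) := fun k => (hw _).comp (hφ _)
  have hlenck : ∀ k, len (ck k) = len (w (k + N)) := fun k => len_comp (hw _) (hφ _)
  have hEck : ∀ k, elasticEnergy (ck k) = elasticEnergy (w (k + N)) := fun k =>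
    elasticEnergy_comp (hw _) (hφ _)
  -- All later terms are within ℓ/(8 λ^{-1/2}) of w N, whose length exceeds ℓ/2 ≥ ℓ/4 + ℓ/8, so the
  -- energy estimate from w N holds with m = ℓ/4.
  obtain ⟨D, hD⟩ : ∃ D, ∀ k, elasticEnergy (ck k) ≤ D := by
    refine ⟨Real.exp (energyConst lam (ℓ / 4) * (ℓ / (8 * isq lam))) *
      (1 + elasticEnergy (w N)), fun k => ?_⟩
    have := one_add_energy_le_of_geomDist_lt hlam (hw (k + N)) (m := ℓ / 4) hδ.le (by positivity)
      (by rw [hmδ]; linarith [(hN₂ N (le_max_right _ _)).1.1])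
      (hN₁ N (le_max_left _ _) (k + N) ((le_max_left _ _).trans (Nat.le_add_left _ _)))
    rw [hEck]; linarith
  have hlen : ∀ k, len (ck k) ≤ 2 * ℓ := fun k => by
    rw [hlenck]
    exact (hN₂ (k + N) ((le_max_right _ _).trans (Nat.le_add_left _ _))).1.2.le
  obtain ⟨M, hM⟩ : ∃ M, ∀ x, ‖c x‖ ≤ M := by
    obtain ⟨M, hM⟩ := isCompact_Icc.exists_bound_of_continuousOn
      (s := Set.Icc (0 : ℝ) 1) hc.continuous.continuousOn
    refine ⟨M, fun x => ?_⟩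
    obtain ⟨y, hy, he⟩ := hc.periodic.exists_mem_Ico₀ one_pos x
    rw [he]
    exact hM y ⟨hy.1, hy.2.le⟩
  have hckM : ∀ k x, ‖ck k x‖ ≤ M + 1 := fun k x => by
    have h1 := (hN₂ (k + N) ((le_max_right _ _).trans (Nat.le_add_left _ _))).2 x
    rw [dist_eq_norm, norm_sub_rev] at h1
    have h2 := norm_le_norm_add_norm_sub (c x) (ck k x)
    rw [norm_sub_rev] at h2
    linarith [hM x]
  choose τ σ hτ hσc hσm hσd hσb hτσ hspeed using fun k => (hcki k).exists_constantSpeed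
  set g : ℕ → ℝ → Euc n := fun k x => ck k (τ k x) with hg
  have hgi : ∀ k, IsImmersedCurve (g k) := fun k => (hcki k).comp (hτ k)
  -- A free ultrafilter refines `atTop`, so the convergence of lengths and of curves persists along
  -- it.
  set U : Ultrafilter ℕ := hyperfilter ℕ
  have hU : (U : Filter ℕ) ≤ atTop := Nat.hyperfilter_le_atTop
  have hshift : Tendsto (fun k => k + N) U atTop := (tendsto_add_atTop_nat N).mono_left hU
  obtain ⟨g', v, κ, hgg', hgd, hv, hκm, hκ, hweak⟩ := exists_limit_of_constantSpeed U
    (fun k => (hgi k).smooth) (fun k => (hgi k).periodic) (L := fun k => len (ck k))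
    (ℓ := ℓ) (M := M + 1) (B := (2 * ℓ) ^ 3 * D) (A := 2 * ℓ) hspeed hlen
    (by simp only [hlenck]; exact hℓ.comp hshift) (fun k x => hckM k _) fun k => by
      rw [(hgi k).integral_sq_of_constantSpeed (hcki k).len_pos (hspeed k),
        elasticEnergy_comp (hcki k) (hτ k)]
      have := (hcki k).len_pos
      have := elasticEnergy_nonneg (ck k)
      have := hlen k
      have := hD k
      gcongr
  -- The arclength maps also converge pointwise, because |σ k x − x| ≤ 1. The limit is monotone of
  -- degree 1; only its continuity needs a separate argument.
  choose σ' hσ' using fun x => exists_tendsto_ultrafilter U (x := fun k => σ k x)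
    (M := |x| + 1) fun k => by
      have := abs_add_le x (σ k x - x)
      rw [add_sub_cancel] at this
      rw [Real.norm_eq_abs]
      linarith [hσb k x]
  have hσ'm : Monotone σ' := fun x y hxy =>
    le_of_tendsto_of_tendsto' (hσ' x) (hσ' y) fun k => hσm k hxy
  have hσ'd : ∀ x, σ' (x + 1) = σ' x + 1 := fun x => by
    refine tendsto_nhds_unique (hσ' (x + 1)) ?_
    simp only [hσd]
    exact (hσ' x).add_const 1
  have hckg : ∀ k x, ck k x = g k (σ k x) := fun k x => by simp only [hg, hτσ]
  have hcg : ∀ x, c x = g' (σ' x) := fun x => by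
    have h1 : Tendsto (fun k => ck k x) U (𝓝 (c x)) := (hptw x).comp hshift
    refine tendsto_nhds_unique h1 ?_
    rw [tendsto_iff_norm_sub_tendsto_zero]
    have h2 : Tendsto (fun k => 2 * ℓ * |σ k x - σ' x| + ‖g k (σ' x) - g' (σ' x)‖) U (𝓝 0) := by
      have e1 := (tendsto_iff_norm_sub_tendsto_zero.1 (hσ' x)).const_mul (2 * ℓ)
      have e2 := tendsto_iff_norm_sub_tendsto_zero.1 (hgg' (σ' x))
      simpa using e1.add e2
    refine squeeze_zero (fun k => norm_nonneg _) (fun k => ?_) h2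
    rw [hckg]
    refine (norm_sub_le_norm_sub_add_norm_sub _ (g k (σ' x)) _).trans ?_
    gcongr
    exact lipschitzWith_of_norm_deriv_le (hgi k).smooth
      (fun u => (hspeed k u).trans_le (hlen k)) _ _
  refine hasFiniteEnergy_of_constantSpeed hℓpos
    (σ := σ') ⟨?_, Or.inl ⟨hσ'm, hσ'd⟩⟩ hcg (fun x => ?_) hgd hv hκm hκ hweak
  · refine continuous_of_monotone_limit hσc hσ'm hσ' hckg hgg' hc.continuous (fun ε hε => ?_) hgd
      fun x => norm_pos_iff.1 (by rw [hv]; exact hℓpos)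
    filter_upwards [hshift.eventually (hlim ε hε)] with k hk x
    rw [← dist_eq_norm, dist_comm]
    exact (hk x).le
  · refine tendsto_nhds_unique (hgg' (x + 1)) ?_
    simp only [fun k => (hgi k).periodic x]
    exact hgg' x

end FiniteEnergy

/-! ### H² curves and the length of linear homotopies -/

section H2Curves

/-- The closed curve `g` is of class `H²`, with derivatives `g' = v` and `g'' = κ`. -/
structure H2Curve (g v κ : ℝ → Euc n) : Prop where
  periodic : Function.Periodic g 1
  periodic_deriv : Function.Periodic v 1
  hasDerivAt : ∀ x, HasDerivAt g (v x) x
  continuous_deriv : Continuous v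
  memLp : MemLp κ 2 circleMeasure
  eq_integral : ∀ x ∈ Set.Icc (0 : ℝ) 1, v x = v 0 + ∫ u in (0 : ℝ)..x, κ u

/-- The square of the `L²` norm on the circle. -/
def sqNorm (κ : ℝ → Euc n) : ℝ := ∫ u in (0 : ℝ)..1, ‖κ u‖ ^ 2

lemma sqNorm_nonneg (κ : ℝ → Euc n) : 0 ≤ sqNorm κ :=
  intervalIntegral.integral_nonneg zero_le_one fun _ _ => by positivity

lemma intervalIntegrable_of_memLp {κ : ℝ → Euc n} (hκ : MemLp κ 2 circleMeasure) :
    IntervalIntegrable κ volume 0 1 :=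
  (intervalIntegrable_iff_integrableOn_Ioc_of_le zero_le_one).2 (hκ.integrable one_le_two)

lemma intervalIntegrable_sq_of_memLp {κ : ℝ → Euc n} (hκ : MemLp κ 2 circleMeasure) :
    IntervalIntegrable (fun u => ‖κ u‖ ^ 2) volume 0 1 :=
  (intervalIntegrable_iff_integrableOn_Ioc_of_le zero_le_one).2
    ((memLp_two_iff_integrable_sq_norm hκ.1).1 hκ)

lemma integral_norm_le_sqrt {κ : ℝ → Euc n} (hκ : MemLp κ 2 circleMeasure) :
    ∫ u in (0 : ℝ)..1, ‖κ u‖ ≤ √(sqNorm κ) := by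
  refine Real.le_sqrt_of_sq_le ?_
  have := sq_integral_le (f := fun u => ‖κ u‖) (w := fun _ => 1) zero_le_one
    (fun _ => zero_le_one) (by simpa using (intervalIntegrable_of_memLp hκ).norm)
    (by simpa using intervalIntegrable_sq_of_memLp hκ) (by simp)
  simpa [sqNorm] using this

lemma sqNorm_add_le {κ κ' : ℝ → Euc n} (hκ : MemLp κ 2 circleMeasure)
    (hκ' : MemLp κ' 2 circleMeasure) :
    sqNorm (fun u => κ u + κ' u) ≤ 2 * sqNorm κ + 2 * sqNorm κ' := by
  have h1 := (intervalIntegrable_sq_of_memLp hκ).const_mul 2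
  have h2 := (intervalIntegrable_sq_of_memLp hκ').const_mul 2
  rw [sqNorm, sqNorm, sqNorm, ← intervalIntegral.integral_const_mul,
    ← intervalIntegral.integral_const_mul, ← intervalIntegral.integral_add h1 h2]
  refine intervalIntegral.integral_mono_on zero_le_one
    (intervalIntegrable_sq_of_memLp (hκ.add hκ')) (h1.add h2) fun u _ => ?_
  have := norm_add_le (κ u) (κ' u)
  nlinarith [sq_nonneg (‖κ u‖ - ‖κ' u‖), norm_nonneg (κ u + κ' u), norm_nonneg (κ u),
    norm_nonneg (κ' u)]

lemma sqNorm_smul (t : ℝ) (κ : ℝ → Euc n) : sqNorm (fun u => t • κ u) = t ^ 2 * sqNorm κ := by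
  simp only [sqNorm, norm_smul, mul_pow, Real.norm_eq_abs, sq_abs,
    intervalIntegral.integral_const_mul]

variable {g v κ h w ν : ℝ → Euc n}

lemma H2Curve.add_smul (hg : H2Curve g v κ) (hh : H2Curve h w ν) (t : ℝ) :
    H2Curve (fun x => g x + t • h x) (fun x => v x + t • w x) (fun x => κ x + t • ν x) where
  periodic x := by simp only [hg.periodic x, hh.periodic x]
  periodic_deriv x := by simp only [hg.periodic_deriv x, hh.periodic_deriv x]
  hasDerivAt x := (hg.hasDerivAt x).add ((hh.hasDerivAt x).const_smul t)
  continuous_deriv := hg.continuous_deriv.add (hh.continuous_deriv.const_smul t)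
  memLp := hg.memLp.add (hh.memLp.const_smul t)
  eq_integral x hx := by
    have hsub : Set.uIcc 0 x ⊆ Set.uIcc (0 : ℝ) 1 := by
      rw [Set.uIcc_of_le hx.1, Set.uIcc_of_le zero_le_one]
      exact Set.Icc_subset_Icc_right hx.2
    have e := intervalIntegral.integral_add (μ := volume)
      ((intervalIntegrable_of_memLp hg.memLp).mono_set hsub)
      (((intervalIntegrable_of_memLp hh.memLp).mono_set hsub).smul t)
    simp only [Pi.smul_apply, intervalIntegral.integral_smul] at e
    rw [hg.eq_integral x hx, hh.eq_integral x hx, e, smul_add]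
    abel

lemma H2Curve.sub (hg : H2Curve g v κ) (hh : H2Curve h w ν) :
    H2Curve (fun x => g x - h x) (fun x => v x - w x) (fun x => κ x - ν x) := by
  simpa [sub_eq_add_neg] using hg.add_smul hh (-1)

lemma H2Curve.continuous (hg : H2Curve g v κ) : Continuous g :=
  continuous_iff_continuousAt.2 fun x => (hg.hasDerivAt x).continuousAt

lemma H2Curve.deriv_eq (hg : H2Curve g v κ) : deriv g = v :=
  funext fun x => (hg.hasDerivAt x).deriv

lemma exists_mem_Icc_of_periodic {f : ℝ → Euc n} (hf : Function.Periodic f 1) (x : ℝ) :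
    ∃ y ∈ Set.Icc (0 : ℝ) 1, f x = f y := by
  obtain ⟨y, hy, he⟩ := hf.exists_mem_Ico₀ one_pos x
  exact ⟨y, ⟨hy.1, hy.2.le⟩, he⟩

/-- The derivative of a closed curve has mean zero, so its oscillation, at most ∫|κ|, bounds it. -/
lemma H2Curve.norm_deriv_le (hg : H2Curve g v κ) (x : ℝ) : ‖v x‖ ≤ √(sqNorm κ) := by
  refine le_trans ?_ (integral_norm_le_sqrt hg.memLp)
  obtain ⟨z, hz, he⟩ := exists_mem_Icc_of_periodic hg.periodic_deriv x
  rw [he]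
  have hi := intervalIntegrable_of_memLp hg.memLp
  have hosc : ∀ y ∈ Set.Icc (0 : ℝ) (0 + 1), ‖v z - v y‖ ≤ ∫ u in (0 : ℝ)..1, ‖κ u‖ := by
    intro y hy
    rw [zero_add] at hy
    have hsub : ∀ {p}, p ∈ Set.Icc (0 : ℝ) 1 → Set.uIcc 0 p ⊆ Set.uIcc (0 : ℝ) 1 := fun hp => by
      rw [Set.uIcc_of_le hp.1, Set.uIcc_of_le zero_le_one]
      exact Set.Icc_subset_Icc_right hp.2
    rw [hg.eq_integral z hz, hg.eq_integral y hy, add_sub_add_left_eq_sub,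
      intervalIntegral.integral_interval_sub_left (hi.mono_set (hsub hz)) (hi.mono_set (hsub hy))]
    refine (intervalIntegral.norm_integral_le_integral_norm_uIoc).trans ?_
    rw [intervalIntegral.integral_of_le zero_le_one]
    refine setIntegral_mono_set hi.norm.1 (ae_of_all _ fun _ => norm_nonneg _)
      (LE.le.eventuallyLE ?_)
    exact Set.Ioc_subset_Ioc (le_min hy.1 hz.1) (max_le hy.2 hz.2)
  have h1 := norm_le_of_osc hg.continuous_deriv (w := fun _ => 1) continuous_const
    (fun _ => zero_le_one) (v z) hosc
  have h2 : ∫ u in (0 : ℝ)..1, v u = 0 := by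
    rw [intervalIntegral.integral_eq_sub_of_hasDerivAt (fun x _ => hg.hasDerivAt x)
      (hg.continuous_deriv.intervalIntegrable _ _)]
    have := hg.periodic 0
    rw [zero_add] at this
    rw [this, sub_self]
  simpa [h2] using h1

lemma H2Curve.norm_le (hg : H2Curve g v κ) (h0 : g 0 = 0) (x : ℝ) : ‖g x‖ ≤ √(sqNorm κ) := by
  obtain ⟨z, hz, he⟩ := exists_mem_Icc_of_periodic hg.periodic x
  have := convex_univ.norm_image_sub_le_of_norm_hasDerivWithin_le (f := g)
    (fun y _ => (hg.hasDerivAt y).hasDerivWithinAt) (fun y _ => hg.norm_deriv_le y)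
    (Set.mem_univ 0) (Set.mem_univ z)
  rw [h0, sub_zero, sub_zero, Real.norm_eq_abs, abs_of_nonneg hz.1] at this
  rw [he]
  exact this.trans (mul_le_of_le_one_right (Real.sqrt_nonneg _) hz.2)

/-- Lebesgue differentiation of the integral formula, which holds on [0, 1] only; hence the passage
to the open interval. -/
lemma H2Curve.ae_hasDerivAt (hg : H2Curve g v κ) :
    ∀ᵐ x ∂circleMeasure, HasDerivAt v (κ x) x := by
  rw [circleMeasure, ← restrict_Ioo_eq_restrict_Ioc]
  refine (ae_restrict_iff' measurableSet_Ioo).2 ?_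
  filter_upwards [(intervalIntegrable_of_memLp hg.memLp).ae_hasDerivAt_integral] with x hx hx01
  have h1 := hx (by rw [Set.uIcc_of_le zero_le_one]; exact Set.Ioo_subset_Icc_self hx01) 0 (by simp)
  refine (h1.const_add (v 0)).congr_of_eventuallyEq ?_
  filter_upwards [Icc_mem_nhds hx01.1 hx01.2] with y hy
  exact hg.eq_integral y hy

/-- From |D_s²h| ≤ |y|/|a|² + |b||x|/|a|³ and (p + q)² ≤ 2p² + 2q². The factor |a| from ds lowers
the powers of |a| to 3 and 5. -/
lemma norm_secondDs_sq_mul_le {a b x y : Euc n} {m X : ℝ} (hm : 0 < m) (ha : m ≤ ‖a‖)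
    (hx : ‖x‖ ^ 2 ≤ X) : ‖secondDs a b x y‖ ^ 2 * ‖a‖ ≤
      2 * (m ^ 3)⁻¹ * ‖y‖ ^ 2 + 2 * (m ^ 5)⁻¹ * X * ‖b‖ ^ 2 := by
  have hp : 0 < ‖a‖ := hm.trans_le ha
  have h1 : ‖secondDs a b x y‖ ≤ (‖a‖ ^ 2)⁻¹ * ‖y‖ + (‖a‖ ^ 3)⁻¹ * ‖b‖ * ‖x‖ := by
    refine (norm_sub_le _ _).trans (add_le_add ?_ ?_)
    · rw [norm_smul, norm_inv, norm_pow, norm_norm]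
    · rw [norm_smul, norm_mul, norm_inv, norm_pow, norm_norm]
      refine mul_le_mul_of_nonneg_right ?_ (norm_nonneg x)
      calc ‖inner ℝ a b‖ * (‖a‖ ^ 4)⁻¹ ≤ (‖a‖ * ‖b‖) * (‖a‖ ^ 4)⁻¹ := by
            gcongr; exact norm_inner_le_norm _ _
        _ = _ := by field_simp
  have hX : 0 ≤ X := (sq_nonneg _).trans hx
  calc ‖secondDs a b x y‖ ^ 2 * ‖a‖
      ≤ ((‖a‖ ^ 2)⁻¹ * ‖y‖ + (‖a‖ ^ 3)⁻¹ * ‖b‖ * ‖x‖) ^ 2 * ‖a‖ := by gcongr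
    _ ≤ (2 * ((‖a‖ ^ 2)⁻¹ * ‖y‖) ^ 2 + 2 * ((‖a‖ ^ 3)⁻¹ * ‖b‖ * ‖x‖) ^ 2) * ‖a‖ := by
        gcongr
        nlinarith [sq_nonneg ((‖a‖ ^ 2)⁻¹ * ‖y‖ - (‖a‖ ^ 3)⁻¹ * ‖b‖ * ‖x‖)]
    _ = 2 * (‖a‖ ^ 3)⁻¹ * ‖y‖ ^ 2 + 2 * (‖a‖ ^ 5)⁻¹ * ‖x‖ ^ 2 * ‖b‖ ^ 2 := by field_simp
    _ ≤ _ := by gcongr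

/-- The constant in the comparison of the metric with the `H²` norm on the circle. -/
def comparisonConst (lam m M B : ℝ) : ℝ := 1 + lam * M ^ 3 * (2 * (m ^ 3)⁻¹ + 2 * (m ^ 5)⁻¹ * B)

lemma comparisonConst_nonneg {lam m M B : ℝ} (hlam : 0 < lam) (hm : 0 < m) (hM : 0 ≤ M)
    (hB : 0 ≤ B) : 0 ≤ comparisonConst lam m M B := by
  unfold comparisonConst; positivity

/-- The norm of the metric is bounded by the `L²` norm of the second derivative. -/
lemma normH2_le_of_H2Curve {lam m M B : ℝ} (hlam : 0 < lam) (hm : 0 < m)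
    (hg : H2Curve g v κ) (hvm : ∀ x, m ≤ ‖v x‖) (hvM : ∀ x, ‖v x‖ ≤ M) (hB : sqNorm κ ≤ B)
    (hh : H2Curve h w ν) (h0 : h 0 = 0) :
    normH2 lam g h ≤ √(comparisonConst lam m M B * sqNorm ν) := by
  set Y := sqNorm ν with hY
  have hY0 : 0 ≤ Y := sqNorm_nonneg ν
  have hB0 : 0 ≤ B := (sqNorm_nonneg κ).trans hB
  have hv := hg.continuous_deriv.norm
  have hlen : len g = ∫ x in (0 : ℝ)..1, ‖v x‖ := by rw [len, hg.deriv_eq]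
  have hmM : m ≤ M := (hvm 0).trans (hvM 0)
  have hLm : m ≤ len g := by
    have := intervalIntegral.integral_mono_on (μ := volume) zero_le_one
      (intervalIntegrable_const (c := m)) (hv.intervalIntegrable 0 1) fun x _ => hvm x
    rw [hlen]; simpa using this
  have hLM : len g ≤ M := by
    have := intervalIntegral.integral_mono_on (μ := volume) zero_le_one
      (hv.intervalIntegrable 0 1) (intervalIntegrable_const (c := M)) fun x _ => hvM x
    rw [hlen]; simpa using this
  have hL : 0 < len g := hm.trans_le hLm
  have hhn : ∀ x, ‖h x‖ ^ 2 ≤ Y := fun x => by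
    rw [← Real.sq_sqrt hY0]; gcongr; exact hh.norm_le h0 x
  have hwn : ∀ x, ‖w x‖ ^ 2 ≤ Y := fun x => by
    rw [← Real.sq_sqrt hY0]; gcongr; exact hh.norm_deriv_le x
  have e1 : ∫ u in (0 : ℝ)..1, ‖h u‖ ^ 2 * ‖deriv g u‖ ≤ Y * len g := by
    rw [hg.deriv_eq, hlen, ← intervalIntegral.integral_const_mul]
    refine intervalIntegral.integral_mono_on zero_le_one
      (((hh.continuous.norm.pow 2).mul hv).intervalIntegrable _ _)
      ((hv.const_mul Y).intervalIntegrable _ _) fun x _ => ?_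
    exact mul_le_mul_of_nonneg_right (hhn x) (norm_nonneg _)
  have e2 : ∫ u in (0 : ℝ)..1, ‖Ds g (Ds g h) u‖ ^ 2 * ‖deriv g u‖ ≤
      (2 * (m ^ 3)⁻¹ + 2 * (m ^ 5)⁻¹ * B) * Y := by
    have i1 := (intervalIntegrable_sq_of_memLp hh.memLp).const_mul (2 * (m ^ 3)⁻¹)
    have i2 := (intervalIntegrable_sq_of_memLp hg.memLp).const_mul (2 * (m ^ 5)⁻¹ * Y)
    -- `Ds` is built on `deriv`, which is the L² second derivative only almost everywhere; the
    -- comparison is therefore an almost everywhere one.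
    have e3 : ∫ u in (0 : ℝ)..1, ‖Ds g (Ds g h) u‖ ^ 2 * ‖deriv g u‖ ≤
        ∫ u in (0 : ℝ)..1, (2 * (m ^ 3)⁻¹ * ‖ν u‖ ^ 2 + 2 * (m ^ 5)⁻¹ * Y * ‖κ u‖ ^ 2) := by
      rw [intervalIntegral.integral_of_le zero_le_one, intervalIntegral.integral_of_le zero_le_one]
      refine integral_mono_of_nonneg (ae_of_all _ fun u => by positivity) (i1.add i2).1 ?_
      filter_upwards [hg.ae_hasDerivAt, hh.ae_hasDerivAt] with u h1 h2
      rw [← hg.deriv_eq] at h1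
      rw [← hh.deriv_eq] at h2
      have hne : deriv g u ≠ 0 := by
        rw [hg.deriv_eq]; exact norm_pos_iff.1 (hm.trans_le (hvm u))
      rw [Ds_Ds h1 h2 hne]
      refine norm_secondDs_sq_mul_le hm ?_ ?_
      · rw [hg.deriv_eq]; exact hvm u
      · rw [hh.deriv_eq]; exact hwn u
    refine e3.trans ?_
    rw [intervalIntegral.integral_add i1 i2, intervalIntegral.integral_const_mul,
      intervalIntegral.integral_const_mul]
    change 2 * (m ^ 3)⁻¹ * Y + 2 * (m ^ 5)⁻¹ * Y * sqNorm κ ≤ _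
    have : 2 * (m ^ 5)⁻¹ * Y * sqNorm κ ≤ 2 * (m ^ 5)⁻¹ * Y * B := by gcongr
    linarith
  refine Real.sqrt_le_sqrt ?_
  have e : innerH2 lam g h h = (len g)⁻¹ * (∫ u in (0 : ℝ)..1, ‖h u‖ ^ 2 * ‖deriv g u‖) +
      lam * len g ^ 3 * ∫ u in (0 : ℝ)..1, ‖Ds g (Ds g h) u‖ ^ 2 * ‖deriv g u‖ := by
    simp only [innerH2, innerH0, real_inner_self_eq_norm_sq]
    field_simp
  have hD0 : 0 ≤ ∫ u in (0 : ℝ)..1, ‖Ds g (Ds g h) u‖ ^ 2 * ‖deriv g u‖ :=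
    intervalIntegral.integral_nonneg zero_le_one fun u _ => by positivity
  have hM0 : 0 ≤ M := hm.le.trans hmM
  rw [e]
  calc _ ≤ (len g)⁻¹ * (Y * len g) +
        lam * M ^ 3 * ((2 * (m ^ 3)⁻¹ + 2 * (m ^ 5)⁻¹ * B) * Y) := by gcongr
    _ = _ := by
      rw [comparisonConst]; field_simp

/-- The length of a linear homotopy. -/
lemma pathLength_affine_le {lam m M B : ℝ} (hlam : 0 < lam) (hm : 0 < m)
    (hg : H2Curve g v κ) (hh : H2Curve h w ν) (h0 : h 0 = 0)
    (hvm : ∀ t ∈ Set.Icc (0 : ℝ) 1, ∀ x, m ≤ ‖v x + t • w x‖)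
    (hvM : ∀ t ∈ Set.Icc (0 : ℝ) 1, ∀ x, ‖v x + t • w x‖ ≤ M)
    (hB : ∀ t ∈ Set.Icc (0 : ℝ) 1, sqNorm (fun x => κ x + t • ν x) ≤ B) :
    pathLength lam (fun t x => g x + t • h x) ≤
      ENNReal.ofReal √(comparisonConst lam m M B * sqNorm ν) := by
  have hvel : ∀ t, (fun u => deriv (fun τ : ℝ => g u + τ • h u) t) = h := fun t => by
    ext1 u
    have := ((hasDerivAt_id t).smul_const (h u)).const_add (g u)
    simpa using this.deriv
  rw [pathLength]
  calc _ ≤ ∫⁻ t in Set.Icc (0 : ℝ) 1,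
        ENNReal.ofReal √(comparisonConst lam m M B * sqNorm ν) := by
        refine setLIntegral_mono' measurableSet_Icc fun t ht => ENNReal.ofReal_le_ofReal ?_
        rw [hvel]
        exact normH2_le_of_H2Curve hlam hm (hg.add_smul hh t) (hvm t ht) (hvM t ht) (hB t ht) hh h0
    _ = _ := by simp

end H2Curves

/-! ### Density of smooth periodic functions, and distributional second derivatives -/

section Approximation

/-- Mollification of a uniformly continuous function. -/
lemma exists_mollifier {E : Type*} [NormedAddCommGroup E] [NormedSpace ℝ E] [CompleteSpace E]
    {f : ℝ → E} (hf : UniformContinuous f) {ε : ℝ} (hε : 0 < ε) :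
    ∃ ρ : ℝ → ℝ, (∀ t, 0 ≤ ρ t) ∧ Continuous ρ ∧ HasCompactSupport ρ ∧ ∫ t, ρ t = 1 ∧
      ContDiff ℝ ∞ (fun x => ∫ t, ρ t • f (x - t)) ∧
      ∀ x, dist (∫ t, ρ t • f (x - t)) (f x) ≤ ε := by
  obtain ⟨δ, hδ, hfδ⟩ := Metric.uniformContinuous_iff.1 hf ε hε
  set φ : ContDiffBump (0 : ℝ) := ⟨δ / 2, δ, half_pos hδ, half_lt_self hδ⟩ with hφ
  have e : (convolution (φ.normed volume) f (ContinuousLinearMap.lsmul ℝ ℝ) volume) =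
      fun x => ∫ t, φ.normed volume t • f (x - t) := by
    ext1 x; simp [convolution_def]
  refine ⟨φ.normed volume, fun t => φ.nonneg_normed t, φ.continuous_normed,
    φ.hasCompactSupport_normed, φ.integral_normed, ?_, fun x => ?_⟩
  · rw [← e]
    exact φ.hasCompactSupport_normed.contDiff_convolution_left _ φ.contDiff_normed
      hf.continuous.locallyIntegrable
  · have := φ.dist_normed_convolution_le (μ := volume) (g := f) (x₀ := x) (ε := ε)
      hf.continuous.aestronglyMeasurable fun y hy => (hfδ hy).le
    rwa [e] at this

lemma uniformContinuous_of_periodic {E : Type*} [NormedAddCommGroup E] {f : ℝ → E}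
    (hf : Continuous f) (hp : Function.Periodic f 1) : UniformContinuous f := by
  -- After an integer translation the first point lies in [0, 1), and a second point at distance
  -- less than 1 then lies in [−1, 2].
  have hI := isCompact_Icc (a := (-1 : ℝ)) (b := 2)
    |>.uniformContinuousOn_of_continuous hf.continuousOn
  rw [Metric.uniformContinuousOn_iff] at hI
  rw [Metric.uniformContinuous_iff]
  intro ε hε
  obtain ⟨δ, hδ, h⟩ := hI ε hε
  refine ⟨min δ 1, lt_min hδ one_pos, fun {x y} hxy => ?_⟩
  have e : ∀ z, f z = f (z - ⌊x⌋) := fun z => by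
    have := hp.sub_int_mul_eq (x := z) ⌊x⌋
    rw [mul_one] at this
    exact this.symm
  rw [e x, e y]
  have h1 := Int.floor_le x
  have h2 := Int.lt_floor_add_one x
  have h3 : |x - y| < 1 := hxy.trans_le (min_le_right _ _)
  rw [abs_lt] at h3
  refine h _ ⟨by linarith, by linarith⟩ _ ⟨by linarith, by linarith⟩ ?_
  rw [Real.dist_eq, sub_sub_sub_cancel_right]
  exact hxy.trans_le (min_le_left _ _)

/-- Smooth periodic functions are uniformly dense in the continuous periodic ones. -/
lemma exists_smooth_periodic_near {E : Type*} [NormedAddCommGroup E] [NormedSpace ℝ E]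
    [CompleteSpace E] {f : ℝ → E} (hf : Continuous f) (hp : Function.Periodic f 1) {ε : ℝ}
    (hε : 0 < ε) : ∃ q : ℝ → E, ContDiff ℝ ∞ q ∧ Function.Periodic q 1 ∧ ∀ x, ‖q x - f x‖ ≤ ε := by
  obtain ⟨ρ, -, -, -, -, h1, h2⟩ := exists_mollifier (uniformContinuous_of_periodic hf hp) hε
  refine ⟨_, h1, fun x => ?_, fun x => by rw [← dist_eq_norm]; exact h2 x⟩
  have : ∀ t, f (x + 1 - t) = f (x - t) := fun t => by
    rw [show x + 1 - t = x - t + 1 by ring, hp]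
  simp only [this]

lemma sqNorm_eq_eLpNorm {κ : ℝ → Euc n} (hκ : MemLp κ 2 circleMeasure) :
    sqNorm κ = (eLpNorm κ 2 circleMeasure).toReal ^ 2 := by
  have := inner_toLp_eq hκ hκ
  simp only [real_inner_self_eq_norm_sq, Lp.norm_toLp] at this
  exact this.symm

/-- Continuous periodic functions are dense in `L²`. -/
lemma exists_continuous_periodic_near {κ : ℝ → Euc n} (hκ : MemLp κ 2 circleMeasure) {ε : ℝ}
    (hε : 0 < ε) : ∃ f : ℝ → Euc n, Continuous f ∧ Function.Periodic f 1 ∧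
      sqNorm (fun x => κ x - f x) ≤ ε := by
  have hmk : MeasurePreserving ((↑) : ℝ → UnitAddCircle) circleMeasure volume := by
    have := UnitAddCircle.measurePreserving_mk 0
    rwa [zero_add] at this
  -- On the circle, a continuous approximant lifts to a periodic function, whereas one on (0, 1]
  -- need not match at the ends.
  set F : UnitAddCircle → Euc n := AddCircle.liftIoc 1 0 κ with hF
  have hFm : MemLp F 2 volume := by
    have h' : MemLp κ 2 (volume.restrict (Set.Ioc (0 : ℝ) (0 + 1))) := by rwa [zero_add]
    simp only [hF, AddCircle.liftIoc, Set.domRestrict_def, Function.comp_def]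
    apply h'.comp_measurePreserving
    exact (measurePreserving_subtype_coe measurableSet_Ioc).comp
      (AddCircle.measurePreserving_equivIoc 1)
  obtain ⟨G, hG, hGm⟩ := hFm.exists_boundedContinuous_eLpNorm_sub_le (by simp)
    (ε := ENNReal.ofReal √ε) (by simpa using hε)
  refine ⟨fun x => G x, G.continuous.comp (AddCircle.continuous_mk' 1), fun x => ?_, ?_⟩
  · simp only [AddCircle.coe_add_period]
  · have hm : MemLp (fun x : ℝ => G x) 2 circleMeasure := hGm.comp_measurePreserving hmk
    have hsub : MemLp (fun x => κ x - G x) 2 circleMeasure := hκ.sub hm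
    rw [sqNorm_eq_eLpNorm hsub, ← Real.sq_sqrt hε.le]
    gcongr
    have e1 : eLpNorm (fun x => κ x - G x) 2 circleMeasure =
        eLpNorm ((F - ⇑G) ∘ ((↑) : ℝ → UnitAddCircle)) 2 circleMeasure := by
      refine eLpNorm_congr_ae ((ae_restrict_iff' measurableSet_Ioc).2 (ae_of_all _ fun x hx => ?_))
      simp only [Function.comp_apply, Pi.sub_apply, hF]
      rw [AddCircle.liftIoc_coe_apply (by rwa [zero_add])]
    rw [e1, eLpNorm_comp_measurePreserving (hFm.sub hGm).1 hmk]
    exact ENNReal.toReal_le_of_le_ofReal (Real.sqrt_nonneg _) hG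

/-- Smooth periodic functions of mean zero are dense in the `L²` functions of mean zero. -/
lemma exists_smooth_meanZero_near {κ : ℝ → Euc n} (hκ : MemLp κ 2 circleMeasure)
    (h0 : ∫ x in (0 : ℝ)..1, κ x = 0) {ε : ℝ} (hε : 0 < ε) :
    ∃ q : ℝ → Euc n, ContDiff ℝ ∞ q ∧ Function.Periodic q 1 ∧ ∫ x in (0 : ℝ)..1, q x = 0 ∧
      sqNorm (fun x => κ x - q x) ≤ ε := by
  -- Each `sqNorm_add_le` doubles the errors: two errors ε/16 give ε/4 for κ − p. The mean m of p
  -- has |m|² ≤ ε/4 because κ has mean zero, and subtracting it gives 2(ε/4 + ε/4) = ε.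
  obtain ⟨f, hf, hfp, hfε⟩ := exists_continuous_periodic_near hκ (show 0 < ε / 16 by positivity)
  obtain ⟨p, hp, hpp, hpf⟩ := exists_smooth_periodic_near hf hfp
    (show 0 < √(ε / 16) by positivity)
  have hfm := memLp_circle_of_continuous hf
  have hpm := memLp_circle_of_continuous hp.continuous
  have h1 : sqNorm (fun x => f x - p x) ≤ ε / 16 := by
    have := intervalIntegral.integral_mono_on (μ := volume) zero_le_one
      (intervalIntegrable_sq_of_memLp (hfm.sub hpm)) (intervalIntegrable_const (c := ε / 16))
      fun x _ => ?_
    · simpa [sqNorm] using this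
    · rw [← Real.sq_sqrt (show 0 ≤ ε / 16 by positivity), Pi.sub_apply, norm_sub_rev]
      gcongr
      exact hpf x
  have hκp : MemLp (fun x => κ x - p x) 2 circleMeasure := hκ.sub hpm
  have h2 : sqNorm (fun x => κ x - p x) ≤ ε / 4 := by
    have := sqNorm_add_le (hκ.sub hfm) (hfm.sub hpm)
    simp only [Pi.sub_apply, sub_add_sub_cancel] at this
    have hfε' : sqNorm (κ - f) ≤ ε / 16 := hfε
    have h1' : sqNorm (f - p) ≤ ε / 16 := h1
    linarith
  set m := ∫ x in (0 : ℝ)..1, p x with hm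
  have hmn : ‖m‖ ^ 2 ≤ ε / 4 := by
    have e : m = -∫ x in (0 : ℝ)..1, (κ x - p x) := by
      rw [intervalIntegral.integral_sub (intervalIntegrable_of_memLp hκ)
        (intervalIntegrable_of_memLp hpm), h0, zero_sub, neg_neg]
    have h3 : ‖m‖ ≤ √(sqNorm fun x => κ x - p x) := by
      rw [e, norm_neg]
      exact (intervalIntegral.norm_integral_le_integral_norm zero_le_one).trans
        (integral_norm_le_sqrt hκp)
    refine le_trans ?_ h2
    rw [← Real.sq_sqrt (sqNorm_nonneg fun x => κ x - p x)]
    gcongr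
  refine ⟨fun x => p x - m, hp.sub contDiff_const, fun x => by simp only [hpp x], ?_, ?_⟩
  · rw [intervalIntegral.integral_sub (intervalIntegrable_of_memLp hpm) (by simp), ← hm]
    simp
  · have := sqNorm_add_le hκp (memLp_circle_of_continuous (continuous_const (y := m)))
    have e : sqNorm (fun _ => m) = ‖m‖ ^ 2 := by simp [sqNorm]
    rw [e] at this
    have e2 : (fun x => κ x - (p x - m)) = fun x => κ x - p x + m := by
      ext1 x; abel
    rw [e2]
    linarith

/-- Periodic primitives of smooth periodic functions of mean zero. -/
lemma exists_periodic_primitive {E : Type*} [NormedAddCommGroup E] [NormedSpace ℝ E]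
    [CompleteSpace E] {q : ℝ → E} (hq : ContDiff ℝ ∞ q) (hp : Function.Periodic q 1)
    (h0 : ∫ x in (0 : ℝ)..1, q x = 0) (y : E) :
    ∃ V : ℝ → E, ContDiff ℝ ∞ V ∧ Function.Periodic V 1 ∧ deriv V = q ∧ V 0 = y := by
  have hi : ∀ a b, IntervalIntegrable q volume a b := hq.continuous.intervalIntegrable
  have hd : ∀ x, HasDerivAt (fun x => y + ∫ u in (0 : ℝ)..x, q u) (q x) x := fun x =>
    (intervalIntegral.integral_hasDerivAt_right (hi 0 x)
      (hq.continuous.stronglyMeasurableAtFilter _ _) hq.continuous.continuousAt).const_add y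
  have hde := funext fun x => (hd x).deriv
  refine ⟨fun x => y + ∫ u in (0 : ℝ)..x, q u, ?_, fun x => ?_, hde, by simp⟩
  · rw [contDiff_infty_iff_deriv]
    exact ⟨fun x => (hd x).differentiableAt, by rwa [hde]⟩
  · have := hp.intervalIntegral_add_eq x 0
    rw [zero_add, h0] at this
    simp only [← intervalIntegral.integral_add_adjacent_intervals (hi 0 x) (hi x (x + 1)), this,
      add_zero]

/-- The first primitive is corrected by its mean, which makes the second one periodic and does not
affect the second derivative. -/
lemma exists_periodic_double_primitive {E : Type*} [NormedAddCommGroup E] [NormedSpace ℝ E]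
    [CompleteSpace E] {q : ℝ → E} (hq : ContDiff ℝ ∞ q) (hp : Function.Periodic q 1)
    (h0 : ∫ x in (0 : ℝ)..1, q x = 0) (y : E) :
    ∃ G : ℝ → E, ContDiff ℝ ∞ G ∧ Function.Periodic G 1 ∧ deriv (deriv G) = q ∧ G 0 = y := by
  obtain ⟨V, hV, hVp, hVd, -⟩ := exists_periodic_primitive hq hp h0 0
  set m := ∫ x in (0 : ℝ)..1, V x with hm
  obtain ⟨G, hG, hGp, hGd, hG0⟩ := exists_periodic_primitive (q := fun x => V x - m)
    (hV.sub contDiff_const) (fun x => by simp only [hVp x]) (by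
      rw [intervalIntegral.integral_sub (hV.continuous.intervalIntegrable _ _) (by simp), ← hm]
      simp) y
  refine ⟨G, hG, hGp, ?_, hG0⟩
  rw [hGd, ← hVd]
  ext1 x
  exact deriv_sub_const m

lemma H2Curve.of_smooth {G : ℝ → Euc n} (hG : ContDiff ℝ ∞ G) (hp : Function.Periodic G 1) :
    H2Curve G (deriv G) (deriv (deriv G)) where
  periodic := hp
  periodic_deriv := SobolevCurves.periodic_deriv hp
  hasDerivAt x := hasDerivAt_deriv hG x
  continuous_deriv := (contDiff_deriv hG).continuous
  memLp := memLp_circle_of_continuous (contDiff_deriv (contDiff_deriv hG)).continuous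
  eq_integral x _ := by
    rw [intervalIntegral.integral_eq_sub_of_hasDerivAt
      (fun u _ => hasDerivAt_deriv (contDiff_deriv hG) u)
      ((contDiff_deriv (contDiff_deriv hG)).continuous.intervalIntegrable _ _)]
    abel

/-- A continuous periodic function whose second distributional derivative vanishes is constant. -/
lemma eq_const_of_integral_deriv_deriv_eq_zero {f : ℝ → Euc n} (hf : Continuous f)
    (hp : Function.Periodic f 1) (h : ∀ η : ℝ → ℝ, ContDiff ℝ ∞ η → Function.Periodic η 1 →
      ∫ x in (0 : ℝ)..1, deriv (deriv η) x • f x = 0) (x : ℝ) :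
    f x = ∫ x in (0 : ℝ)..1, f x := by
  set m := ∫ x in (0 : ℝ)..1, f x with hm
  set F : ℝ → Euc n := fun x => f x - m with hF
  have hFc : Continuous F := hf.sub continuous_const
  have hFm := memLp_circle_of_continuous hFc
  have hF0 : ∫ x in (0 : ℝ)..1, F x = 0 := by
    rw [hF, intervalIntegral.integral_sub (hf.intervalIntegrable _ _) (by simp), ← hm]
    simp
  -- Each coordinate of a smooth periodic q of mean zero is η'' for a periodic η, so the hypothesis
  -- makes F orthogonal to every such q.
  have horth : ∀ q : ℝ → Euc n, ContDiff ℝ ∞ q → Function.Periodic q 1 →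
      ∫ x in (0 : ℝ)..1, q x = 0 → ∫ x in (0 : ℝ)..1, inner ℝ (q x) (F x) = 0 := by
    intro q hq hqp hq0
    have hcoord : ∀ i, ContDiff ℝ ∞ fun x => q x i := fun i =>
      (EuclideanSpace.proj (𝕜 := ℝ) i).contDiff.comp hq
    have hFi : ∀ i, Continuous fun x => F x i := fun i =>
      (EuclideanSpace.proj (𝕜 := ℝ) i).continuous.comp hFc
    have hcoord0 : ∀ i, ∫ x in (0 : ℝ)..1, q x i = 0 := fun i => by
      have := (EuclideanSpace.proj (𝕜 := ℝ) i).intervalIntegral_comp_comm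
        (hq.continuous.intervalIntegrable (μ := volume) 0 1)
      rw [hq0, map_zero] at this
      exact this
    have hz : ∀ i, ∫ x in (0 : ℝ)..1, q x i * F x i = 0 := fun i => by
      obtain ⟨η, hη, hηp, hηd, -⟩ := exists_periodic_double_primitive (hcoord i)
        (fun x => by simp only [hqp x]) (hcoord0 i) 0
      have h1 := h η hη hηp
      rw [hηd] at h1
      have h2 : ∫ x in (0 : ℝ)..1, q x i • F x = 0 := by
        simp only [hF, smul_sub]
        have hqc := (hcoord i).continuous
        rw [intervalIntegral.integral_sub (Continuous.intervalIntegrable (by fun_prop) _ _)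
          (Continuous.intervalIntegrable (by fun_prop) _ _), h1,
          intervalIntegral.integral_smul_const, hcoord0, zero_smul, sub_zero]
      have h3 := (EuclideanSpace.proj (𝕜 := ℝ) i).intervalIntegral_comp_comm
        (((hcoord i).continuous.smul hFc).intervalIntegrable (μ := volume) 0 1)
      have h4 : ∫ x in (0 : ℝ)..1, ((fun x => q x i) • F) x = 0 := h2
      rw [h4, map_zero] at h3
      exact h3
    have e : ∀ x, inner ℝ (q x) (F x) = ∑ i, q x i * F x i := fun x => by
      simp [PiLp.inner_apply, mul_comm]
    simp only [e]
    have hi : ∀ i, Continuous fun x => q x i * F x i := fun i =>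
      (hcoord i).continuous.mul (hFi i)
    rw [intervalIntegral.integral_finsetSum fun i _ => (hi i).intervalIntegrable _ _]
    exact Finset.sum_eq_zero fun i _ => hz i
  -- F has mean zero, hence is an L² limit of such q. By orthogonality ‖F − q‖² = ‖F‖² + ‖q‖², so F
  -- vanishes.
  have hsq : sqNorm F ≤ 0 := by
    refine le_of_forall_pos_le_add fun ε hε => ?_
    rw [zero_add]
    obtain ⟨q, hq, hqp, hq0, hqε⟩ := exists_smooth_meanZero_near hFm hF0 hε
    refine le_trans ?_ hqε
    have hi : ∀ {f : ℝ → ℝ}, Continuous f → IntervalIntegrable f volume 0 1 :=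
      fun hf => hf.intervalIntegrable _ _
    have hqc := hq.continuous
    have e : sqNorm (fun x => F x - q x) = sqNorm F + sqNorm q := by
      have h1 : ∀ x, ‖F x - q x‖ ^ 2 = ‖F x‖ ^ 2 + ‖q x‖ ^ 2 - 2 * inner ℝ (q x) (F x) :=
        fun x => by rw [norm_sub_sq_real, real_inner_comm]; ring
      simp only [sqNorm, h1]
      rw [intervalIntegral.integral_sub (hi (by fun_prop)) (hi (by fun_prop)),
        intervalIntegral.integral_add (hi (by fun_prop)) (hi (by fun_prop)),
        intervalIntegral.integral_const_mul, horth q hq hqp hq0, mul_zero, sub_zero]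
    rw [e]
    linarith [sqNorm_nonneg q]
  have hzero : ∀ y ∈ Set.Icc (0 : ℝ) 1, ‖F y‖ ^ 2 = 0 := by
    intro y hy
    by_contra hne
    have hpos : 0 < sqNorm F := intervalIntegral.integral_pos zero_lt_one
      (hFc.norm.pow 2).continuousOn (fun _ _ => by positivity)
      ⟨y, hy, lt_of_le_of_ne (by positivity) (Ne.symm hne)⟩
    linarith
  obtain ⟨y, hy, he⟩ := exists_mem_Icc_of_periodic hp x
  have := hzero y hy
  rw [he, ← sub_eq_zero]
  simpa [hF] using this

end Approximation

/-! ### Smoothing of monotone maps and H² regularity of weak solutions -/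

section SmoothApproximation

/-- Convolution with a nonnegative kernel of mass 1 keeps monotonicity and degree. A convex
combination with the identity then makes the derivative at least θ > 0. -/
lemma exists_diffeo_near_of_monotone {σ : ℝ → ℝ} (hc : Continuous σ) (hm : Monotone σ)
    (hd : ∀ x, σ (x + 1) = σ x + 1) {ε : ℝ} (hε : 0 < ε) :
    ∃ φ : ℝ → ℝ, IsCircleDiffeo φ ∧ ∀ x, |φ x - σ x| ≤ ε := by
  have hper : Function.Periodic (fun x => x - σ x) 1 := fun x => by simp only [hd x]; ring
  have hpc : Continuous fun x => x - σ x := continuous_id.sub hc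
  have huc : UniformContinuous σ := by
    have := uniformContinuous_id.sub (uniformContinuous_of_periodic hpc hper)
    simpa using this
  obtain ⟨D, hD⟩ : ∃ D, ∀ x, |x - σ x| ≤ D := by
    obtain ⟨D, hD⟩ := (isCompact_Icc (a := (0 : ℝ)) (b := 1)).exists_bound_of_continuousOn
      hpc.continuousOn
    refine ⟨D, fun x => ?_⟩
    obtain ⟨y, hy, he⟩ := hper.exists_mem_Ico₀ one_pos x
    rw [he]
    exact hD y ⟨hy.1, hy.2.le⟩
  have hD0 : 0 ≤ D := (abs_nonneg _).trans (hD 0)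
  obtain ⟨ρ, hρ0, hρc, hρs, hρ1, hsm, hnear⟩ := exists_mollifier huc (half_pos hε)
  have hint : ∀ x, Integrable fun t => ρ t • σ (x - t) := fun x =>
    (Continuous.smul hρc (hc.comp (continuous_const.sub continuous_id))).integrable_of_hasCompactSupport
      hρs.smul_right
  set f : ℝ → ℝ := fun x => ∫ t, ρ t • σ (x - t) with hf
  have hfm : Monotone f := fun x y hxy => integral_mono (hint x) (hint y) fun t =>
    mul_le_mul_of_nonneg_left (hm (by linarith)) (hρ0 t)
  have hfd : ∀ x, f (x + 1) = f x + 1 := fun x => by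
    have e : ∀ t, ρ t • σ (x + 1 - t) = ρ t • σ (x - t) + ρ t := fun t => by
      rw [show x + 1 - t = x - t + 1 by ring, hd, smul_add, smul_eq_mul _ (1 : ℝ), mul_one]
    simp only [hf, e]
    rw [integral_add (hint x) (hρc.integrable_of_hasCompactSupport hρs), hρ1]
  -- The identity is at distance at most D from σ, so its share costs θ D ≤ ε/2; D + 1 avoids a zero
  -- denominator.
  set θ : ℝ := min (1 / 2) (ε / (2 * (D + 1))) with hθ
  have hθ0 : 0 < θ := lt_min (by norm_num) (by positivity)
  have hθ1 : θ ≤ 1 / 2 := min_le_left _ _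
  have hθD : θ * D ≤ ε / 2 := by
    calc θ * D ≤ ε / (2 * (D + 1)) * (D + 1) := by
          gcongr
          · exact min_le_right _ _
          · linarith
      _ = ε / 2 := by field_simp
  have hfsm : ContDiff ℝ ∞ f := hsm
  have hfder : ∀ x, HasDerivAt (fun x => (1 - θ) * f x + θ * x) ((1 - θ) * deriv f x + θ) x :=
    fun x => HasDerivAt.congr_deriv (((hasDerivAt_deriv hfsm x).const_mul (1 - θ)).add
      ((hasDerivAt_id x).const_mul θ)) (by simp)
  refine ⟨fun x => (1 - θ) * f x + θ * x, ⟨?_, fun x => ?_, Or.inl fun x => ?_⟩, fun x => ?_⟩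
  · exact (contDiff_const.mul hfsm).add (contDiff_const.mul contDiff_id)
  · rw [(hfder x).deriv]
    have h1 : 0 ≤ deriv f x := hfm.deriv_nonneg
    have h2 : 0 ≤ (1 - θ) * deriv f x := mul_nonneg (by linarith) h1
    linarith
  · simp only [hfd x]; ring
  · have h1 := hnear x
    rw [Real.dist_eq] at h1
    have e : (1 - θ) * f x + θ * x - σ x = (1 - θ) * (f x - σ x) + θ * (x - σ x) := by ring
    rw [e]
    refine (abs_add_le _ _).trans ?_
    rw [abs_mul, abs_mul, abs_of_pos hθ0, abs_of_nonneg (by linarith : 0 ≤ 1 - θ)]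
    have h2 : (1 - θ) * |f x - σ x| ≤ 1 * (ε / 2) :=
      mul_le_mul (by linarith) h1 (abs_nonneg _) zero_le_one
    have h3 : θ * |x - σ x| ≤ θ * D := by gcongr; exact hD x
    linarith

/-- Monotone reparametrizations are uniform limits of diffeomorphisms. -/
lemma IsReparam.exists_diffeo_near {σ : ℝ → ℝ} (hσ : IsReparam σ) {ε : ℝ} (hε : 0 < ε) :
    ∃ φ : ℝ → ℝ, IsCircleDiffeo φ ∧ ∀ x, |φ x - σ x| ≤ ε := by
  rcases hσ.degree with ⟨hm, hd⟩ | ⟨hm, hd⟩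
  · exact exists_diffeo_near_of_monotone hσ.continuous hm hd hε
  · obtain ⟨φ, hφ, h⟩ := exists_diffeo_near_of_monotone (σ := fun x => -σ x) hσ.continuous.neg
      (fun x y hxy => neg_le_neg (hm hxy)) (fun x => by simp only [hd x]; ring) hε
    refine ⟨fun x => -φ x, ⟨hφ.smooth.neg, fun x => ?_, ?_⟩, fun x => ?_⟩
    · rw [deriv.fun_neg]
      exact neg_ne_zero.2 (hφ.deriv_ne_zero x)
    · rcases hφ.degree with h | h
      · exact Or.inr fun x => by rw [h x]; ring
      · exact Or.inl fun x => by rw [h x]; ring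
    · rw [← abs_neg]
      have := h x
      rwa [sub_neg_eq_add, show φ x + σ x = -(-φ x - σ x) by ring] at this

variable {g v κ : ℝ → Euc n}

lemma H2Curve.integral_eq_zero (hg : H2Curve g v κ) : ∫ x in (0 : ℝ)..1, κ x = 0 := by
  have h1 := hg.eq_integral 1 (by simp)
  have h2 := hg.periodic_deriv 0
  rw [zero_add] at h2
  rw [h2] at h1
  simpa using h1

/-- The second derivative is approximated in L² and integrated twice. Prescribing the value y at 0
lets differences of such curves vanish at 0, as `H2Curve.norm_le` needs. -/
lemma exists_smooth_H2Curve_near (hκ : MemLp κ 2 circleMeasure)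
    (h0 : ∫ x in (0 : ℝ)..1, κ x = 0) (y : Euc n) {δ : ℝ} (hδ : 0 < δ) :
    ∃ G q : ℝ → Euc n, ContDiff ℝ ∞ G ∧ Continuous q ∧ H2Curve G (deriv G) q ∧ G 0 = y ∧
      sqNorm (fun x => κ x - q x) ≤ δ := by
  obtain ⟨q, hq, hqp, hq0, hqδ⟩ := exists_smooth_meanZero_near hκ h0 hδ
  obtain ⟨G, hG, hGp, hGd, hG0⟩ := exists_periodic_double_primitive hq hqp hq0 y
  refine ⟨G, q, hG, hq.continuous, ?_, hG0, hqδ⟩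
  have := H2Curve.of_smooth hG hGp
  rwa [hGd] at this

lemma norm_integral_sub_le_sqrt {κ q : ℝ → Euc n} (hκ : MemLp κ 2 circleMeasure)
    (hq : MemLp q 2 circleMeasure) {x : ℝ} (hx : x ∈ Set.Icc (0 : ℝ) 1) :
    ‖(∫ u in (0 : ℝ)..x, q u) - ∫ u in (0 : ℝ)..x, κ u‖ ≤
      √(sqNorm fun u => κ u - q u) := by
  have hsub : Set.uIcc 0 x ⊆ Set.uIcc (0 : ℝ) 1 := by
    rw [Set.uIcc_of_le hx.1, Set.uIcc_of_le zero_le_one]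
    exact Set.Icc_subset_Icc_right hx.2
  have hi : IntervalIntegrable (fun u => κ u - q u) volume 0 1 :=
    intervalIntegrable_of_memLp (hκ.sub hq)
  rw [norm_sub_rev, ← intervalIntegral.integral_sub
    ((intervalIntegrable_of_memLp hκ).mono_set hsub)
    ((intervalIntegrable_of_memLp hq).mono_set hsub)]
  refine (intervalIntegral.norm_integral_le_integral_norm hx.1).trans
    (le_trans ?_ (integral_norm_le_sqrt (hκ.sub hq)))
  exact intervalIntegral.integral_mono_interval le_rfl hx.1 hx.2
    (ae_of_all _ fun _ => norm_nonneg _) hi.norm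

lemma uniformCauchy_of_norm_sub_le {G : ℕ → ℝ → Euc n} {ε : ℕ → ℝ} (hε : Tendsto ε atTop (𝓝 0))
    (h : ∀ k l x, ‖G k x - G l x‖ ≤ √(2 * ε k + 2 * ε l)) :
    ∃ G' : ℝ → Euc n, TendstoUniformly G G' atTop := by
  have huc : UniformCauchySeqOn G atTop Set.univ := by
    rw [Metric.uniformCauchySeqOn_iff]
    intro r hr
    obtain ⟨N, hN⟩ := eventually_atTop.1 (hε.eventually (gt_mem_nhds
      (show 0 < r ^ 2 / 4 by positivity)))
    refine ⟨N, fun k hk l hl x _ => ?_⟩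
    rw [dist_eq_norm]
    refine (h k l x).trans_lt ?_
    rw [Real.sqrt_lt' hr]
    linarith [hN k hk, hN l hl]
  choose G' hG' using fun x => cauchySeq_tendsto_of_complete
    (huc.cauchySeq (x := x) (Set.mem_univ x))
  exact ⟨G', tendstoUniformlyOn_univ.1 (huc.tendstoUniformlyOn_of_tendsto fun x _ => hG' x)⟩

/-- A closed curve with square integrable weak second derivative is of class `H²`. -/
lemma exists_H2Curve_of_weak (hg : Continuous g) (hp : Function.Periodic g 1)
    (hκ : MemLp κ 2 circleMeasure)
    (hw : ∀ η : ℝ → ℝ, ContDiff ℝ ∞ η → Function.Periodic η 1 →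
      ∫ x in (0 : ℝ)..1, deriv (deriv η) x • g x = ∫ x in (0 : ℝ)..1, η x • κ x) :
    ∃ v, H2Curve g v κ := by
  -- The test function 1.
  have h0 : ∫ x in (0 : ℝ)..1, κ x = 0 := by
    have := hw (fun _ => 1) contDiff_const fun _ => rfl
    simpa using this.symm
  set ε : ℕ → ℝ := fun k => 1 / ((k : ℝ) + 1) with hε_def
  have hε : ∀ k, 0 < ε k := fun k => by positivity
  have hεlim : Tendsto ε atTop (𝓝 0) := tendsto_one_div_add_atTop_nhds_zero_nat
  -- The smooth curves G k have second derivatives tending to κ in L². The bounds by `sqNorm` make G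
  -- k and their derivatives uniformly Cauchy, and the limit is an H² curve with second derivative
  -- κ.
  choose G q hG hqc hGq hG0 hq using fun k => exists_smooth_H2Curve_near hκ h0 0 (hε k)
  have hqq : ∀ k l, sqNorm (fun x => q k x - q l x) ≤ 2 * ε k + 2 * ε l := fun k l => by
    have h1 : MemLp (fun x => κ x - q l x) 2 circleMeasure := hκ.sub (hGq l).memLp
    have h2 : MemLp (fun x => (-1 : ℝ) • (κ x - q k x)) 2 circleMeasure :=
      (hκ.sub (hGq k).memLp).const_smul (-1 : ℝ)
    have h3 := sqNorm_add_le h1 h2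
    rw [sqNorm_smul] at h3
    have e : (fun x => κ x - q l x + (-1 : ℝ) • (κ x - q k x)) = fun x => q k x - q l x := by
      ext1 x; rw [neg_one_smul]; abel
    rw [e] at h3
    linarith [hq k, hq l]
  have hdiff := fun k l => (hGq k).sub (hGq l)
  obtain ⟨V, hV⟩ := uniformCauchy_of_norm_sub_le (G := fun k => deriv (G k)) hεlim fun k l x =>
    ((hdiff k l).norm_deriv_le x).trans (Real.sqrt_le_sqrt (hqq k l))
  obtain ⟨G', hG'⟩ := uniformCauchy_of_norm_sub_le hεlim fun k l x =>
    ((hdiff k l).norm_le (by simp [hG0]) x).trans (Real.sqrt_le_sqrt (hqq k l))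
  have hVx := fun x => hV.tendsto_at x
  have hGx := fun x => hG'.tendsto_at x
  have hsqrt : Tendsto (fun k => √(ε k)) atTop (𝓝 0) := by
    have := (Real.continuous_sqrt.tendsto 0).comp hεlim
    rwa [Real.sqrt_zero] at this
  have hlimit : H2Curve G' V κ := by
    refine ⟨fun x => ?_, fun x => ?_, fun x => ?_, ?_, hκ, fun x hx => ?_⟩
    · refine tendsto_nhds_unique (hGx (x + 1)) ?_
      simp only [fun k => (hGq k).periodic x]
      exact hGx x
    · refine tendsto_nhds_unique (hVx (x + 1)) ?_
      simp only [fun k => (hGq k).periodic_deriv x]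
      exact hVx x
    · exact hasDerivAt_of_tendstoUniformly hV
        (Eventually.of_forall fun k x => (hGq k).hasDerivAt x) hGx x
    · exact hV.continuous (Eventually.of_forall fun k => (hGq k).continuous_deriv).frequently
    · refine tendsto_nhds_unique (hVx x) ?_
      simp only [fun k => (hGq k).eq_integral x hx]
      refine (hVx 0).add (tendsto_iff_norm_sub_tendsto_zero.2 ?_)
      refine squeeze_zero (fun _ => norm_nonneg _) (fun k => ?_) hsqrt
      exact (norm_integral_sub_le_sqrt hκ (hGq k).memLp hx).trans (Real.sqrt_le_sqrt (hq k))
  have hweak : ∀ η : ℝ → ℝ, ContDiff ℝ ∞ η → Function.Periodic η 1 →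
      ∫ x in (0 : ℝ)..1, deriv (deriv η) x • G' x = ∫ x in (0 : ℝ)..1, η x • κ x := by
    intro η hη hηp
    have hη2 := (contDiff_deriv (contDiff_deriv hη)).continuous
    have hGk : ∀ k, ∫ x in (0 : ℝ)..1, deriv (deriv η) x • G k x =
        ∫ x in (0 : ℝ)..1, η x • q k x := fun k => by
      have hV' : ∀ x, HasDerivAt (deriv (G k)) (deriv (deriv (G k)) x) x :=
        fun x => hasDerivAt_deriv (contDiff_deriv (hG k)) x
      rw [integral_deriv_deriv_smul (hGq k).hasDerivAt hV'
        (contDiff_deriv (contDiff_deriv (hG k))).continuous (hGq k).periodic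
        (hGq k).periodic_deriv hη hηp, intervalIntegral.integral_of_le zero_le_one,
        intervalIntegral.integral_of_le zero_le_one]
      refine integral_congr_ae ?_
      filter_upwards [(hGq k).ae_hasDerivAt] with x hx
      rw [hx.deriv]
    obtain ⟨A, hA⟩ := (isCompact_Icc (a := (0 : ℝ)) (b := 1)).exists_bound_of_continuousOn
      hη.continuous.continuousOn
    have hint : ∀ f : ℝ → Euc n, MemLp f 2 circleMeasure →
        IntervalIntegrable (fun x => η x • f x) volume 0 1 := fun f hf =>
      (intervalIntegrable_of_memLp hf).continuousOn_smul hη.continuous.continuousOn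
    have t1 : Tendsto (fun k => ∫ x in (0 : ℝ)..1, η x • q k x) atTop
        (𝓝 (∫ x in (0 : ℝ)..1, η x • κ x)) := by
      rw [tendsto_iff_norm_sub_tendsto_zero]
      have t3 := hsqrt.const_mul A
      rw [mul_zero] at t3
      refine squeeze_zero (fun _ => norm_nonneg _) (fun k => ?_) t3
      have hm : MemLp (fun x => κ x - q k x) 2 circleMeasure := hκ.sub (hGq k).memLp
      rw [norm_sub_rev, ← intervalIntegral.integral_sub (hint κ hκ) (hint (q k) (hGq k).memLp)]
      calc _ ≤ ∫ x in (0 : ℝ)..1, A * ‖κ x - q k x‖ := by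
            refine intervalIntegral.norm_integral_le_of_norm_le zero_le_one
              (ae_of_all _ fun x hx => ?_) ((intervalIntegrable_of_memLp hm).norm.const_mul A)
            rw [← smul_sub, norm_smul]
            exact mul_le_mul_of_nonneg_right (hA x (Set.Ioc_subset_Icc_self hx)) (norm_nonneg _)
        _ = A * ∫ x in (0 : ℝ)..1, ‖κ x - q k x‖ := intervalIntegral.integral_const_mul _ _
        _ ≤ A * √(ε k) := by
            refine mul_le_mul_of_nonneg_left ((integral_norm_le_sqrt hm).trans
              (Real.sqrt_le_sqrt (hq k))) ((norm_nonneg _).trans (hA 0 (by simp)))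
    have t2 : Tendsto (fun k => ∫ x in (0 : ℝ)..1, deriv (deriv η) x • G k x) atTop
        (𝓝 (∫ x in (0 : ℝ)..1, deriv (deriv η) x • G' x)) := by
      rw [Metric.tendsto_nhds]
      intro r hr
      set I := ∫ x in (0 : ℝ)..1, |deriv (deriv η) x| with hI
      have hI0 : 0 ≤ I := intervalIntegral.integral_nonneg zero_le_one fun x _ => abs_nonneg _
      filter_upwards [Metric.tendstoUniformly_iff.1 hG' (r / (I + 1)) (by positivity)] with k hk
      rw [dist_eq_norm]
      refine (norm_integral_sub_le_of_norm_le (hG k).continuous hlimit.continuous hη2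
        (ε := r / (I + 1)) fun x _ => ?_).trans_lt ?_
      · rw [← dist_eq_norm, dist_comm]; exact (hk x).le
      · rw [← hI, div_mul_eq_mul_div, div_lt_iff₀ (by positivity)]
        nlinarith
    simp only [hGk] at t2
    exact tendsto_nhds_unique t2 t1
  -- g and the constructed curve have the same weak second derivative, so they differ by a constant
  -- and g inherits the regularity.
  have hconst := eq_const_of_integral_deriv_deriv_eq_zero (f := fun x => g x - G' x)
    (hg.sub hlimit.continuous) (fun x => by simp only [hp x, hlimit.periodic x])
    fun η hη hηp => by
      have hη2 := (contDiff_deriv (contDiff_deriv hη)).continuous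
      have hG'c := hlimit.continuous
      simp only [smul_sub]
      rw [intervalIntegral.integral_sub (Continuous.intervalIntegrable (by fun_prop) _ _)
        (Continuous.intervalIntegrable (by fun_prop) _ _), hw η hη hηp, hweak η hη hηp, sub_self]
  refine ⟨V, ⟨hp, hlimit.periodic_deriv, fun x => ?_, hlimit.continuous_deriv, hκ,
    hlimit.eq_integral⟩⟩
  have e : g = fun x => G' x + ∫ x in (0 : ℝ)..1, (g x - G' x) := by
    ext1 x
    rw [← hconst x]; abel
  rw [e]
  exact (hlimit.hasDerivAt x).add_const _

end SmoothApproximation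

/-! ### Approximation of finite energy curves by smooth immersed curves -/

section FiniteEnergyCurves

variable {g v κ c₀ a₀ b₀ c₁ a₁ b₁ : ℝ → Euc n} {ℓ δ lam : ℝ}

lemma H2Curve.affine (h₀ : H2Curve c₀ a₀ b₀) (h₁ : H2Curve c₁ a₁ b₁) (t : ℝ) :
    H2Curve (fun x => c₀ x + t • (c₁ x - c₀ x)) (fun x => a₀ x + t • (a₁ x - a₀ x))
      (fun x => b₀ x + t • (b₁ x - b₀ x)) :=
  h₀.add_smul (h₁.sub h₀) t

/-- The error is a convex combination of the two end errors, and (1 − t)² + t² ≤ 1. -/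
lemma sqNorm_sub_affine_le (hκ : MemLp κ 2 circleMeasure) (h₀ : MemLp b₀ 2 circleMeasure)
    (h₁ : MemLp b₁ 2 circleMeasure) (d₀ : sqNorm (fun x => κ x - b₀ x) ≤ δ)
    (d₁ : sqNorm (fun x => κ x - b₁ x) ≤ δ) {t : ℝ} (ht : t ∈ Set.Icc (0 : ℝ) 1) :
    sqNorm (fun x => κ x - (b₀ x + t • (b₁ x - b₀ x))) ≤ 2 * δ := by
  have e : (fun x => κ x - (b₀ x + t • (b₁ x - b₀ x))) =
      fun x => (1 - t) • (κ x - b₀ x) + t • (κ x - b₁ x) := by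
    ext1 x; module
  have m₀ : MemLp (fun x => (1 - t) • (κ x - b₀ x)) 2 circleMeasure :=
    (hκ.sub h₀).const_smul (1 - t)
  have m₁ : MemLp (fun x => t • (κ x - b₁ x)) 2 circleMeasure := (hκ.sub h₁).const_smul t
  have hδ : 0 ≤ δ := (sqNorm_nonneg _).trans d₀
  rw [e]
  refine (sqNorm_add_le m₀ m₁).trans ?_
  rw [sqNorm_smul, sqNorm_smul]
  have h1 : (1 - t) ^ 2 * sqNorm (fun x => κ x - b₀ x) ≤ (1 - t) ^ 2 * δ := by gcongr
  have h2 : t ^ 2 * sqNorm (fun x => κ x - b₁ x) ≤ t ^ 2 * δ := by gcongr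
  nlinarith [mul_nonneg (mul_nonneg ht.1 (sub_nonneg.2 ht.2)) hδ]

lemma sqNorm_le_of_sub {f : ℝ → Euc n} (hκ : MemLp κ 2 circleMeasure) (hf : MemLp f 2 circleMeasure)
    (h : sqNorm (fun x => κ x - f x) ≤ δ) : sqNorm f ≤ 2 * sqNorm κ + 2 * δ := by
  have m : MemLp (fun x => (-1 : ℝ) • (κ x - f x)) 2 circleMeasure :=
    (hκ.sub hf).const_smul (-1 : ℝ)
  have e : f = fun x => κ x + (-1 : ℝ) • (κ x - f x) := by ext1 x; module
  have h1 := sqNorm_add_le hκ m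
  rw [sqNorm_smul, ← e] at h1
  linarith

lemma sqNorm_sub_le (hκ : MemLp κ 2 circleMeasure) (h₀ : MemLp b₀ 2 circleMeasure)
    (h₁ : MemLp b₁ 2 circleMeasure) (d₀ : sqNorm (fun x => κ x - b₀ x) ≤ δ)
    (d₁ : sqNorm (fun x => κ x - b₁ x) ≤ δ) : sqNorm (fun x => b₁ x - b₀ x) ≤ 4 * δ := by
  have m : MemLp (fun x => (-1 : ℝ) • (κ x - b₁ x)) 2 circleMeasure :=
    (hκ.sub h₁).const_smul (-1 : ℝ)
  have e : (fun x => b₁ x - b₀ x) = fun x => (κ x - b₀ x) + (-1 : ℝ) • (κ x - b₁ x) := by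
    ext1 x; module
  have h := sqNorm_add_le (hκ.sub h₀) m
  rw [sqNorm_smul] at h
  rw [e]
  refine h.trans ?_
  change 2 * sqNorm (fun x => κ x - b₀ x) + _ ≤ _
  linarith

/-- Along the homotopy the derivative differs from v by at most √(2δ) ≤ ℓ/2; this is what the
condition 8δ ≤ ℓ² is for. -/
lemma norm_affine_deriv_mem (hg : H2Curve g v κ) (hℓ : 0 < ℓ) (hv : ∀ x, ‖v x‖ = ℓ)
    (h₀ : H2Curve c₀ a₀ b₀) (h₁ : H2Curve c₁ a₁ b₁) (d₀ : sqNorm (fun x => κ x - b₀ x) ≤ δ)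
    (d₁ : sqNorm (fun x => κ x - b₁ x) ≤ δ) (hδ : 8 * δ ≤ ℓ ^ 2) {t : ℝ}
    (ht : t ∈ Set.Icc (0 : ℝ) 1) (x : ℝ) :
    ‖a₀ x + t • (a₁ x - a₀ x)‖ ∈ Set.Icc (ℓ / 2) (3 * ℓ / 2) := by
  have h := (hg.sub (h₀.affine h₁ t)).norm_deriv_le x
  have h2 : √(sqNorm fun x => κ x - (b₀ x + t • (b₁ x - b₀ x))) ≤ ℓ / 2 := by
    rw [Real.sqrt_le_left (by positivity)]
    linarith [sqNorm_sub_affine_le hg.memLp h₀.memLp h₁.memLp d₀ d₁ ht]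
  have h3 := norm_sub_norm_le (v x) (a₀ x + t • (a₁ x - a₀ x))
  have h4 := norm_sub_norm_le (a₀ x + t • (a₁ x - a₀ x)) (v x)
  rw [norm_sub_rev] at h4
  rw [hv] at h3 h4
  constructor <;> linarith

/-- The linear homotopy between two `H²` curves close to a curve of constant speed is short. -/
lemma pathLength_affine_near_le (hlam : 0 < lam) (hg : H2Curve g v κ) (hℓ : 0 < ℓ)
    (hv : ∀ x, ‖v x‖ = ℓ) (h₀ : H2Curve c₀ a₀ b₀) (h₁ : H2Curve c₁ a₁ b₁) (h : c₀ 0 = c₁ 0)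
    (d₀ : sqNorm (fun x => κ x - b₀ x) ≤ δ) (d₁ : sqNorm (fun x => κ x - b₁ x) ≤ δ)
    (hδ : 8 * δ ≤ ℓ ^ 2) (hδ1 : δ ≤ 1) :
    pathLength lam (fun t x => c₀ x + t • (c₁ x - c₀ x)) ≤ ENNReal.ofReal
      √(comparisonConst lam (ℓ / 2) (3 * ℓ / 2) (2 * sqNorm κ + 4) * (4 * δ)) := by
  refine (pathLength_affine_le hlam (half_pos hℓ) h₀ (h₁.sub h₀) (by simp [h])
    (fun t ht x => (norm_affine_deriv_mem hg hℓ hv h₀ h₁ d₀ d₁ hδ ht x).1)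
    (fun t ht x => (norm_affine_deriv_mem hg hℓ hv h₀ h₁ d₀ d₁ hδ ht x).2)
    (B := 2 * sqNorm κ + 4) fun t ht => ?_).trans ?_
  · have := sqNorm_le_of_sub hg.memLp (h₀.affine h₁ t).memLp
      (sqNorm_sub_affine_le hg.memLp h₀.memLp h₁.memLp d₀ d₁ ht)
    linarith
  · have h1 := sqNorm_nonneg κ
    refine ENNReal.ofReal_le_ofReal (Real.sqrt_le_sqrt (mul_le_mul_of_nonneg_left
      (sqNorm_sub_le hg.memLp h₀.memLp h₁.memLp d₀ d₁)
      (comparisonConst_nonneg hlam (by positivity) (by positivity) (by positivity))))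

lemma geomDist_le_of_affine (s₀ : ContDiff ℝ ∞ c₀) (s₁ : ContDiff ℝ ∞ c₁)
    (h₀ : H2Curve c₀ a₀ b₀) (h₁ : H2Curve c₁ a₁ b₁)
    (hne : ∀ t ∈ Set.Icc (0 : ℝ) 1, ∀ x, a₀ x + t • (a₁ x - a₀ x) ≠ 0) :
    geomDist lam c₀ c₁ ≤ pathLength lam (fun t x => c₀ x + t • (c₁ x - c₀ x)) := by
  refine iInf_le_of_le (fun t x => c₀ x + t • (c₁ x - c₀ x)) <| iInf_le_of_le (fun u => u) <|
    iInf_le_of_le ⟨?_, fun t ht => ⟨?_, (h₀.affine h₁ t).periodic, fun x => ?_⟩⟩ <|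
    iInf_le_of_le IsCircleDiffeo.id <| iInf_le_of_le (fun u => by simp) <|
    iInf_le_of_le (fun u => by simp) le_rfl
  · exact (s₀.comp contDiff_snd).add
      (contDiff_fst.smul ((s₁.comp contDiff_snd).sub (s₀.comp contDiff_snd)))
  · exact s₀.add (ContDiff.const_smul t (s₁.sub s₀))
  · rw [(h₀.affine h₁ t).deriv_eq]
    exact hne t ht x

/-- The homotopy is affine in t, also as a path of second derivatives in L², hence C¹. -/
lemma isH2Path_affine (h₀ : H2Curve c₀ a₀ b₀) (h₁ : H2Curve c₁ a₁ b₁)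
    (hne : ∀ t ∈ Set.Icc (0 : ℝ) 1, ∀ x, a₀ x + t • (a₁ x - a₀ x) ≠ 0) :
    IsH2Path (fun t x => c₀ x + t • (c₁ x - c₀ x)) where
  periodic t _ := (h₀.affine h₁ t).periodic
  contDiff t _ := by
    have h := h₀.affine h₁ t
    refine contDiff_one_iff_deriv.2 ⟨fun x => (h.hasDerivAt x).differentiableAt, ?_⟩
    rw [h.deriv_eq]
    exact h.continuous_deriv
  immersed t ht x := by
    rw [(h₀.affine h₁ t).deriv_eq]
    exact hne t ht x
  c1_value := (contDiff_const.add (contDiff_id.smul contDiff_const)).contDiffOn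
  c1_deriv := by
    simp only [fun t => (h₀.affine h₁ t).deriv_eq]
    exact (contDiff_const.add (contDiff_id.smul contDiff_const)).contDiffOn
  c1_second := by
    have hd := (h₁.sub h₀).memLp
    refine ⟨fun t => h₀.memLp.toLp b₀ + t • hd.toLp _,
      (contDiff_const.add (contDiff_id.smul contDiff_const)).contDiffOn, fun t _ x hx => ?_⟩
    have h := h₀.affine h₁ t
    rw [h.deriv_eq]
    refine (h.eq_integral x hx).trans (congrArg _ ?_)
    rw [intervalIntegral.integral_of_le hx.1, intervalIntegral.integral_of_le hx.1]
    refine integral_congr_ae (ae_restrict_of_ae_restrict_of_subset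
      (Set.Ioc_subset_Ioc_right hx.2) ?_)
    filter_upwards [Lp.coeFn_add (h₀.memLp.toLp b₀) (t • hd.toLp _),
      Lp.coeFn_smul t (hd.toLp _), h₀.memLp.coeFn_toLp, hd.coeFn_toLp] with s e1 e2 e3 e4
    rw [e1, Pi.add_apply, e2, Pi.smul_apply, e3, e4]

lemma IsReparam.id : IsReparam (fun u => u) :=
  ⟨continuous_id, Or.inl ⟨monotone_id, fun _ => rfl⟩⟩

/-- The monotone map σ, possibly with flat pieces, is absorbed into the definition of the distance:
the homotopy itself starts at the regular representative c₀. -/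
lemma extGeomDist_le_of_affine {c : ℝ → Euc n} {σ : ℝ → ℝ} (hσ : IsReparam σ)
    (hc : ∀ u, c u = c₀ (σ u)) (h₀ : H2Curve c₀ a₀ b₀) (h₁ : H2Curve c₁ a₁ b₁)
    (hne : ∀ t ∈ Set.Icc (0 : ℝ) 1, ∀ x, a₀ x + t • (a₁ x - a₀ x) ≠ 0) :
    extGeomDist lam c c₁ ≤ pathLength lam (fun t x => c₀ x + t • (c₁ x - c₀ x)) :=
  iInf_le_of_le (fun t x => c₀ x + t • (c₁ x - c₀ x)) <| iInf_le_of_le σ <|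
    iInf_le_of_le (fun u => u) <| iInf_le_of_le (isH2Path_affine h₀ h₁ hne) <|
    iInf_le_of_le hσ <| iInf_le_of_le IsReparam.id <|
    iInf_le_of_le (fun u => by simp [hc]) <| iInf_le_of_le (fun u => by simp) le_rfl

/-- A curve of finite energy is, up to a monotone reparametrization, an `H²` curve of constant
speed. -/
lemma HasFiniteEnergy.exists_H2Curve {c : ℝ → Euc n} (hc : HasFiniteEnergy c) :
    ∃ (ℓ : ℝ) (g v κ : ℝ → Euc n) (σ : ℝ → ℝ), 0 < ℓ ∧ H2Curve g v κ ∧ (∀ x, ‖v x‖ = ℓ) ∧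
      IsReparam σ ∧ ∀ u, c u = g (σ u) := by
  obtain ⟨ℓ, γ, κ, hγ, hκ, hE⟩ := hc
  obtain ⟨σ, hσ, hcσ⟩ := hγ.reparam
  have hℓ := hγ.pos
  have hm : MemLp (fun x => ℓ ^ 2 • κ (ℓ * x)) 2 circleMeasure :=
    ((weakEnergy_lt_top_iff hℓ hκ.measurable).1 hE).const_smul (ℓ ^ 2)
  obtain ⟨v, hv⟩ := exists_H2Curve_of_weak (g := fun x => γ (ℓ * x))
    (hγ.lipschitz.continuous.comp (continuous_const.mul continuous_id))
    (fun x => by simp only [mul_add, mul_one, hγ.periodic (ℓ * x)]) hm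
    ((weak_iff_scale hℓ γ κ).1 hκ.weak)
  refine ⟨ℓ, fun x => γ (ℓ * x), v, _, σ, hℓ, hv, fun x => ?_, hσ, hcσ⟩
  have hd : ∀ s, HasDerivAt γ (ℓ⁻¹ • v (s / ℓ)) s := fun s => by
    have h := (hv.hasDerivAt (s / ℓ)).scomp s ((hasDerivAt_id s).div_const ℓ)
    refine HasDerivAt.congr_deriv (f := γ) (h.congr_of_eventuallyEq
      (Eventually.of_forall fun y => ?_)) (by simp)
    simp [mul_div_cancel₀ _ hℓ.ne']
  -- Unit speed is assumed almost everywhere only; continuity of v gives it everywhere.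
  have hn : (fun s => ‖ℓ⁻¹ • v (s / ℓ)‖) = fun _ => 1 := by
    refine (Continuous.ae_eq_iff_eq volume ?_ continuous_const).1 ?_
    · exact ((hv.continuous_deriv.comp (continuous_id.div_const ℓ)).const_smul ℓ⁻¹).norm
    · filter_upwards [hγ.unit_speed] with s hs
      rwa [(hd s).deriv] at hs
  have := congrFun hn (ℓ * x)
  simp only [mul_div_cancel_left₀ _ hℓ.ne', norm_smul, norm_inv, Real.norm_eq_abs,
    abs_of_pos hℓ] at this
  field_simp at this
  exact this

/-- Curves of finite energy are limits of smooth curves. -/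
theorem HasFiniteEnergy.exists_approximation (hlam : 0 < lam) {c : ℝ → Euc n}
    (hc : HasFiniteEnergy c) :
    ∃ u : ℕ → ℝ → Euc n, (∀ k, IsImmersedCurve (u k)) ∧
      Tendsto (fun k => extGeomDist lam c (u k)) atTop (𝓝 0) ∧
      IsCauchyH2 lam u ∧ ConvergesToCurve u c := by
  obtain ⟨ℓ, g, v, κ, σ, hℓ, hg, hv, hσ, hcσ⟩ := hc.exists_H2Curve
  set ε : ℕ → ℝ := fun k => 1 / ((k : ℝ) + 1) with hε_def
  have hε : ∀ k, 0 < ε k := fun k => by positivity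
  have hε1 : ∀ k, ε k ≤ 1 := fun k => by
    rw [hε_def]; simp only; rw [div_le_one (by positivity)]
    linarith [(k.cast_nonneg : (0 : ℝ) ≤ k)]
  have hεanti : Antitone ε := fun k m hkm => one_div_le_one_div_of_le (by positivity)
    (by gcongr)
  have hεlim : Tendsto ε atTop (𝓝 0) := tendsto_one_div_add_atTop_nhds_zero_nat
  -- The tolerances δ k = θ/(k + 1) satisfy both smallness conditions on linear homotopies, 8δ ≤ ℓ²
  -- and δ ≤ 1, for every k.
  set θ : ℝ := min (ℓ ^ 2 / 8) 1 with hθ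
  have hθ0 : 0 < θ := lt_min (by positivity) one_pos
  have hθℓ : 8 * θ ≤ ℓ ^ 2 := by linarith [min_le_left (ℓ ^ 2 / 8) 1]
  have hθ1 : θ ≤ 1 := min_le_right _ _
  set δ : ℕ → ℝ := fun k => θ * ε k with hδ_def
  have hδ0 : ∀ k, 0 < δ k := fun k => mul_pos hθ0 (hε k)
  have hδθ : ∀ k, δ k ≤ θ := fun k => mul_le_of_le_one_right hθ0.le (hε1 k)
  have hδℓ : ∀ k, 8 * δ k ≤ ℓ ^ 2 := fun k => by linarith [hδθ k]
  have hδ1 : ∀ k, δ k ≤ 1 := fun k => (hδθ k).trans hθ1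
  have hδanti : Antitone δ := fun k m hkm => mul_le_mul_of_nonneg_left (hεanti hkm) hθ0.le
  have hδlim : Tendsto δ atTop (𝓝 0) := by simpa using hεlim.const_mul θ
  choose G q hG hq hGq hG0 hGδ using fun k =>
    exists_smooth_H2Curve_near hg.memLp hg.integral_eq_zero (g 0) (hδ0 k)
  -- With error zero, g itself may be an end of the homotopy.
  have hself : ∀ k, sqNorm (fun x => κ x - κ x) ≤ δ k := fun k => by
    simpa [sqNorm] using (hδ0 k).le
  have hne : ∀ {d c₀ a₀ b₀ c₁ a₁ b₁}, H2Curve c₀ a₀ b₀ → H2Curve c₁ a₁ b₁ →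
      sqNorm (fun x => κ x - b₀ x) ≤ d → sqNorm (fun x => κ x - b₁ x) ≤ d → 8 * d ≤ ℓ ^ 2 →
      ∀ t ∈ Set.Icc (0 : ℝ) 1, ∀ x, a₀ x + t • (a₁ x - a₀ x) ≠ 0 :=
    fun h₀ h₁ d₀ d₁ hd t ht x => norm_pos_iff.1 ((half_pos hℓ).trans_le
      (norm_affine_deriv_mem hg hℓ hv h₀ h₁ d₀ d₁ hd ht x).1)
  set K : ℝ := comparisonConst lam (ℓ / 2) (3 * ℓ / 2) (2 * sqNorm κ + 4)
  have hlim : Tendsto (fun k => ENNReal.ofReal √(K * (4 * δ k))) atTop (𝓝 0) := by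
    have h1 : Tendsto (fun k => K * (4 * δ k)) atTop (𝓝 0) := by
      simpa using (hδlim.const_mul 4).const_mul K
    have h2 := ENNReal.tendsto_ofReal ((Real.continuous_sqrt.tendsto 0).comp h1)
    rwa [Real.sqrt_zero, ENNReal.ofReal_zero] at h2
  refine ⟨G, fun k => ⟨hG k, (hGq k).periodic, fun x => ?_⟩, ?_, fun r hr => ?_, ?_⟩
  · have := hne (hGq k) (hGq k) (hGδ k) (hGδ k) (hδℓ k) 0 (by simp) x
    simpa using this
  · refine tendsto_of_tendsto_of_tendsto_of_le_of_le tendsto_const_nhds hlim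
      (fun _ => bot_le) fun k => ?_
    exact (extGeomDist_le_of_affine hσ hcσ hg (hGq k)
      (hne hg (hGq k) (hself k) (hGδ k) (hδℓ k))).trans
      (pathLength_affine_near_le hlam hg hℓ hv hg (hGq k) (hG0 k).symm (hself k) (hGδ k)
        (hδℓ k) (hδ1 k))
  · obtain ⟨N, hN⟩ := eventually_atTop.1 (hlim.eventually (gt_mem_nhds hr))
    refine ⟨N, fun k hk m hm => lt_of_le_of_lt ?_ (hN N le_rfl)⟩
    -- Both curves lie within the common tolerance δ N, so a single bound tending to 0 serves for
    -- all pairs beyond N.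
    have dk := (hGδ k).trans (hδanti hk)
    have dm := (hGδ m).trans (hδanti hm)
    exact (geomDist_le_of_affine (hG k) (hG m) (hGq k) (hGq m)
      (hne (hGq k) (hGq m) dk dm (hδℓ N))).trans
      (pathLength_affine_near_le hlam hg hℓ hv (hGq k) (hGq m) ((hG0 k).trans (hG0 m).symm)
        dk dm (hδℓ N) (hδ1 N))
  -- Convergence to a limit curve asks for diffeomorphisms, so σ is approximated by φ k. The error
  -- splits into √(δ k) from G k − g and ℓ ε k from φ k − σ, as g is ℓ-Lipschitz.
  · choose φ hφ hφσ using fun k => hσ.exists_diffeo_near (hε k)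
    refine ⟨φ, hφ, ?_⟩
    have hb : Tendsto (fun k => √(δ k) + ℓ * ε k) atTop (𝓝 0) := by
      have h2 := (Real.continuous_sqrt.tendsto 0).comp hδlim
      rw [Real.sqrt_zero] at h2
      simpa using h2.add (hεlim.const_mul ℓ)
    rw [Metric.tendstoUniformly_iff]
    intro r hr
    filter_upwards [hb.eventually (gt_mem_nhds hr)] with k hk x
    refine lt_of_le_of_lt ?_ hk
    rw [hcσ, dist_comm, dist_eq_norm]
    have h1 := (hg.sub (hGq k)).norm_le (by simp [hG0]) (φ k x)
    have h2 := convex_univ.norm_image_sub_le_of_norm_hasDerivWithin_le (f := g)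
      (fun y _ => (hg.hasDerivAt y).hasDerivWithinAt) (fun y _ => (hv y).le)
      (Set.mem_univ (σ x)) (Set.mem_univ (φ k x))
    have h3 : ℓ * ‖φ k x - σ x‖ ≤ ℓ * ε k := mul_le_mul_of_nonneg_left (hφσ k x) hℓ.le
    have h4 := h1.trans (Real.sqrt_le_sqrt (hGδ k))
    calc ‖G k (φ k x) - g (σ x)‖
        ≤ ‖G k (φ k x) - g (φ k x)‖ + ‖g (φ k x) - g (σ x)‖ := norm_sub_le_norm_sub_add_norm_sub ..
      _ ≤ _ := by
        rw [norm_sub_rev (G k (φ k x))]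
        linarith

end FiniteEnergyCurves
end

end SobolevCurves

/-! ### The theorem -/

theorem mainTheorem1 (lam : ℝ) (hlam : 0 < lam) :
    -- the elastic energy is locally Lipschitz on `M`; the radius `r` and the factor `K` depend
    -- only on `lam` and on the length of the curve
    (∃ r K : ℝ → ℝ, (∀ ℓ, 0 < ℓ → 0 < r ℓ) ∧
      ∀ n : ℕ, 2 ≤ n → ∀ c c₁ c₂ : ℝ → SobolevCurves.Euc n,
        SobolevCurves.IsImmersedCurve c → SobolevCurves.IsImmersedCurve c₁ →
        SobolevCurves.IsImmersedCurve c₂ →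
        SobolevCurves.geomDist lam c c₁ < ENNReal.ofReal (r (SobolevCurves.len c)) →
        SobolevCurves.geomDist lam c c₂ < ENNReal.ofReal (r (SobolevCurves.len c)) →
        ENNReal.ofReal |SobolevCurves.elasticEnergy c₁ - SobolevCurves.elasticEnergy c₂| ≤
          ENNReal.ofReal (K (SobolevCurves.len c) * (1 + SobolevCurves.elasticEnergy c)) *
            SobolevCurves.geomDist lam c₁ c₂) ∧
    ∀ n : ℕ, 2 ≤ n →
      -- every Cauchy sequence of `M` has a limit curve
      (∀ u : ℕ → ℝ → SobolevCurves.Euc n, (∀ k, SobolevCurves.IsImmersedCurve (u k)) →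
        SobolevCurves.IsCauchyH2 lam u →
        ∃ c : ℝ → SobolevCurves.Euc n, SobolevCurves.IsClosedCurve c ∧
          (∃ A, LipschitzWith A c) ∧ SobolevCurves.ConvergesToCurve u c) ∧
      -- the non-constant curves of the completion have a curvature and finite energy
      (∀ c : ℝ → SobolevCurves.Euc n, SobolevCurves.IsClosedCurve c →
        SobolevCurves.NonConstant c → SobolevCurves.InCompletion lam c →
        SobolevCurves.HasFiniteEnergy c) ∧
      -- the non-constant curves with weak curvature and finite energy are limits of smooth curves
      (∀ c : ℝ → SobolevCurves.Euc n, SobolevCurves.IsClosedCurve c →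
        SobolevCurves.NonConstant c → SobolevCurves.HasFiniteEnergy c →
        ∃ u : ℕ → ℝ → SobolevCurves.Euc n, (∀ k, SobolevCurves.IsImmersedCurve (u k)) ∧
          Filter.Tendsto (fun k => SobolevCurves.extGeomDist lam c (u k)) Filter.atTop
            (nhds 0) ∧
          SobolevCurves.IsCauchyH2 lam u ∧ SobolevCurves.ConvergesToCurve u c) := by
  obtain ⟨r, K, hr, h⟩ := SobolevCurves.elasticEnergy_locally_lipschitz hlam
  exact ⟨⟨r, K, hr, fun n _ => h n⟩, fun n _ =>
    ⟨fun u hu hC => SobolevCurves.exists_limitCurve hlam hu hC,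
      fun c hc hne h => SobolevCurves.hasFiniteEnergy_of_inCompletion hlam hc hne h,
      fun c _ _ h => h.exists_approximation hlam⟩⟩
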